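/- **Theorem 2.30 (Real interpolation of tent spaces: full range).** Let $n\ge 1$. An *exponent* $\mathbf p$ is either finite, $\mathbf p=(p,s)$ with $0<p<\infty$, $s\in\mathbb R$, or infinite, $\mathbf p=(\infty,s;\alpha)$ with $s\in\mathbb R$, $\alpha\ge 0$. Put $\theta(\mathbf p)=s$ in both cases; $i(\mathbf p)=p$, $j(\mathbf p)=1/p$, $r(\mathbf p)=s$ for finite $\mathbf p$; and $i(\mathbf p)=\infty$, $j(\mathbf p)=-\alpha/n$, $r(\mathbf p)=s+\alpha$ for infinite $\mathbf p$. For $0<\eta<1$ let $[\mathbf p,\mathbf q]_\eta$ be the exponent with $j([\mathbf p,\mathbf q]_\eta)=(1-\eta)j(\mathbf p)+\eta j(\mathbf q)$ and $\theta([\mathbf p,\mathbf q]_\eta)=(1-\eta)\theta(\mathbf p)+\eta\theta(\mathbf q)$. For (classes of) measurable functions $f:\mathbb R^{1+n}_+=\{(t,x):t>0,\ x\in\mathbb R^n\}\to\mathbb C^N$ define the tent space $T^{\mathbf p}$ by finiteness of $$\|f\|_{T^{\mathbf p}}=\Big\|x\mapsto\Big(\iint_{|x-y|<t}|t^{-s}f(t,y)|^2\,\frac{dt\,dy}{t^{n+1}}\Big)^{1/2}\Big\|_{L^p(\mathbb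 R^n)}\quad(\mathbf p=(p,s)),$$ $$\|f\|_{T^{\mathbf p}}=\sup_{B}\,r_B^{-\alpha}\Big(\frac1{|B|}\iint_{T(B)}|t^{-s}f(t,y)|^2\,\frac{dy\,dt}{t}\Big)^{1/2}\quad(\mathbf p=(\infty,s;\alpha)),$$ where the supremum is over all balls $B\subset\mathbb R^n$, $r_B$ is the radius of $B$, and $T(B)=\{(t,y):t>0,\ B(y,t)\subseteq B\}$. For $c=(c_0,c_1)$ with $c_0>0$, $c_1>1$ define $Z^{\mathbf p}=Z^{\mathbf p}_c$ by finiteness of $$\|f\|_{Z^{\mathbf p}}=\Big\|(t,x)\mapsto\Big(\frac{1}{|\Omega_c(t,x)|}\iint_{\Omega_c(t,x)}|\tau^{-r(\mathbf p)}f(\tau,y)|^2\,d\tau\,dy\Big)^{1/2}\Big\|_{L^{i(\mathbf p)}(\mathbb R^{1+n}_+,\,dx\,dt/t)},\qquad \Omega_c(t,x)=(c_1^{-1}t,c_1t)\times B(x,c_0t).$$ Let $(X_0,X_1)_{\eta,q}$ denote the real interpolation space, i.e. the set of $f\in X_0+X_1$ for which $t\mapsto t^{-\eta}K(t,f)$ lies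 in $L^q((0,\infty),dt/t)$, with the corresponding quasi-norm, where $K(t,f)=\inf\{\|g\|_{X_0}+t\|h\|_{X_1}: f=g+h\}$. Suppose that $\mathbf p$ and $\mathbf q$ are exponents with $\theta(\mathbf p)\ne\theta(\mathbf q)$ and $j(\mathbf p),j(\mathbf q)\ge 0$, and let $0<\eta<1$. Then, for every choice of $c$, $$(T^{\mathbf p},T^{\mathbf q})_{\eta,p_\eta}=Z^{[\mathbf p,\mathbf q]_\eta},\qquad p_\eta=i([\mathbf p,\mathbf q]_\eta),$$ as sets and with equivalent quasi-norms. -/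

import Mathlib

open MeasureTheory Set
open scoped ENNReal NNReal

noncomputable section

namespace TentZ

/-! ### Exponents -/

/-- An exponent is either finite, `(p, s)` with `0 < p < ∞` and `s ∈ ℝ`, or infinite,
`(∞, s; α)` with `s ∈ ℝ` and `α ≥ 0`. -/
inductive Exponent : Type
  | finite (p : ℝ) (hp : 0 < p) (s : ℝ) : Exponent
  | infinite (s α : ℝ) (hα : 0 ≤ α) : Exponent

namespace Exponent

/-- The integrability index `i(𝐩) ∈ (0, ∞]`. -/
def i : Exponent → ℝ≥0∞
  | finite p _ _ => ENNReal.ofReal p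
  | infinite _ _ _ => ⊤

/-- The regularity index `θ(𝐩)`. -/
def θ : Exponent → ℝ
  | finite _ _ s => s
  | infinite s _ _ => s

/-- The index `j(𝐩)` in dimension `n`: `1 / p` for `(p, s)` and `-α / n` for `(∞, s; α)`. -/
def j (n : ℕ) : Exponent → ℝ
  | finite p _ _ => 1 / p
  | infinite _ α _ => -α / n

/-- The order of the weight in the `Z`-space: `s` for `(p, s)` and `s + α` for `(∞, s; α)`. -/
def r : Exponent → ℝ
  | finite _ _ s => s
  | infinite s α _ => s + α

/-- The exponent with prescribed position `(j, θ)` in the plane (for `n ≥ 1`). -/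
def ofJTheta (n : ℕ) (j θ : ℝ) : Exponent :=
  if h : 0 < j then finite (1 / j) (one_div_pos.mpr h) θ
  else infinite θ (-(n * j))
    (neg_nonneg.mpr (mul_nonpos_of_nonneg_of_nonpos n.cast_nonneg (not_lt.mp h)))

/-- The geometrically interpolating exponent `[𝐩, 𝐪]_η`: the convex combination of `𝐩` and `𝐪`
in the `(j, θ)`-plane. -/
def interp (n : ℕ) (p q : Exponent) (η : ℝ) : Exponent :=
  ofJTheta n ((1 - η) * p.j n + η * q.j n) ((1 - η) * p.θ + η * q.θ)

end Exponent

/-! ### Functions on the upper half-space -/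

/-- `ℝ × ℝⁿ`, with points written `(t, x)`. -/
abbrev Space (n : ℕ) : Type := ℝ × EuclideanSpace ℝ (Fin n)

/-- Lebesgue measure `dt dx` on the upper half-space `{(t, x) : t > 0}`. -/
def halfSpace (n : ℕ) : Measure (Space n) := volume.restrict {z | 0 < z.1}

/-- `L⁰` of the upper half-space: classes modulo a.e. equality of (strongly) measurable functions
with values in `ℂ^N`. -/
abbrev L0 (n N : ℕ) : Type := Space n →ₘ[halfSpace n] EuclideanSpace ℂ (Fin N)

/-- `(κ^a f)(t, x) = t^a f(t, x)`. -/
def kappa {n N : ℕ} (a : ℝ) (f : Space n → EuclideanSpace ℂ (Fin N)) :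
    Space n → EuclideanSpace ℂ (Fin N) :=
  fun z => (z.1 ^ a) • f z

/-! ### Tent spaces -/

/-- The cone `Γ(x) = {(t, y) : |x - y| < t}`. -/
def cone {n : ℕ} (x : EuclideanSpace ℝ (Fin n)) : Set (Space n) := {z | dist x z.2 < z.1}

/-- The tent `T(B) = {(t, y) : t > 0, B(y, t) ⊆ B}` over the ball `B = B(x, R)`. -/
def tent {n : ℕ} (x : EuclideanSpace ℝ (Fin n)) (R : ℝ) : Set (Space n) :=
  {z | 0 < z.1 ∧ dist x z.2 + z.1 ≤ R}

/-- `𝒜 f (x) = (∬_{Γ(x)} |f(t, y)|² dt dy / t^{n+1})^{1/2}`. -/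
def areaFn {n N : ℕ} (f : Space n → EuclideanSpace ℂ (Fin N)) (x : EuclideanSpace ℝ (Fin n)) :
    ℝ≥0∞ :=
  (∫⁻ z in cone x, ‖f z‖ₑ ^ 2 / ENNReal.ofReal (z.1 ^ (n + 1))) ^ (1 / 2 : ℝ)

/-- `sup_B r_B^{-α} (|B|⁻¹ ∬_{T(B)} |f(t, y)|² dy dt / t)^{1/2}`, over all balls `B` of `ℝⁿ`. -/
def carlesonNorm {n N : ℕ} (α : ℝ) (f : Space n → EuclideanSpace ℂ (Fin N)) : ℝ≥0∞ :=
  ⨆ (x : EuclideanSpace ℝ (Fin n)) (R : ℝ) (_ : 0 < R),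
    ENNReal.ofReal (R ^ (-α)) *
      ((volume (Metric.ball x R))⁻¹ *
        ∫⁻ z in tent x R, ‖f z‖ₑ ^ 2 / ENNReal.ofReal z.1) ^ (1 / 2 : ℝ)

/-- The quasi-norm of `T^𝐩`, with value `∞` off the space: `‖𝒜(κ^{-s} f)‖_{L^p(ℝⁿ)}` for
`𝐩 = (p, s)` and the Carleson norm of order `α` of `κ^{-s} f` for `𝐩 = (∞, s; α)`. -/
def tentNorm {n N : ℕ} : Exponent → L0 n N → ℝ≥0∞
  | .finite p _ s, f => eLpNorm (areaFn (kappa (-s) f)) (ENNReal.ofReal p) volume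
  | .infinite s α _, f => carlesonNorm α (kappa (-s) f)

/-! ### `Z`-spaces -/

/-- The Whitney region `Ω_c(t, x) = (t / c₁, c₁ t) × B(x, c₀ t)`. -/
def whitney {n : ℕ} (c₀ c₁ : ℝ) (z : Space n) : Set (Space n) :=
  Ioo (z.1 / c₁) (c₁ * z.1) ×ˢ Metric.ball z.2 (c₀ * z.1)

/-- The `L²` Whitney average of `f` over `Ω_c(t, x)`, with respect to Lebesgue measure. -/
def whitneyAvg {n N : ℕ} (c₀ c₁ : ℝ) (f : Space n → EuclideanSpace ℂ (Fin N)) (z : Space n) :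
    ℝ≥0∞ :=
  (⨍⁻ w in whitney c₀ c₁ z, ‖f w‖ₑ ^ 2 ∂volume) ^ (1 / 2 : ℝ)

/-- The measure `dx dt / t` on the upper half-space. -/
def halfSpaceHaar (n : ℕ) : Measure (Space n) :=
  (halfSpace n).withDensity fun z => ENNReal.ofReal z.1⁻¹

/-- The quasi-norm of `Z^𝐩_c`, with value `∞` off the space:
`‖W_c(κ^{-r(𝐩)} f)‖_{L^{i(𝐩)}(dx dt / t)}`. -/
def zNorm {n N : ℕ} (c₀ c₁ : ℝ) (p : Exponent) (f : L0 n N) : ℝ≥0∞ :=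
  eLpNorm (whitneyAvg c₀ c₁ (kappa (-p.r) f)) p.i (halfSpaceHaar n)

/-- The space `Z^𝐩_c`. -/
def zSpace {n N : ℕ} (c₀ c₁ : ℝ) (p : Exponent) : Set (L0 n N) := {f | zNorm c₀ c₁ p f < ⊤}

/-! ### Real interpolation -/

section Real

variable {V : Type*} [AddCommGroup V]

/-- Peetre's `K`-functional of the couple `X₀ = {N₀ < ∞}`, `X₁ = {N₁ < ∞}` of subspaces of `V` with
(extended) quasi-norms `N₀`, `N₁`; its value is `∞` off `X₀ + X₁`. -/
def kFunctional (N₀ N₁ : V → ℝ≥0∞) (t : ℝ) (f : V) : ℝ≥0∞ :=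
  ⨅ (g : V) (h : V) (_ : g + h = f), N₀ g + ENNReal.ofReal t * N₁ h

/-- The quasi-norm of `(X₀, X₁)_{η,q}`: the `L^q((0, ∞), dt / t)` quasi-norm of
`t ↦ t^{-η} K(t, f)`. -/
def realInterpNorm (N₀ N₁ : V → ℝ≥0∞) (η : ℝ) (q : ℝ≥0∞) (f : V) : ℝ≥0∞ :=
  eLpNorm (fun t : ℝ => ENNReal.ofReal (t ^ (-η)) * kFunctional N₀ N₁ t f) q
    ((volume.restrict (Ioi (0 : ℝ))).withDensity fun t => ENNReal.ofReal t⁻¹)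

/-- The real interpolation space `(X₀, X₁)_{η,q}`: the elements of `X₀ + X₁` whose interpolation
quasi-norm is finite. -/
def realInterpSpace (N₀ N₁ : V → ℝ≥0∞) (η : ℝ) (q : ℝ≥0∞) : Set V :=
  {f | (∃ g h, N₀ g < ⊤ ∧ N₁ h < ⊤ ∧ g + h = f) ∧ realInterpNorm N₀ N₁ η q f < ⊤}

end Real

end TentZ

end

noncomputable section

namespace TentZ

/-! ### Inequalities for sums and integrals with values in `[0, ∞]` -/

section Sums

variable {ι : Type*}

theorem tsum_rpow_le_rpow_tsum (x : ι → ℝ≥0∞) {s : ℝ} (hs : 1 ≤ s) :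
    ∑' i, x i ^ s ≤ (∑' i, x i) ^ s := by
  have key : ∀ y : ℝ≥0∞, y ^ s = y * y ^ (s - 1) := by
    intro y
    conv_rhs => rw [← ENNReal.rpow_one y, ← ENNReal.rpow_mul, one_mul,
      ← ENNReal.rpow_add_of_nonneg _ _ zero_le_one (by linarith)]
    ring_nf
  rw [key (∑' i, x i), ← ENNReal.tsum_mul_right]
  refine ENNReal.tsum_le_tsum fun i => ?_
  rw [key]
  gcongr
  exact ENNReal.le_tsum i

theorem rpow_tsum_le_tsum_rpow (x : ι → ℝ≥0∞) {s : ℝ} (hs₀ : 0 < s) (hs : s ≤ 1) :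
    (∑' i, x i) ^ s ≤ ∑' i, x i ^ s := by
  have h := tsum_rpow_le_rpow_tsum (fun i => x i ^ s) (s := 1 / s) (by rwa [le_div_iff₀ hs₀, one_mul])
  simp only [← ENNReal.rpow_mul, mul_one_div_cancel hs₀.ne', ENNReal.rpow_one] at h
  calc (∑' i, x i) ^ s ≤ ((∑' i, x i ^ s) ^ (1 / s)) ^ s := by gcongr
    _ = _ := by rw [← ENNReal.rpow_mul, one_div_mul_cancel hs₀.ne', ENNReal.rpow_one]

/-- Jensen's inequality for weighted sums. -/
theorem rpow_tsum_mul_le [Countable ι] (κ v : ι → ℝ≥0∞) {P : ℝ} (hP : 1 ≤ P) :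
    (∑' i, κ i * v i) ^ P ≤ (∑' i, κ i) ^ (P - 1) * ∑' i, κ i * v i ^ P := by
  rcases hP.eq_or_lt with rfl | hP
  · simp
  have hP0 : 0 < P := by linarith
  have hpq : P.HolderConjugate P.conjExponent := Real.HolderConjugate.conjExponent hP
  let _ : MeasurableSpace ι := ⊤
  have hq0 := hpq.symm.pos
  have h := ENNReal.lintegral_mul_le_Lp_mul_Lq (Measure.count : Measure ι) hpq
    (f := fun i => κ i ^ (1 / P) * v i) (g := fun i => κ i ^ (1 / P.conjExponent))
    (Measurable.of_discrete).aemeasurable (Measurable.of_discrete).aemeasurable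
  simp only [lintegral_count, Pi.mul_apply] at h
  have e1 : ∀ i, κ i ^ (1 / P) * v i * κ i ^ (1 / P.conjExponent) = κ i * v i := by
    intro i
    rw [mul_right_comm, ← ENNReal.rpow_add_of_nonneg _ _ (by positivity) (by positivity)]
    have : 1 / P + 1 / P.conjExponent = 1 := by
      simpa [one_div] using hpq.inv_add_inv_eq_one
    rw [this, ENNReal.rpow_one]
  have e2 : ∀ i, (κ i ^ (1 / P) * v i) ^ P = κ i * v i ^ P := by
    intro i
    rw [ENNReal.mul_rpow_of_nonneg _ _ hP0.le, ← ENNReal.rpow_mul, one_div_mul_cancel hP0.ne',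
      ENNReal.rpow_one]
  have e3 : ∀ i, (κ i ^ (1 / P.conjExponent)) ^ P.conjExponent = κ i := by
    intro i
    rw [← ENNReal.rpow_mul, one_div_mul_cancel hq0.ne', ENNReal.rpow_one]
  simp only [e1, e2, e3] at h
  calc (∑' i, κ i * v i) ^ P
      ≤ ((∑' i, κ i * v i ^ P) ^ (1 / P) * (∑' i, κ i) ^ (1 / P.conjExponent)) ^ P := by gcongr
    _ = _ := by
      rw [ENNReal.mul_rpow_of_nonneg _ _ hP0.le, ← ENNReal.rpow_mul, one_div_mul_cancel hP0.ne',
        ENNReal.rpow_one, ← ENNReal.rpow_mul, mul_comm]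
      congr 2
      have : P - 1 ≠ 0 := by linarith
      rw [Real.conjExponent]; field_simp

/-- Minkowski's inequality for countable sums. -/
theorem lintegral_tsum_rpow_le [Countable ι] {α : Type*} [MeasurableSpace α] {μ : Measure α}
    {V : ι → α → ℝ≥0∞} (hV : ∀ i, Measurable (V i)) {P : ℝ} (hP : 1 ≤ P) :
    (∫⁻ x, (∑' i, V i x) ^ P ∂μ) ^ (1 / P) ≤ ∑' i, (∫⁻ x, V i x ^ P ∂μ) ^ (1 / P) := by
  have hP0 : 0 < P := by linarith
  have fin : ∀ s : Finset ι, (∫⁻ x, (∑ i ∈ s, V i x) ^ P ∂μ) ^ (1 / P) ≤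
      ∑ i ∈ s, (∫⁻ x, V i x ^ P ∂μ) ^ (1 / P) := by
    classical
    intro s
    induction s using Finset.induction_on with
    | empty => simp [ENNReal.zero_rpow_of_pos hP0, hP0]
    | insert a s ha ih =>
      simp only [Finset.sum_insert ha]
      refine (ENNReal.lintegral_Lp_add_le (hV a).aemeasurable
        (Finset.measurable_fun_sum s fun i _ => hV i).aemeasurable hP).trans ?_
      gcongr
  have h1 : ∀ x, (∑' i, V i x) ^ P = ⨆ s : Finset ι, (∑ i ∈ s, V i x) ^ P := by
    intro x
    rw [ENNReal.tsum_eq_iSup_sum]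
    exact (ENNReal.orderIsoRpow P hP0).map_iSup _
  simp only [h1]
  rw [lintegral_iSup_directed]
  · rw [show ∀ y : ℝ≥0∞, y ^ (1 / P) = ENNReal.orderIsoRpow (1 / P) (by positivity) y from
      fun _ => rfl, OrderIso.map_iSup]
    exact iSup_le fun s => (fin s).trans (ENNReal.sum_le_tsum s)
  · intro s
    exact ((Finset.measurable_fun_sum s fun i _ => hV i).pow_const P).aemeasurable
  · intro s t
    classical
    refine ⟨s ∪ t, fun x => ?_, fun x => ?_⟩ <;> dsimp only <;> gcongr
    · exact Finset.subset_union_left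
    · exact Finset.subset_union_right

theorem lintegral_tsum_sq_rpow_le [Countable ι] {α : Type*} [MeasurableSpace α] {μ : Measure α}
    {V : ι → α → ℝ≥0∞} (hV : ∀ i, Measurable (V i)) {p r : ℝ} (hr : 0 < r) (hr1 : r ≤ 1)
    (hrp : r ≤ p) :
    (∫⁻ x, (∑' i, V i x ^ (2 : ℝ)) ^ (p / 2) ∂μ) ^ (r / p) ≤
      ∑' i, (∫⁻ x, V i x ^ p ∂μ) ^ (r / p) := by
  have hp : 0 < p := by linarith
  have h := lintegral_tsum_rpow_le (μ := μ) (V := fun i x => V i x ^ r)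
    (fun i => (hV i).pow_const r) (P := p / r) (by rwa [le_div_iff₀ hr, one_mul])
  simp only [← ENNReal.rpow_mul, mul_div_cancel₀ p hr.ne', one_div_div] at h
  refine le_trans ?_ h
  gcongr with x
  have h2 := tsum_rpow_le_rpow_tsum (fun i => V i x ^ r) (s := 2 / r)
    (by rw [le_div_iff₀ hr]; linarith)
  simp only [← ENNReal.rpow_mul, mul_div_cancel₀ 2 hr.ne'] at h2
  calc _ ≤ ((∑' i, V i x ^ r) ^ (2 / r)) ^ (p / 2) := by gcongr
    _ = _ := by rw [← ENNReal.rpow_mul]; congr 1; field_simp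

/-- A family of positive numbers any two of which differ by a factor of at least `q⁻¹`. -/
structure Lacunary (q : ℝ≥0∞) (x : ι → ℝ≥0∞) : Prop where
  lt_one : q < 1
  ne_zero : ∀ i, x i ≠ 0
  ne_top : ∀ i, x i ≠ ⊤
  le_or_le : ∀ i j, i ≠ j → x i ≤ q * x j ∨ x j ≤ q * x i

theorem Lacunary.tsum_le {q : ℝ≥0∞} {x : ι → ℝ≥0∞} (h : Lacunary q x) (X : ℝ≥0∞) :
    ∑' i, (if x i ≤ X then x i else 0) ≤ (1 - q)⁻¹ * X := by
  classical
  have hC : (1 - q)⁻¹ = q * (1 - q)⁻¹ + 1 := by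
    have h1 : (1 - q) * (1 - q)⁻¹ = 1 :=
      ENNReal.mul_inv_cancel (tsub_pos_of_lt h.lt_one).ne' (by finiteness)
    calc (1 - q)⁻¹ = (q + (1 - q)) * (1 - q)⁻¹ := by
          rw [add_tsub_cancel_of_le h.lt_one.le, one_mul]
      _ = _ := by rw [add_mul, h1]
  have fin : ∀ (s : Finset ι) (Y : ℝ≥0∞), (∀ i ∈ s, x i ≤ Y) → ∑ i ∈ s, x i ≤ (1 - q)⁻¹ * Y := by
    intro s
    induction s using Finset.induction_on_max_value x with
    | empty => simp
    | insert a s ha hmax ih =>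
      intro Y hY
      rw [Finset.sum_insert ha]
      have h2 : ∀ i ∈ s, x i ≤ q * x a := by
        intro i hi
        rcases h.le_or_le i a (fun e => ha (e ▸ hi)) with h3 | h3
        · exact h3
        · exfalso
          have h4 : x a ≤ q * x a := h3.trans (by gcongr; exact hmax i hi)
          have h5 : q * x a < 1 * x a := by
            rw [ENNReal.mul_lt_mul_iff_left (h.ne_zero a) (h.ne_top a)]; exact h.lt_one
          rw [one_mul] at h5
          exact absurd h4 (not_le.mpr h5)
      calc x a + ∑ i ∈ s, x i ≤ x a + (1 - q)⁻¹ * (q * x a) := by gcongr; exact ih _ h2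
        _ = (1 - q)⁻¹ * x a := by nth_rw 2 [hC]; ring
        _ ≤ _ := by gcongr; exact hY a (Finset.mem_insert_self a s)
  rw [ENNReal.tsum_eq_iSup_sum]
  refine iSup_le fun s => ?_
  rw [← Finset.sum_filter]
  exact fin _ _ fun i hi => (Finset.mem_filter.mp hi).2

theorem Lacunary.rpow {q : ℝ≥0∞} {x : ι → ℝ≥0∞} (h : Lacunary q x) {a : ℝ} (ha : a ≠ 0) :
    Lacunary (q ^ |a|) (fun i => x i ^ a) := by
  refine ⟨ENNReal.rpow_lt_one h.lt_one (abs_pos.mpr ha), fun i => ?_, fun i => ?_, ?_⟩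
  · exact (ENNReal.rpow_pos (pos_iff_ne_zero.mpr (h.ne_zero i)) (h.ne_top i)).ne'
  · exact ENNReal.rpow_ne_top_of_ne_zero (h.ne_zero i) (h.ne_top i)
  · have key : ∀ i j, x i ≤ q * x j → x i ^ |a| ≤ q ^ |a| * x j ^ |a| := by
      intro i j hij
      rw [← ENNReal.mul_rpow_of_nonneg _ _ (abs_nonneg a)]
      gcongr
    intro i j hij
    rcases lt_or_gt_of_ne ha with h0 | h0
    · have key2 : ∀ i j, x i ≤ q * x j → x j ^ a ≤ q ^ |a| * x i ^ a := by
        intro i j hij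
        have h3 := key i j hij
        have e : ∀ k, x k ^ a = (x k ^ |a|)⁻¹ := fun k => by
          rw [abs_of_neg h0, ENNReal.rpow_neg, inv_inv]
        rw [e, e]
        have hj0 : x j ^ |a| ≠ 0 :=
          (ENNReal.rpow_pos (pos_iff_ne_zero.mpr (h.ne_zero j)) (h.ne_top j)).ne'
        have hj1 : x j ^ |a| ≠ ⊤ := ENNReal.rpow_ne_top_of_ne_zero (h.ne_zero j) (h.ne_top j)
        have hi0 : x i ^ |a| ≠ 0 :=
          (ENNReal.rpow_pos (pos_iff_ne_zero.mpr (h.ne_zero i)) (h.ne_top i)).ne'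
        have hi1 : x i ^ |a| ≠ ⊤ := ENNReal.rpow_ne_top_of_ne_zero (h.ne_zero i) (h.ne_top i)
        rw [← div_eq_mul_inv, ENNReal.le_div_iff_mul_le (Or.inl hi0) (Or.inl hi1), mul_comm,
          ← div_eq_mul_inv]
        exact ENNReal.div_le_of_le_mul h3
      exact (h.le_or_le i j hij).symm.imp (key2 j i) (key2 i j)
    · rw [abs_of_pos h0] at key ⊢
      exact (h.le_or_le i j hij).imp (key i j) (key j i)

theorem Lacunary.exists_tsum_rpow_le {q : ℝ≥0∞} (hq : q < 1) {a : ℝ} (ha : a ≠ 0) :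
    ∃ C : ℝ≥0, ∀ (ι : Type) (x : ι → ℝ≥0∞), Lacunary q x → ∀ X : ℝ≥0∞,
      ∑' i, (if x i ^ a ≤ X then x i ^ a else 0) ≤ C * X := by
  have h1 : q ^ |a| < 1 := ENNReal.rpow_lt_one hq (abs_pos.mpr ha)
  refine ⟨((1 - q ^ |a|)⁻¹).toNNReal, fun ι x hx X => ?_⟩
  rw [ENNReal.coe_toNNReal (ENNReal.inv_ne_top.mpr (tsub_pos_of_lt h1).ne')]
  exact (hx.rpow ha).tsum_le X

theorem lacunary_rpow_int {R : ℝ≥0∞} (hR : 1 < R) (hR' : R ≠ ⊤) {m : ℝ} (hm : m ≠ 0) :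
    Lacunary (R ^ (-|m|)) (fun l : ℤ => R ^ ((l : ℝ) * m)) := by
  have hR0 : R ≠ 0 := (zero_lt_one.trans hR).ne'
  have key : ∀ a b : ℤ, a ≠ b → R ^ ((a : ℝ) * m) ≤ R ^ (-|m|) * R ^ ((b : ℝ) * m) ∨
      R ^ ((b : ℝ) * m) ≤ R ^ (-|m|) * R ^ ((a : ℝ) * m) := by
    intro a b hab
    rw [← ENNReal.rpow_add _ _ hR0 hR', ← ENNReal.rpow_add _ _ hR0 hR']
    have h1 : (1 : ℝ) ≤ |(a : ℝ) - b| := by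
      exact_mod_cast Int.one_le_abs (sub_ne_zero.mpr hab)
    have h2 : |m| ≤ |(a : ℝ) * m - b * m| := by
      rw [← sub_mul, abs_mul]; nlinarith [abs_nonneg m]
    rcases le_abs.mp h2 with h | h
    · exact Or.inr (ENNReal.rpow_le_rpow_of_exponent_le hR.le (by linarith))
    · exact Or.inl (ENNReal.rpow_le_rpow_of_exponent_le hR.le (by linarith))
  refine ⟨?_, fun i => ?_, fun i => ?_, key⟩
  · exact ENNReal.rpow_lt_one_of_one_lt_of_neg hR (by simpa using hm)
  · exact (ENNReal.rpow_pos (zero_lt_one.trans hR) hR').ne'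
  · exact ENNReal.rpow_ne_top_of_ne_zero hR0 hR'

end Sums

/-! ### The `K`-functional and sequences -/

section Interp

theorem lintegral_Ioi_rpow {s a : ℝ} (hs : 0 < s) (ha : 0 < a) :
    ∫⁻ t in Ioi s, ENNReal.ofReal (s ^ a * t ^ (-a - 1)) = ENNReal.ofReal (1 / a) := by
  rw [← ofReal_integral_eq_lintegral_ofReal]
  · congr 1
    rw [integral_const_mul, integral_Ioi_rpow_of_lt (by linarith) hs]
    have : s ^ a * s ^ (-a) = 1 := by rw [← Real.rpow_add hs]; simp
    rw [show -a - 1 + 1 = -a by ring]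
    field_simp
    linarith
  · exact (integrableOn_Ioi_rpow_of_lt (by linarith) hs).const_mul _
  · filter_upwards [ae_restrict_mem measurableSet_Ioi] with t ht
    have : 0 < t := hs.trans ht
    positivity

theorem lintegral_Ioc_rpow {s b : ℝ} (hs : 0 < s) (hb : 0 < b) :
    ∫⁻ t in Ioc 0 s, ENNReal.ofReal (s ^ (-b) * t ^ (b - 1)) = ENNReal.ofReal (1 / b) := by
  have hi : IntervalIntegrable (fun t : ℝ => t ^ (b - 1)) volume 0 s :=
    intervalIntegral.intervalIntegrable_rpow' (by linarith)
  rw [← ofReal_integral_eq_lintegral_ofReal]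
  · congr 1
    rw [integral_const_mul, ← intervalIntegral.integral_of_le hs.le,
      integral_rpow (Or.inl (by linarith))]
    have : s ^ b * s ^ (-b) = 1 := by rw [← Real.rpow_add hs]; simp
    rw [show b - 1 + 1 = b by ring, Real.zero_rpow hb.ne']
    field_simp
    linarith
  · exact ((intervalIntegrable_iff_integrableOn_Ioc_of_le hs.le).mp hi).const_mul _
  · filter_upwards [ae_restrict_mem measurableSet_Ioc] with t ht
    have : 0 < t := ht.1
    positivity

/-- The kernel `min((τ / t)^a, (t / τ)^b)`. -/
def kernel (a b : ℝ) (τ t : ℝ≥0∞) : ℝ≥0∞ := if τ ≤ t then (τ / t) ^ a else (t / τ) ^ b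

theorem measurable_kernel (a b : ℝ) (τ : ℝ≥0∞) :
    Measurable fun t : ℝ => kernel a b τ (ENNReal.ofReal t) := by
  unfold kernel
  refine Measurable.ite (measurableSet_le measurable_const ENNReal.measurable_ofReal) ?_ ?_
  · exact (ENNReal.measurable_ofReal.const_div τ).pow_const a
  · exact (ENNReal.measurable_ofReal.div_const τ).pow_const b

theorem lintegral_kernel_le {a b : ℝ} (ha : 0 < a) (hb : 0 < b) {τ : ℝ≥0∞} (h0 : τ ≠ 0)
    (h1 : τ ≠ ⊤) :
    ∫⁻ t in Ioi (0 : ℝ), ENNReal.ofReal t⁻¹ * kernel a b τ (ENNReal.ofReal t) ≤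
      ENNReal.ofReal (1 / a) + ENNReal.ofReal (1 / b) := by
  obtain ⟨s, hs, rfl⟩ : ∃ s : ℝ, 0 < s ∧ ENNReal.ofReal s = τ :=
    ⟨τ.toReal, ENNReal.toReal_pos h0 h1, ENNReal.ofReal_toReal h1⟩
  rw [← lintegral_Ioi_rpow hs ha, ← lintegral_Ioc_rpow hs hb, ← Ioc_union_Ioi_eq_Ioi hs.le, add_comm]
  refine (lintegral_union_le _ _ _).trans (add_le_add ?_ ?_)
  · rw [← setLIntegral_congr Ioo_ae_eq_Ioc, ← setLIntegral_congr Ioo_ae_eq_Ioc]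
    refine setLIntegral_mono' measurableSet_Ioo fun t ht => ?_
    have ht0 : 0 < t := ht.1
    rw [kernel, if_neg, ← ENNReal.ofReal_div_of_pos hs, ENNReal.ofReal_rpow_of_pos (by positivity),
      ← ENNReal.ofReal_mul (by positivity)]
    · apply le_of_eq; congr 1
      rw [Real.div_rpow ht0.le hs.le, Real.rpow_neg hs.le, Real.rpow_sub_one ht0.ne']
      field_simp
    · rw [ENNReal.ofReal_le_ofReal_iff ht0.le]; exact not_le.mpr ht.2
  · refine setLIntegral_mono' measurableSet_Ioi fun t ht => ?_
    have ht0 : 0 < t := hs.trans ht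
    rw [kernel, if_pos (ENNReal.ofReal_le_ofReal (le_of_lt ht)), ← ENNReal.ofReal_div_of_pos ht0,
      ENNReal.ofReal_rpow_of_pos (by positivity), ← ENNReal.ofReal_mul (by positivity)]
    apply le_of_eq; congr 1
    rw [Real.div_rpow hs.le ht0.le, Real.rpow_sub_one ht0.ne', Real.rpow_neg ht0.le]
    field_simp

theorem exists_tsum_kernel_le {q₀ : ℝ≥0∞} (hq₀ : q₀ < 1) {a b : ℝ} (ha : 0 < a) (hb : 0 < b) :
    ∃ C : ℝ≥0, ∀ τ : ℤ → ℝ≥0∞, Lacunary q₀ τ → ∀ t : ℝ≥0∞, t ≠ 0 → t ≠ ⊤ →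
      ∑' j, kernel a b (τ j) t ≤ C := by
  obtain ⟨C₁, h₁⟩ := Lacunary.exists_tsum_rpow_le hq₀ (a := a) ha.ne'
  obtain ⟨C₂, h₂⟩ := Lacunary.exists_tsum_rpow_le hq₀ (a := -b) (by linarith)
  refine ⟨C₁ + C₂, fun τ hτ t ht0 ht1 => ?_⟩
  have e1 := h₁ ℤ τ hτ (t ^ a)
  have e2 := h₂ ℤ τ hτ (t ^ (-b))
  have hta : t ^ a * t ^ (-a) = 1 := by rw [← ENNReal.rpow_add _ _ ht0 ht1]; simp
  have htb : t ^ (-b) * t ^ b = 1 := by rw [← ENNReal.rpow_add _ _ ht0 ht1]; simp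
  calc ∑' j, kernel a b (τ j) t
      ≤ ∑' j, ((if τ j ^ a ≤ t ^ a then τ j ^ a else 0) * t ^ (-a) +
          (if τ j ^ (-b) ≤ t ^ (-b) then τ j ^ (-b) else 0) * t ^ b) := by
        refine ENNReal.tsum_le_tsum fun j => ?_
        unfold kernel
        split_ifs with h3 h4 h5 h6
        · refine le_add_right (le_of_eq ?_)
          rw [ENNReal.div_rpow_of_nonneg _ _ ha.le, ENNReal.rpow_neg]; rfl
        · refine le_add_right (le_of_eq ?_)
          rw [ENNReal.div_rpow_of_nonneg _ _ ha.le, ENNReal.rpow_neg]; rfl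
        · exact absurd (ENNReal.rpow_le_rpow h3 ha.le) h4
        · exact absurd (ENNReal.rpow_le_rpow h3 ha.le) h4
        · refine le_add_left (le_of_eq ?_)
          rw [ENNReal.div_rpow_of_nonneg _ _ hb.le, ENNReal.rpow_neg, mul_comm]; rfl
        · refine absurd ?_ ‹¬ τ j ^ (-b) ≤ t ^ (-b)›
          rw [ENNReal.rpow_neg, ENNReal.rpow_neg]
          exact ENNReal.inv_le_inv.mpr (ENNReal.rpow_le_rpow (not_le.mp h3).le hb.le)
        · refine le_add_left (le_of_eq ?_)
          rw [ENNReal.div_rpow_of_nonneg _ _ hb.le, ENNReal.rpow_neg, mul_comm]; rfl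
        · refine absurd ?_ ‹¬ τ j ^ (-b) ≤ t ^ (-b)›
          rw [ENNReal.rpow_neg, ENNReal.rpow_neg]
          exact ENNReal.inv_le_inv.mpr (ENNReal.rpow_le_rpow (not_le.mp h3).le hb.le)
    _ ≤ C₁ * t ^ a * t ^ (-a) + C₂ * t ^ (-b) * t ^ b := by
        rw [ENNReal.tsum_add, ENNReal.tsum_mul_right, ENNReal.tsum_mul_right]
        gcongr
    _ = _ := by rw [mul_assoc, hta, mul_assoc, htb]; simp

/-- The pointwise bound that turns a lacunary decomposition into a kernel estimate. -/
theorem rpow_mul_le_tsum_kernel {η r : ℝ} (hr : 0 < r) {τ u : ℤ → ℝ≥0∞} {q₀ : ℝ≥0∞}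
    (hτ : Lacunary q₀ τ) {k : ℝ≥0∞} {t : ℝ} (ht : 0 < t)
    (hk : k ^ r ≤ ∑' j, (if τ j ≤ ENNReal.ofReal t then τ j ^ η * u j
      else ENNReal.ofReal t * τ j ^ (η - 1) * u j) ^ r) :
    (ENNReal.ofReal (t ^ (-η)) * k) ^ r ≤
      ∑' j, kernel (η * r) ((1 - η) * r) (τ j) (ENNReal.ofReal t) * u j ^ r := by
  have ht0 : ENNReal.ofReal t ≠ 0 := by simpa using ht
  have ht1 : ENNReal.ofReal t ≠ ⊤ := ENNReal.ofReal_ne_top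
  rw [ENNReal.mul_rpow_of_nonneg _ _ hr.le, ← ENNReal.ofReal_rpow_of_pos ht]
  refine (mul_le_mul_right hk _).trans ?_
  rw [← ENNReal.tsum_mul_left]
  refine ENNReal.tsum_le_tsum fun j => le_of_eq ?_
  rw [← ENNReal.mul_rpow_of_nonneg _ _ hr.le]
  have h0 := hτ.ne_zero j
  have h1 := hτ.ne_top j
  unfold kernel
  split_ifs with h
  · rw [ENNReal.rpow_mul, ← ENNReal.mul_rpow_of_nonneg _ _ hr.le, ← mul_assoc]
    congr 2
    rw [div_eq_mul_inv, ENNReal.mul_rpow_of_ne_top h1 (ENNReal.inv_ne_top.mpr ht0),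
      ENNReal.inv_rpow, ENNReal.rpow_neg, mul_comm]
  · rw [ENNReal.rpow_mul, ← ENNReal.mul_rpow_of_nonneg _ _ hr.le, ← mul_assoc, ← mul_assoc]
    congr 2
    rw [div_eq_mul_inv, ENNReal.mul_rpow_of_ne_top ht1 (ENNReal.inv_ne_top.mpr h0),
      ENNReal.inv_rpow, ← ENNReal.rpow_neg]
    congr 1
    · nth_rw 2 [← ENNReal.rpow_one (ENNReal.ofReal t)]
      rw [← ENNReal.rpow_add _ _ ht0 ht1]; ring_nf
    · ring_nf

theorem exists_lintegral_le_of_lacunary {q₀ : ℝ≥0∞} (hq₀ : q₀ < 1) {η r q : ℝ} (hη₀ : 0 < η)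
    (hη₁ : η < 1) (hr : 0 < r) (hrq : r ≤ q) :
    ∃ C : ℝ≥0, ∀ (τ u : ℤ → ℝ≥0∞) (K : ℝ → ℝ≥0∞), Lacunary q₀ τ →
      (∀ t, 0 < t → K t ^ r ≤ ∑' j, (if τ j ≤ ENNReal.ofReal t then τ j ^ η * u j
        else ENNReal.ofReal t * τ j ^ (η - 1) * u j) ^ r) →
      ∫⁻ t in Ioi (0 : ℝ), ENNReal.ofReal t⁻¹ * (ENNReal.ofReal (t ^ (-η)) * K t) ^ q ≤
        C * ∑' j, u j ^ q := by
  have ha : 0 < η * r := by positivity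
  have hb : 0 < (1 - η) * r := mul_pos (by linarith) hr
  have hP : 1 ≤ q / r := by rwa [le_div_iff₀ hr, one_mul]
  obtain ⟨C₁, hC₁⟩ := exists_tsum_kernel_le hq₀ ha hb
  refine ⟨C₁ ^ (q / r - 1) * (Real.toNNReal (1 / (η * r)) + Real.toNNReal (1 / ((1 - η) * r))),
    fun τ u K hτ hK => ?_⟩
  calc ∫⁻ t in Ioi (0 : ℝ), ENNReal.ofReal t⁻¹ * (ENNReal.ofReal (t ^ (-η)) * K t) ^ q
      ≤ ∫⁻ t in Ioi (0 : ℝ), ∑' j, C₁ ^ (q / r - 1) * u j ^ q * (ENNReal.ofReal t⁻¹ *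
          kernel (η * r) ((1 - η) * r) (τ j) (ENNReal.ofReal t)) := by
        refine setLIntegral_mono' measurableSet_Ioi fun t ht => ?_
        have ht0 : ENNReal.ofReal t ≠ 0 := by simpa using ht
        have h1 := rpow_mul_le_tsum_kernel hr hτ ht (hK t ht)
        have h2 := ENNReal.rpow_le_rpow h1 (zero_le_one.trans hP)
        rw [← ENNReal.rpow_mul, mul_div_cancel₀ _ hr.ne'] at h2
        have h3 := h2.trans (rpow_tsum_mul_le _ _ hP)
        calc _ ≤ ENNReal.ofReal t⁻¹ * ((C₁ : ℝ≥0∞) ^ (q / r - 1) *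
              ∑' j, kernel (η * r) ((1 - η) * r) (τ j) (ENNReal.ofReal t) *
                (u j ^ r) ^ (q / r)) := by
              refine mul_le_mul_right (h3.trans ?_) _
              gcongr
              exact hC₁ τ hτ _ ht0 ENNReal.ofReal_ne_top
          _ = _ := by
              rw [← ENNReal.tsum_mul_left, ← ENNReal.tsum_mul_left]
              congr 1; ext j
              rw [← ENNReal.rpow_mul, mul_div_cancel₀ _ hr.ne']
              ring
    _ = ∑' j, C₁ ^ (q / r - 1) * u j ^ q * ∫⁻ t in Ioi (0 : ℝ), ENNReal.ofReal t⁻¹ *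
          kernel (η * r) ((1 - η) * r) (τ j) (ENNReal.ofReal t) := by
        have hm : ∀ j, Measurable fun t : ℝ => ENNReal.ofReal t⁻¹ *
          kernel (η * r) ((1 - η) * r) (τ j) (ENNReal.ofReal t) := fun j =>
          (ENNReal.measurable_ofReal.comp measurable_inv).mul (measurable_kernel _ _ _)
        rw [lintegral_tsum fun j => ((hm j).const_mul _).aemeasurable]
        congr 1; ext j
        rw [lintegral_const_mul _ (hm j)]
    _ ≤ ∑' j, C₁ ^ (q / r - 1) * u j ^ q *
          (ENNReal.ofReal (1 / (η * r)) + ENNReal.ofReal (1 / ((1 - η) * r))) := by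
        gcongr with j
        exact lintegral_kernel_le ha hb (hτ.ne_zero j) (hτ.ne_top j)
    _ = _ := by
        rw [ENNReal.tsum_mul_right, ENNReal.tsum_mul_left, ENNReal.coe_mul,
          ENNReal.coe_rpow_of_nonneg _ (by linarith : 0 ≤ q / r - 1), ENNReal.coe_add]
        simp only [ENNReal.ofReal]
        ring

theorem exists_le_of_lacunary {q₀ : ℝ≥0∞} (hq₀ : q₀ < 1) {η r : ℝ} (hη₀ : 0 < η)
    (hη₁ : η < 1) (hr : 0 < r) :
    ∃ C : ℝ≥0, ∀ (τ u : ℤ → ℝ≥0∞) (K : ℝ → ℝ≥0∞) (U : ℝ≥0∞), Lacunary q₀ τ →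
      (∀ t, 0 < t → K t ^ r ≤ ∑' j, (if τ j ≤ ENNReal.ofReal t then τ j ^ η * u j
        else ENNReal.ofReal t * τ j ^ (η - 1) * u j) ^ r) → (∀ j, u j ≤ U) →
      ∀ t, 0 < t → ENNReal.ofReal (t ^ (-η)) * K t ≤ C * U := by
  have ha : 0 < η * r := by positivity
  have hb : 0 < (1 - η) * r := mul_pos (by linarith) hr
  obtain ⟨C₁, hC₁⟩ := exists_tsum_kernel_le hq₀ ha hb
  refine ⟨C₁ ^ (1 / r), fun τ u K U hτ hK hU t ht => ?_⟩
  have ht0 : ENNReal.ofReal t ≠ 0 := by simpa using ht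
  have h1 := rpow_mul_le_tsum_kernel hr hτ ht (hK t ht)
  have h2 : (ENNReal.ofReal (t ^ (-η)) * K t) ^ r ≤ C₁ * U ^ r := by
    refine h1.trans ?_
    calc _ ≤ ∑' j, kernel (η * r) ((1 - η) * r) (τ j) (ENNReal.ofReal t) * U ^ r := by
          gcongr with j; exact hU j
      _ ≤ _ := by
          rw [ENNReal.tsum_mul_right]; gcongr; exact hC₁ τ hτ _ ht0 ENNReal.ofReal_ne_top
  have h3 := ENNReal.rpow_le_rpow h2 (by positivity : 0 ≤ 1 / r)
  rwa [← ENNReal.rpow_mul, mul_one_div_cancel hr.ne', ENNReal.rpow_one,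
    ENNReal.mul_rpow_of_nonneg _ _ (by positivity), ← ENNReal.rpow_mul,
    mul_one_div_cancel hr.ne', ENNReal.rpow_one,
    ← ENNReal.coe_rpow_of_nonneg _ (by positivity)] at h3

/-- Every finite-measure sequence is dominated by a lacunary one of comparable size. -/
theorem exists_lacunary_majorant {P : ℝ} (hP : 0 < P) :
    ∃ C : ℝ≥0, ∀ ν : ℤ → ℝ≥0∞, ∑' i : ℤ, 2 ^ ((i : ℝ) * P) * ν i ≠ 0 →
      ∑' i : ℤ, 2 ^ ((i : ℝ) * P) * ν i ≠ ⊤ →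
      ∃ ν' : ℤ → ℝ≥0∞, (∀ i, ν i ≤ ν' i) ∧ Lacunary (2 ^ (-(P / 2))) ν' ∧
        ∑' i : ℤ, 2 ^ ((i : ℝ) * P) * ν' i ≤ C * ∑' i : ℤ, 2 ^ ((i : ℝ) * P) * ν i := by
  have h20 : (2 : ℝ≥0∞) ≠ 0 := by norm_num
  have h21 : (2 : ℝ≥0∞) ≠ ⊤ := by norm_num
  have h2 : (1 : ℝ≥0∞) < 2 := by norm_num
  set D : ℝ≥0∞ := ∑' i : ℤ, 2 ^ (-(P / 2) * |(i : ℝ)|) with hD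
  have hDtop : D ≠ ⊤ := by
    have hl := lacunary_rpow_int h2 h21 (m := P / 2) (by positivity)
    have hl' := lacunary_rpow_int h2 h21 (m := -(P / 2)) (by linarith)
    have e1 := hl.tsum_le 1
    have e2 := hl'.tsum_le 1
    have e3 : D ≤ ∑' i : ℤ, ((if (2 : ℝ≥0∞) ^ ((i : ℝ) * (P / 2)) ≤ 1 then
        (2 : ℝ≥0∞) ^ ((i : ℝ) * (P / 2)) else 0) +
        (if (2 : ℝ≥0∞) ^ ((i : ℝ) * -(P / 2)) ≤ 1 then
        (2 : ℝ≥0∞) ^ ((i : ℝ) * -(P / 2)) else 0)) := by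
      refine ENNReal.tsum_le_tsum fun i => ?_
      rcases le_total (i : ℝ) 0 with hi | hi
      · refine le_add_right ?_
        rw [if_pos, abs_of_nonpos hi]
        · ring_nf; rfl
        · calc (2 : ℝ≥0∞) ^ ((i : ℝ) * (P / 2)) ≤ 2 ^ (0 : ℝ) :=
              ENNReal.rpow_le_rpow_of_exponent_le h2.le (by nlinarith)
            _ = 1 := by simp
      · refine le_add_left ?_
        rw [if_pos, abs_of_nonneg hi]
        · ring_nf; rfl
        · calc (2 : ℝ≥0∞) ^ ((i : ℝ) * -(P / 2)) ≤ 2 ^ (0 : ℝ) :=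
              ENNReal.rpow_le_rpow_of_exponent_le h2.le (by nlinarith)
            _ = 1 := by simp
    refine ne_top_of_le_ne_top ?_ e3
    rw [ENNReal.tsum_add]
    refine ENNReal.add_ne_top.mpr ⟨ne_top_of_le_ne_top ?_ e1, ne_top_of_le_ne_top ?_ e2⟩
    · rw [mul_one]; exact ENNReal.inv_ne_top.mpr (tsub_pos_of_lt hl.lt_one).ne'
    · rw [mul_one]; exact ENNReal.inv_ne_top.mpr (tsub_pos_of_lt hl'.lt_one).ne'
  refine ⟨D.toNNReal, fun ν h0 h1 => ?_⟩
  rw [ENNReal.coe_toNNReal hDtop]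
  set u : ℤ → ℝ≥0∞ := fun i => 2 ^ ((i : ℝ) * P) * ν i with hu
  set v : ℤ → ℝ≥0∞ := fun i => ∑' k : ℤ, 2 ^ (-(P / 2) * |(i : ℝ) - k|) * u k with hv
  have huv : ∀ i, u i ≤ v i := fun i => by
    refine le_trans ?_ (ENNReal.le_tsum i); simp
  have hvv : ∀ i j : ℤ, v i ≤ 2 ^ (P / 2 * |(i : ℝ) - j|) * v j := by
    intro i j
    simp only [hv]
    rw [← ENNReal.tsum_mul_left]
    refine ENNReal.tsum_le_tsum fun k => ?_
    rw [← mul_assoc (2 ^ (P / 2 * |(i : ℝ) - j|)) _ (u k), ← ENNReal.rpow_add _ _ h20 h21]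
    refine mul_le_mul_left (ENNReal.rpow_le_rpow_of_exponent_le h2.le ?_) _
    have := abs_sub_le (j : ℝ) i k
    rw [abs_sub_comm (j : ℝ) i] at this
    have h3 := abs_sub_le (i : ℝ) j k
    nlinarith
  have hvsum : ∑' i, v i = D * ∑' k, u k := by
    simp only [hv]
    rw [ENNReal.tsum_comm]
    simp only [ENNReal.tsum_mul_right]
    rw [← ENNReal.tsum_mul_left]
    congr 1; ext k; congr 1
    rw [hD, ← (Equiv.subRight k).tsum_eq (fun i : ℤ => (2 : ℝ≥0∞) ^ (-(P / 2) * |(i : ℝ)|))]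
    simp
  have hv1 : ∀ i, v i ≠ ⊤ := fun i =>
    ne_top_of_le_ne_top (ENNReal.mul_ne_top hDtop h1) (hvsum ▸ ENNReal.le_tsum i)
  have hv0 : ∀ i, v i ≠ 0 := by
    intro i hi
    apply h0
    rw [ENNReal.tsum_eq_zero]
    intro k
    have h3 := (huv k).trans (hvv k i)
    rw [hi, mul_zero] at h3
    exact le_antisymm h3 zero_le
  have hpos : ∀ x : ℝ, (2 : ℝ≥0∞) ^ x ≠ 0 := fun x => (ENNReal.rpow_pos (by norm_num) h21).ne'
  have hfin : ∀ x : ℝ, (2 : ℝ≥0∞) ^ x ≠ ⊤ := fun x => ENNReal.rpow_ne_top_of_ne_zero h20 h21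
  have hcanc : ∀ (i : ℤ) (x : ℝ≥0∞), (2 : ℝ≥0∞) ^ ((i : ℝ) * P) * (2 ^ (-((i : ℝ) * P)) * x) = x := by
    intro i x
    rw [← mul_assoc, ← ENNReal.rpow_add _ _ h20 h21]; simp
  have hcanc' : ∀ (i : ℤ) (x : ℝ≥0∞), (2 : ℝ≥0∞) ^ (-((i : ℝ) * P)) * (2 ^ ((i : ℝ) * P) * x) = x := by
    intro i x
    rw [← mul_assoc, ← ENNReal.rpow_add _ _ h20 h21]; simp
  refine ⟨fun i => 2 ^ (-((i : ℝ) * P)) * v i, fun i => ?_, ⟨?_, fun i => ?_, fun i => ?_, ?_⟩, ?_⟩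
  · calc ν i = 2 ^ (-((i : ℝ) * P)) * u i := by rw [hu]; exact (hcanc' i (ν i)).symm
      _ ≤ _ := mul_le_mul_right (huv i) _
  · exact ENNReal.rpow_lt_one_of_one_lt_of_neg h2 (by linarith)
  · exact mul_ne_zero (hpos _) (hv0 i)
  · exact ENNReal.mul_ne_top (hfin _) (hv1 i)
  · have key : ∀ i j : ℤ, i < j → (2 : ℝ≥0∞) ^ (-((j : ℝ) * P)) * v j ≤
        2 ^ (-(P / 2)) * (2 ^ (-((i : ℝ) * P)) * v i) := by
      intro i j hij
      have hij' : (i : ℝ) + 1 ≤ j := by exact_mod_cast hij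
      calc (2 : ℝ≥0∞) ^ (-((j : ℝ) * P)) * v j
          ≤ 2 ^ (-((j : ℝ) * P)) * (2 ^ (P / 2 * |(j : ℝ) - i|) * v i) := mul_le_mul_right (hvv j i) _
        _ ≤ _ := by
          rw [← mul_assoc, ← mul_assoc, ← ENNReal.rpow_add _ _ h20 h21,
            ← ENNReal.rpow_add _ _ h20 h21]
          refine mul_le_mul_left (ENNReal.rpow_le_rpow_of_exponent_le h2.le ?_) _
          rw [abs_of_nonneg (by linarith)]; nlinarith
    intro i j hij
    rcases lt_or_gt_of_ne hij with h | h
    · exact Or.inr (key i j h)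
    · exact Or.inl (key j i h)
  · simp only [hcanc]
    exact hvsum.le

end Interp

section RealInterp

theorem eLpNorm_ofReal_eq {α : Type*} [MeasurableSpace α] (μ : Measure α) (g : α → ℝ≥0∞) {p : ℝ}
    (hp : 0 < p) : eLpNorm g (ENNReal.ofReal p) μ = (∫⁻ x, g x ^ p ∂μ) ^ (1 / p) := by
  rw [eLpNorm_eq_lintegral_rpow_enorm_toReal (by simpa using hp) ENNReal.ofReal_ne_top,
    ENNReal.toReal_ofReal hp.le]
  simp

variable {V : Type*} [AddCommGroup V] {N₀ N₁ : V → ℝ≥0∞}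

theorem kFunctional_le (t : ℝ) (g h : V) :
    kFunctional N₀ N₁ t (g + h) ≤ N₀ g + ENNReal.ofReal t * N₁ h :=
  iInf_le_of_le g (iInf_le_of_le h (iInf_le _ rfl))

theorem le_kFunctional {t : ℝ} {f : V} {a : ℝ≥0∞}
    (h : ∀ g h, g + h = f → a ≤ N₀ g + ENNReal.ofReal t * N₁ h) : a ≤ kFunctional N₀ N₁ t f :=
  le_iInf fun g => le_iInf fun k => le_iInf fun e => h g k e

theorem exists_of_kFunctional_lt {t : ℝ} {f : V} {a : ℝ≥0∞} (h : kFunctional N₀ N₁ t f < a) :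
    ∃ g k, g + k = f ∧ N₀ g + ENNReal.ofReal t * N₁ k < a := by
  simp only [kFunctional, iInf_lt_iff] at h
  obtain ⟨g, k, e, h⟩ := h
  exact ⟨g, k, e, h⟩

theorem kFunctional_mono {s t : ℝ} (hst : s ≤ t) (f : V) :
    kFunctional N₀ N₁ s f ≤ kFunctional N₀ N₁ t f := by
  refine le_kFunctional fun g h e => ?_
  rw [← e]
  refine (kFunctional_le s g h).trans ?_
  gcongr

theorem realInterpNorm_ofReal (η : ℝ) {q : ℝ} (hq : 0 < q) (f : V) :
    realInterpNorm N₀ N₁ η (ENNReal.ofReal q) f =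
      (∫⁻ t in Ioi (0 : ℝ), ENNReal.ofReal t⁻¹ *
        (ENNReal.ofReal (t ^ (-η)) * kFunctional N₀ N₁ t f) ^ q) ^ (1 / q) := by
  rw [realInterpNorm, eLpNorm_ofReal_eq _ _ hq,
    lintegral_withDensity_eq_lintegral_mul_non_measurable]
  · rfl
  · exact ENNReal.measurable_ofReal.comp measurable_inv
  · exact Filter.Eventually.of_forall fun t => ENNReal.ofReal_lt_top

theorem realInterpNorm_top_le {η : ℝ} {f : V} {a : ℝ≥0∞}
    (h : ∀ t : ℝ, 0 < t → ENNReal.ofReal (t ^ (-η)) * kFunctional N₀ N₁ t f ≤ a) :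
    realInterpNorm N₀ N₁ η ⊤ f ≤ a := by
  rw [realInterpNorm, eLpNorm_exponent_top]
  refine eLpNormEssSup_le_of_ae_enorm_bound ?_
  rw [ae_withDensity_iff measurable_inv.ennreal_ofReal]
  filter_upwards [ae_restrict_mem measurableSet_Ioi] with t ht _
  simpa using h t ht

theorem exists_mem_Ioo_le_realInterpNorm (η : ℝ) (f : V) {a b : ℝ} (ha : 0 < a) (hab : a < b) :
    ∃ t ∈ Ioo a b, ENNReal.ofReal (t ^ (-η)) * kFunctional N₀ N₁ t f ≤
      realInterpNorm N₀ N₁ η ⊤ f := by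
  rw [realInterpNorm, eLpNorm_exponent_top]
  have h := ae_le_eLpNormEssSup (μ := (volume.restrict (Ioi (0 : ℝ))).withDensity
    fun t => ENNReal.ofReal t⁻¹) (f := fun t : ℝ => ENNReal.ofReal (t ^ (-η)) *
      kFunctional N₀ N₁ t f)
  rw [ae_withDensity_iff measurable_inv.ennreal_ofReal,
    ae_restrict_iff' measurableSet_Ioi] at h
  have h2 : ∃ t ∈ Ioo a b, (t ∈ Ioi (0 : ℝ) → ENNReal.ofReal t⁻¹ ≠ 0 →
      ‖ENNReal.ofReal (t ^ (-η)) * kFunctional N₀ N₁ t f‖ₑ ≤ eLpNormEssSup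
      (fun t : ℝ => ENNReal.ofReal (t ^ (-η)) * kFunctional N₀ N₁ t f)
      ((volume.restrict (Ioi (0 : ℝ))).withDensity fun t => ENNReal.ofReal t⁻¹)) := by
    by_contra! hc
    have h3 : Ioo a b ⊆ {t | ¬ (t ∈ Ioi (0 : ℝ) → ENNReal.ofReal t⁻¹ ≠ 0 →
      ‖ENNReal.ofReal (t ^ (-η)) * kFunctional N₀ N₁ t f‖ₑ ≤ eLpNormEssSup
      (fun t : ℝ => ENNReal.ofReal (t ^ (-η)) * kFunctional N₀ N₁ t f)
      ((volume.restrict (Ioi (0 : ℝ))).withDensity fun t => ENNReal.ofReal t⁻¹))} := by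
      intro t ht
      simp only [mem_ofPred_eq, not_forall, not_le]
      obtain ⟨h1, h2, h3⟩ := hc t ht
      exact ⟨h1, h2, h3⟩
    have h4 := measure_mono_null h3 h
    rw [Real.volume_Ioo, ENNReal.ofReal_eq_zero] at h4
    linarith
  obtain ⟨t, ht, h3⟩ := h2
  have ht0 : 0 < t := ha.trans ht.1
  refine ⟨t, ht, ?_⟩
  simpa using h3 ht0 (by simpa using ht0)

theorem exists_le_realInterpNorm_top {η : ℝ} (hη : 0 < η) :
    ∃ C : ℝ≥0, ∀ (V : Type) [AddCommGroup V] (N₀ N₁ : V → ℝ≥0∞) (f : V) (t : ℝ), 0 < t →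
      ENNReal.ofReal (t ^ (-η)) * kFunctional N₀ N₁ t f ≤ C * realInterpNorm N₀ N₁ η ⊤ f := by
  refine ⟨Real.toNNReal (2 ^ η), fun V _ N₀ N₁ f t ht => ?_⟩
  obtain ⟨s, hs, h⟩ := exists_mem_Ioo_le_realInterpNorm (N₀ := N₀) (N₁ := N₁) η f ht
    (by linarith : t < 2 * t)
  have hs0 : 0 < s := ht.trans hs.1
  refine le_trans ?_ (mul_le_mul_right h _)
  rw [← mul_assoc]
  gcongr
  · change _ ≤ ENNReal.ofReal _ * _
    rw [← ENNReal.ofReal_mul (by positivity)]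
    apply ENNReal.ofReal_le_ofReal
    have h1 : t⁻¹ ≤ 2 * s⁻¹ := by
      rw [inv_eq_one_div, inv_eq_one_div, mul_one_div, div_le_div_iff₀ ht hs0]; linarith [hs.2]
    calc t ^ (-η) = (t⁻¹) ^ η := by rw [Real.rpow_neg ht.le, Real.inv_rpow ht.le]
      _ ≤ (2 * s⁻¹) ^ η := by gcongr
      _ = _ := by rw [Real.mul_rpow (by norm_num) (by positivity), Real.rpow_neg hs0.le,
        Real.inv_rpow hs0.le]
  · exact kFunctional_mono hs.1.le f

theorem exists_of_realInterpNorm_lt_top {η : ℝ} {q : ℝ≥0∞} (hq : q ≠ 0) {f : V}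
    (h : realInterpNorm N₀ N₁ η q f < ⊤) : ∃ g h, N₀ g < ⊤ ∧ N₁ h < ⊤ ∧ g + h = f := by
  have h1 : ∃ t : ℝ, 0 < t ∧ ENNReal.ofReal (t ^ (-η)) * kFunctional N₀ N₁ t f < ⊤ := by
    by_cases hq' : q = ⊤
    · subst hq'
      obtain ⟨t, ht, h2⟩ := exists_mem_Ioo_le_realInterpNorm (N₀ := N₀) (N₁ := N₁) η f one_pos
        one_lt_two
      exact ⟨t, one_pos.trans ht.1, h2.trans_lt h⟩
    · have hq0 : 0 < q.toReal := ENNReal.toReal_pos hq hq'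
      rw [← ENNReal.ofReal_toReal hq', realInterpNorm_ofReal η hq0] at h
      by_contra! hc
      simp only [top_le_iff] at hc
      refine absurd h (not_lt.mpr (top_le_iff.mpr ?_))
      rw [ENNReal.rpow_eq_top_iff_of_pos (by positivity), setLIntegral_congr_fun
        (g := fun _ => ⊤) measurableSet_Ioi]
      · simp
      · intro t ht
        dsimp only
        rw [hc t ht, ENNReal.top_rpow_of_pos hq0, ENNReal.mul_top]
        simpa using ht
  obtain ⟨t, ht, h2⟩ := h1
  have h3 : kFunctional N₀ N₁ t f < ⊤ := by
    refine lt_top_iff_ne_top.mpr fun h4 => ?_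
    rw [h4, ENNReal.mul_top] at h2
    · exact lt_irrefl _ h2
    · simpa using Real.rpow_pos_of_pos ht _
  obtain ⟨g, k, e, h4⟩ := exists_of_kFunctional_lt h3
  rw [ENNReal.add_lt_top] at h4
  refine ⟨g, k, h4.1, lt_top_iff_ne_top.mpr fun h5 => ?_, e⟩
  rw [h5, ENNReal.mul_top (by simpa using ht)] at h4
  exact lt_irrefl _ h4.2

/-- Sampling of `t ↦ t^{-η} K(t, f)` along the powers of `ρ ^ a`. -/
theorem exists_tsum_kFunctional_le {ρ a η q : ℝ} (hρ : 1 < ρ) (ha : a ≠ 0) (hη : 0 < η)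
    (hq : 0 < q) : ∃ C : ℝ≥0, ∀ (V : Type) [AddCommGroup V] (N₀ N₁ : V → ℝ≥0∞) (f : V),
      ∑' l : ℤ, (ENNReal.ofReal ((ρ ^ ((l : ℝ) * a)) ^ (-η)) *
        kFunctional N₀ N₁ (ρ ^ ((l : ℝ) * a)) f) ^ q ≤
      C * ∫⁻ t in Ioi (0 : ℝ), ENNReal.ofReal t⁻¹ *
        (ENNReal.ofReal (t ^ (-η)) * kFunctional N₀ N₁ t f) ^ q := by
  have hρ0 : 0 < ρ := by linarith
  set Q : ℝ := ρ ^ |a| with hQ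
  have hQ1 : 1 < Q := Real.one_lt_rpow hρ (abs_pos.mpr ha)
  have hQ0 : 0 < Q := by linarith
  set c : ℝ := (1 - Q⁻¹) * Q ^ (-(η * q)) with hc
  have hc0 : 0 < c := mul_pos (by rw [sub_pos]; exact inv_lt_one_of_one_lt₀ hQ1) (by positivity)
  have hint : ∀ (s : ℝ) (k : ℝ≥0∞), 0 < s →
      ENNReal.ofReal c * (ENNReal.ofReal (s ^ (-η)) * k) ^ q =
      ∫⁻ _ in Ico s (Q * s), ENNReal.ofReal (Q * s)⁻¹ *
        (ENNReal.ofReal ((Q * s) ^ (-η)) * k) ^ q := by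
    intro s k hs
    rw [setLIntegral_const, Real.volume_Ico, mul_right_comm, ← ENNReal.ofReal_mul (by positivity),
      Real.mul_rpow hQ0.le hs.le, ENNReal.ofReal_mul (p := Q ^ (-η)) (by positivity),
      mul_assoc (ENNReal.ofReal (Q ^ (-η))) _ k,
      ENNReal.mul_rpow_of_nonneg (ENNReal.ofReal (Q ^ (-η))) _ hq.le,
      ENNReal.ofReal_rpow_of_pos (by positivity), ← Real.rpow_mul hQ0.le, ← mul_assoc,
      ← ENNReal.ofReal_mul]
    · congr 2
      rw [hc, neg_mul]
      field_simp
    · have : 0 ≤ Q * s - s := by nlinarith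
      positivity
  refine ⟨(Real.toNNReal c)⁻¹, fun V _ N₀ N₁ f => ?_⟩
  set τ : ℤ → ℝ := fun l => ρ ^ ((l : ℝ) * a) with hτ
  have hτ0 : ∀ l, 0 < τ l := fun l => Real.rpow_pos_of_pos hρ0 _
  have hcc : ((Real.toNNReal c)⁻¹ : ℝ≥0) = (ENNReal.ofReal c)⁻¹ :=
    ENNReal.coe_inv (by simpa using hc0)
  rw [hcc, mul_comm, ← div_eq_mul_inv, ENNReal.le_div_iff_mul_le (by simp [hc0]) (by simp), mul_comm,
    ← ENNReal.tsum_mul_left]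
  have hdisj : Pairwise (Function.onFun Disjoint fun l => Ico (τ l) (Q * τ l)) := by
    have key : ∀ l k : ℤ, (l : ℝ) * a + |a| ≤ k * a → Disjoint (Ico (τ l) (Q * τ l))
        (Ico (τ k) (Q * τ k)) := by
      intro l k h
      rw [Set.disjoint_left]
      rintro t ⟨_, h2⟩ ⟨h3, _⟩
      have h4 : Q * τ l ≤ τ k := by
        rw [hQ, hτ, ← Real.rpow_add hρ0]
        exact Real.rpow_le_rpow_of_exponent_le hρ.le (by linarith)
      linarith
    intro l k hlk
    have h1 : (1 : ℝ) ≤ |(l : ℝ) - k| := by exact_mod_cast Int.one_le_abs (sub_ne_zero.mpr hlk)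
    have h2 : |a| ≤ |(l : ℝ) * a - k * a| := by
      rw [← sub_mul, abs_mul]; nlinarith [abs_nonneg a]
    rcases le_abs.mp h2 with h | h
    · exact (key k l (by linarith)).symm
    · exact key l k (by linarith)
  calc _ ≤ ∑' l : ℤ, ∫⁻ t in Ico (τ l) (Q * τ l), ENNReal.ofReal t⁻¹ *
        (ENNReal.ofReal (t ^ (-η)) * kFunctional N₀ N₁ t f) ^ q := by
        refine ENNReal.tsum_le_tsum fun l => ?_
        have ht := hτ0 l
        refine (hint (τ l) _ ht).le.trans ?_
        refine setLIntegral_mono' measurableSet_Ico fun t h => ?_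
        have ht0 : 0 < t := ht.trans_le h.1
        have h2 := h.2.le
        refine mul_le_mul' (ENNReal.ofReal_le_ofReal (inv_anti₀ ht0 h2)) ?_
        refine ENNReal.rpow_le_rpow (mul_le_mul' (ENNReal.ofReal_le_ofReal
          (Real.rpow_le_rpow_of_nonpos ht0 h2 (by linarith))) (kFunctional_mono h.1 f)) hq.le
    _ = ∫⁻ t in ⋃ l, Ico (τ l) (Q * τ l), ENNReal.ofReal t⁻¹ *
        (ENNReal.ofReal (t ^ (-η)) * kFunctional N₀ N₁ t f) ^ q :=
        (lintegral_iUnion (fun l => measurableSet_Ico) hdisj _).symm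
    _ ≤ _ := by
        refine lintegral_mono_set (iUnion_subset fun l t h => ?_)
        exact (hτ0 l).trans_le h.1

end RealInterp

/-- A layer-cake bound from weak-type information along a sequence of levels. -/
theorem tsum_mul_rpow_le_of_weak {ι : Type*} {ν b : ι → ℝ≥0∞} (hν : ∀ Q, ν Q ≠ 0)
    {L M : ℤ → ℝ≥0∞} {C C' : ℝ≥0} (hC : C ≠ 0) (hC' : C' ≠ 0) {P : ℝ} (hP : 0 < P)
    (hweak : ∀ i, ∑' Q, (if L i < b Q then ν Q else 0) ≤ C * M i)
    (hL : ∀ i, L i ≤ C' * L (i + 1))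
    (hM : ∀ ε : ℝ≥0∞, ε ≠ 0 → ∃ i, C * M i < ε) (hM' : ∀ i, 0 ≤ i → 1 ≤ M i) :
    ∑' Q, ν Q * b Q ^ P ≤ C * (C' : ℝ≥0∞) ^ P * ∑' i, L i ^ P * M i := by
  by_cases htop : ∑' i, L i ^ P * M i = ⊤
  · rw [htop, ENNReal.mul_top]
    · exact le_top
    · exact mul_ne_zero (by simpa using hC)
        (ENNReal.rpow_pos (by simpa [pos_iff_ne_zero] using hC') (by simp)).ne'
  have hex : ∀ Q, b Q ≠ 0 → ∃ i, b Q ≤ L i ∧ L (i + 1) < b Q := by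
    intro Q hb
    obtain ⟨i₁, hi₁⟩ := hM (ν Q) (hν Q)
    have h1 : b Q ≤ L i₁ := by
      by_contra! hlt
      have h1 := (ENNReal.le_tsum Q).trans (hweak i₁)
      rw [if_pos hlt] at h1
      exact absurd hi₁ (not_lt.mpr h1)
    by_contra! hc
    have h2 : ∀ i, i₁ ≤ i → b Q ≤ L i := fun i hi => Int.leInduction h1 (fun j _ => hc j) i hi
    apply htop
    have h3 : ∑' k : ℕ, b Q ^ P ≤ ∑' i, L i ^ P * M i := by
      refine le_trans ?_ (ENNReal.tsum_comp_le_tsum_of_injective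
        (f := fun k : ℕ => max i₁ 0 + (k : ℤ)) (fun a b h => by simpa using h) _)
      refine ENNReal.tsum_le_tsum fun k => ?_
      have h4 : b Q ≤ L (max i₁ 0 + k) := h2 _ (by have := le_max_left i₁ 0; omega)
      have h5 : 1 ≤ M (max i₁ 0 + k) := hM' _ (by have := le_max_right i₁ 0; omega)
      calc b Q ^ P = b Q ^ P * 1 := (mul_one _).symm
        _ ≤ _ := by gcongr
    rw [ENNReal.tsum_const_eq_top_of_ne_zero] at h3
    · exact top_le_iff.mp h3
    · simp [ENNReal.rpow_eq_zero_iff, hb, hP.not_gt]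
  have hb : ∀ Q, b Q ^ P ≤ ∑' i, (C' : ℝ≥0∞) ^ P * L i ^ P * (if L i < b Q then 1 else 0) := by
    intro Q
    by_cases h0 : b Q = 0
    · simp [h0, ENNReal.zero_rpow_of_pos hP]
    obtain ⟨i, h1, h2⟩ := hex Q h0
    refine le_trans ?_ (ENNReal.le_tsum (i + 1))
    rw [if_pos h2, mul_one, ← ENNReal.mul_rpow_of_nonneg _ _ hP.le]
    exact ENNReal.rpow_le_rpow (h1.trans (hL i)) hP.le
  calc ∑' Q, ν Q * b Q ^ P
      ≤ ∑' Q, ∑' i, (C' : ℝ≥0∞) ^ P * L i ^ P * (if L i < b Q then ν Q else 0) := by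
        refine ENNReal.tsum_le_tsum fun Q => ?_
        refine (mul_le_mul_right (hb Q) _).trans ?_
        rw [← ENNReal.tsum_mul_left]
        refine ENNReal.tsum_le_tsum fun i => le_of_eq ?_
        split_ifs <;> ring
    _ = ∑' i, (C' : ℝ≥0∞) ^ P * L i ^ P * ∑' Q, (if L i < b Q then ν Q else 0) := by
        rw [ENNReal.tsum_comm]; simp only [ENNReal.tsum_mul_left]
    _ ≤ ∑' i, (C' : ℝ≥0∞) ^ P * L i ^ P * (C * M i) := by gcongr with i; exact hweak i
    _ = _ := by rw [← ENNReal.tsum_mul_left]; congr 1; ext i; ring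

/-! ### Whitney grids -/

/-- Parameters of a Whitney grid: layers `[ρ^l, ρ^{l+1})` and nested cubes of side about
`ρ^l / L` in the layer `l`. -/
structure Grid (n : ℕ) where
  /-- ratio of consecutive layers -/
  ρ : ℝ
  one_lt : 1 < ρ
  /-- fineness of the cubes -/
  L : ℕ
  n_lt : n < L

namespace Grid

variable {n : ℕ} (G : Grid n)

/-- Lower end of the layer `l`. -/
def h (l : ℤ) : ℝ := G.ρ ^ l

/-- Side length of the cubes of the layer `l`. -/
def side (l : ℤ) : ℝ := (2 : ℝ) ^ Int.log 2 (G.h l) / G.L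

/-- Index of the cube of the layer `l` that contains `x`. -/
def cz (l : ℤ) (x : EuclideanSpace ℝ (Fin n)) : Fin n → ℤ := fun i => ⌊x i / G.side l⌋

/-- The layer `l`. -/
def layer (l : ℤ) : Set ℝ := Ico (G.h l) (G.h (l + 1))

/-- The cube with index `z` in the layer `l`. -/
def cube (l : ℤ) (z : Fin n → ℤ) : Set (EuclideanSpace ℝ (Fin n)) := {x | G.cz l x = z}

/-- The Whitney box over a cube. -/
def box (l : ℤ) (z : Fin n → ℤ) : Set (Space n) := G.layer l ×ˢ G.cube l z

/-- The ratio `ρ` as an extended nonnegative real. -/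
def R : ℝ≥0∞ := ENNReal.ofReal G.ρ

/-- The volume of a cube of the layer `l`. -/
def V (l : ℤ) : ℝ≥0∞ := ENNReal.ofReal (G.side l ^ n)

theorem ρ_pos : 0 < G.ρ := zero_lt_one.trans G.one_lt
theorem h_pos (l : ℤ) : 0 < G.h l := zpow_pos G.ρ_pos l
theorem h_succ (l : ℤ) : G.h (l + 1) = G.ρ * G.h l := by
  rw [h, h, zpow_add_one₀ G.ρ_pos.ne', mul_comm]
theorem h_lt_succ (l : ℤ) : G.h l < G.h (l + 1) := by
  rw [h_succ]; nlinarith [G.h_pos l, G.one_lt]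
theorem h_mono : Monotone G.h := fun _ _ hab => zpow_le_zpow_right₀ G.one_lt.le hab
theorem L_pos : 0 < (G.L : ℝ) := by exact_mod_cast (Nat.zero_le n).trans_lt G.n_lt
theorem one_lt_R : 1 < G.R := by simpa [R] using G.one_lt
theorem R_ne_zero : G.R ≠ 0 := (zero_lt_one.trans G.one_lt_R).ne'
theorem R_ne_top : G.R ≠ ⊤ := ENNReal.ofReal_ne_top
theorem Rpow_ne_zero (a : ℝ) : G.R ^ a ≠ 0 :=
  (ENNReal.rpow_pos (pos_iff_ne_zero.mpr G.R_ne_zero) G.R_ne_top).ne'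
theorem Rpow_ne_top (a : ℝ) : G.R ^ a ≠ ⊤ :=
  ENNReal.rpow_ne_top_of_ne_zero G.R_ne_zero G.R_ne_top
theorem Rpow_add (a b : ℝ) : G.R ^ (a + b) = G.R ^ a * G.R ^ b :=
  ENNReal.rpow_add _ _ G.R_ne_zero G.R_ne_top
theorem Rpow_mono {a b : ℝ} (hab : a ≤ b) : G.R ^ a ≤ G.R ^ b :=
  ENNReal.rpow_le_rpow_of_exponent_le G.one_lt_R.le hab

theorem ofReal_h (l : ℤ) : ENNReal.ofReal (G.h l) = G.R ^ (l : ℝ) := by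
  rw [R, ENNReal.ofReal_rpow_of_pos G.ρ_pos, Real.rpow_intCast]; rfl

theorem ofReal_h_rpow (l : ℤ) (a : ℝ) : ENNReal.ofReal (G.h l ^ a) = G.R ^ ((l : ℝ) * a) := by
  rw [← ENNReal.ofReal_rpow_of_pos (G.h_pos l), ofReal_h, ENNReal.rpow_mul]

theorem side_pos (l : ℤ) : 0 < G.side l := div_pos (by positivity) G.L_pos

theorem side_le (l : ℤ) : G.side l ≤ G.h l / G.L := by
  have := Int.zpow_log_le_self (b := 2) one_lt_two (G.h_pos l)
  exact div_le_div_of_nonneg_right (by exact_mod_cast this) G.L_pos.le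

theorem le_side (l : ℤ) : G.h l ≤ 2 * G.L * G.side l := by
  have := Int.lt_zpow_succ_log_self (b := 2) one_lt_two (G.h l)
  have h1 := G.L_pos
  rw [side]
  field_simp
  rw [zpow_add_one₀ (by norm_num)] at this
  push_cast at this
  linarith

theorem side_le_h (l : ℤ) : G.side l ≤ G.h l := by
  refine (G.side_le l).trans (div_le_self (G.h_pos l).le ?_)
  exact_mod_cast (Nat.zero_le n).trans_lt G.n_lt

theorem exists_side_eq {l l' : ℤ} (hl : l ≤ l') : ∃ k : ℕ, G.side l' = (2 ^ k : ℕ) * G.side l := by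
  have h1 := Int.log_mono_right (b := 2) (G.h_pos l) (G.h_mono hl)
  obtain ⟨k, hk⟩ := Int.eq_ofNat_of_zero_le (sub_nonneg.mpr h1)
  refine ⟨k, ?_⟩
  rw [side, side, show Int.log 2 (G.h l') = k + Int.log 2 (G.h l) by omega,
    zpow_add₀ (by norm_num)]
  push_cast
  rw [zpow_natCast, mul_div_assoc]

theorem cz_congr {l l' : ℤ} (hl : l ≤ l') {x y : EuclideanSpace ℝ (Fin n)}
    (hxy : G.cz l x = G.cz l y) : G.cz l' x = G.cz l' y := by
  obtain ⟨k, hk⟩ := G.exists_side_eq hl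
  ext i
  have hi := congrFun hxy i
  simp only [cz] at hi ⊢
  rw [hk, mul_comm, ← div_div, ← div_div, Int.floor_div_natCast, Int.floor_div_natCast, hi]

theorem measurable_cz (l : ℤ) : Measurable (G.cz l) := by
  refine measurable_pi_lambda _ fun i => Measurable.floor ?_
  exact Measurable.div_const (by fun_prop) _

theorem measurableSet_cube (l : ℤ) (z : Fin n → ℤ) : MeasurableSet (G.cube l z) :=
  G.measurable_cz l (measurableSet_singleton z)

theorem measurable_comp_cz (l : ℤ) {β : Type*} [MeasurableSpace β] (φ : (Fin n → ℤ) → β) :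
    Measurable fun x => φ (G.cz l x) := Measurable.of_discrete.comp (G.measurable_cz l)

theorem measurableSet_layer (l : ℤ) : MeasurableSet (G.layer l) := measurableSet_Ico

theorem measurableSet_box (l : ℤ) (z : Fin n → ℤ) : MeasurableSet (G.box l z) :=
  (G.measurableSet_layer l).prod (G.measurableSet_cube l z)

theorem mem_cube {l : ℤ} {z : Fin n → ℤ} {x : EuclideanSpace ℝ (Fin n)} :
    x ∈ G.cube l z ↔ G.cz l x = z := Iff.rfl

theorem pos_of_mem_layer {l : ℤ} {t : ℝ} (ht : t ∈ G.layer l) : 0 < t := (G.h_pos l).trans_le ht.1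

theorem pairwise_disjoint_layer : Pairwise (Function.onFun Disjoint G.layer) := by
  have key : ∀ a b : ℤ, a < b → Disjoint (G.layer a) (G.layer b) := by
    intro a b hab
    rw [Set.disjoint_left]
    intro t ht ht'
    exact absurd ((G.h_mono (by omega : a + 1 ≤ b)).trans ht'.1) (not_le.mpr ht.2)
  intro a b hab
  rcases lt_or_gt_of_ne hab with h | h
  · exact key a b h
  · exact (key b a h).symm

theorem exists_mem_layer {t : ℝ} (ht : 0 < t) : ∃ l, t ∈ G.layer l :=
  exists_mem_Ico_zpow ht G.one_lt

theorem lt_succ_of_mem_layer {l l' : ℤ} {t : ℝ} (ht : t ∈ G.layer l) (h : G.h l' ≤ t) : l' ≤ l := by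
  by_contra! hlt
  exact absurd ((G.h_mono (by omega : l + 1 ≤ l')).trans h) (not_le.mpr ht.2)

theorem dist_le {l : ℤ} {x y : EuclideanSpace ℝ (Fin n)} (hxy : G.cz l x = G.cz l y) :
    dist x y ≤ n * G.side l := by
  have hs := G.side_pos l
  have h1 : ∀ i, dist (x i) (y i) ≤ G.side l := by
    intro i
    have hi := congrFun hxy i
    simp only [cz] at hi
    have h2 := Int.abs_sub_lt_one_of_floor_eq_floor hi
    rw [← sub_div, abs_div, abs_of_pos hs, div_lt_one hs] at h2
    exact h2.le
  rw [EuclideanSpace.dist_eq]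
  refine Real.sqrt_le_iff.mpr ⟨by positivity, ?_⟩
  calc ∑ i, dist (x i) (y i) ^ 2 ≤ ∑ _i : Fin n, G.side l ^ 2 := by
        gcongr with i; exact h1 i
    _ = n * G.side l ^ 2 := by simp
    _ ≤ (n * G.side l) ^ 2 := by
        rw [mul_pow]
        gcongr
        rcases Nat.eq_zero_or_pos n with h0 | h0
        · simp [h0]
        · exact le_self_pow₀ (by exact_mod_cast h0) (by norm_num)

theorem dist_lt {l : ℤ} {x y : EuclideanSpace ℝ (Fin n)} (hxy : G.cz l x = G.cz l y) :
    dist x y < G.h l := by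
  refine (G.dist_le hxy).trans_lt ?_
  have h1 : (n : ℝ) < G.L := by exact_mod_cast G.n_lt
  calc n * G.side l ≤ n * (G.h l / G.L) := by gcongr; exact G.side_le l
    _ < G.L * (G.h l / G.L) := by
        have := div_pos (G.h_pos l) G.L_pos
        nlinarith
    _ = G.h l := mul_div_cancel₀ _ G.L_pos.ne'

theorem volume_cube (l : ℤ) (z : Fin n → ℤ) : volume (G.cube l z) = G.V l := by
  have hs := G.side_pos l
  have e : G.cube l z = (MeasurableEquiv.toLp 2 (Fin n → ℝ)).symm ⁻¹'
      (univ.pi fun i => Ico (z i * G.side l) ((z i + 1) * G.side l)) := by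
    ext x
    simp only [mem_cube, mem_preimage, mem_pi, mem_univ, true_imp_iff, mem_Ico, funext_iff, cz,
      Int.floor_eq_iff, le_div_iff₀ hs, div_lt_iff₀ hs]
    rfl
  rw [e, (EuclideanSpace.volume_preserving_symm_measurableEquiv_toLp (Fin n)).measure_preimage
    (MeasurableSet.univ_pi fun i => measurableSet_Ico).nullMeasurableSet, Real.volume_pi_Ico]
  have : ∀ i, ((z i : ℝ) + 1) * G.side l - z i * G.side l = G.side l := fun i => by ring
  simp only [this]
  rw [Finset.prod_const, Finset.card_univ, Fintype.card_fin, V, ENNReal.ofReal_pow hs.le]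

theorem cube_nonempty (l : ℤ) (z : Fin n → ℤ) : (G.cube l z).Nonempty := by
  refine ⟨WithLp.toLp 2 fun i => z i * G.side l, ?_⟩
  rw [mem_cube]
  ext i
  simp [cz, (G.side_pos l).ne']

theorem V_ne_zero (l : ℤ) : G.V l ≠ 0 := by
  have := pow_pos (G.side_pos l) n
  simpa [V] using this

theorem V_ne_top (l : ℤ) : G.V l ≠ ⊤ := ENNReal.ofReal_ne_top

theorem V_le (l : ℤ) : G.V l ≤ G.R ^ ((l : ℝ) * n) := by
  rw [V, ← G.ofReal_h_rpow, Real.rpow_natCast]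
  exact ENNReal.ofReal_le_ofReal (pow_le_pow_left₀ (G.side_pos l).le (G.side_le_h l) n)

/-- Volumes of balls in terms of volumes of cubes. -/
theorem exists_volume_ball_le (A : ℝ) : ∃ C : ℝ≥0, ∀ (l : ℤ) (x : EuclideanSpace ℝ (Fin n)),
    volume (Metric.ball x (A * G.h l)) ≤ C * G.V l := by
  rcases le_or_gt A 0 with hA | hA
  · refine ⟨0, fun l x => ?_⟩
    rw [Metric.ball_eq_empty.mpr (mul_nonpos_of_nonpos_of_nonneg hA (G.h_pos l).le)]
    simp
  · set v := volume (Metric.ball (0 : EuclideanSpace ℝ (Fin n)) 1) with hv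
    have hvt : v ≠ ⊤ := measure_ball_lt_top.ne
    refine ⟨Real.toNNReal ((A * (2 * G.L)) ^ n) * v.toNNReal, fun l x => ?_⟩
    have hh := G.h_pos l
    have hL := G.L_pos
    have hs := G.side_pos l
    rw [Measure.addHaar_ball_of_pos _ _ (by positivity), finrank_euclideanSpace_fin, ENNReal.coe_mul,
      ENNReal.coe_toNNReal hvt, mul_right_comm, V]
    gcongr
    change _ ≤ ENNReal.ofReal _ * _
    rw [← ENNReal.ofReal_mul (by positivity), ← mul_pow]
    refine ENNReal.ofReal_le_ofReal (pow_le_pow_left₀ (by positivity) ?_ n)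
    rw [mul_assoc]
    exact mul_le_mul_of_nonneg_left (G.le_side l) hA.le

theorem exists_Rpow_le : ∃ C : ℝ≥0, ∀ l : ℤ, G.R ^ ((l : ℝ) * n) ≤ C * G.V l := by
  refine ⟨Real.toNNReal ((2 * G.L) ^ n), fun l => ?_⟩
  rw [V, ← G.ofReal_h_rpow, Real.rpow_natCast]
  change _ ≤ ENNReal.ofReal _ * _
  have hL := G.L_pos
  rw [← ENNReal.ofReal_mul (by positivity), ← mul_pow]
  exact ENNReal.ofReal_le_ofReal (pow_le_pow_left₀ (G.h_pos l).le (G.le_side l) n)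

theorem lintegral_comp_cz (l : ℤ) (φ : (Fin n → ℤ) → ℝ≥0∞) :
    ∫⁻ x, φ (G.cz l x) = ∑' z, G.V l * φ z := by
  rw [← lintegral_map (f := φ) Measurable.of_discrete (G.measurable_cz l), lintegral_countable']
  congr 1; ext z
  rw [Measure.map_apply (G.measurable_cz l) (measurableSet_singleton z), mul_comm]
  congr 1
  exact G.volume_cube l z

theorem setLIntegral_cube (l : ℤ) (z : Fin n → ℤ) (φ : (Fin n → ℤ) → ℝ≥0∞) :
    ∫⁻ x in G.cube l z, φ (G.cz l x) = G.V l * φ z := by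
  rw [setLIntegral_congr_fun (g := fun _ => φ z) (G.measurableSet_cube l z), setLIntegral_const,
    volume_cube, mul_comm]
  intro x hx
  simp only [G.mem_cube.mp hx]

theorem volume_layer_ne_zero (l : ℤ) : volume (G.layer l) ≠ 0 := by
  rw [layer, Real.volume_Ico]; simpa using G.h_lt_succ l

theorem volume_layer (l : ℤ) :
    volume (G.layer l) = ENNReal.ofReal (G.ρ - 1) * G.R ^ (l : ℝ) := by
  rw [layer, Real.volume_Ico, h_succ, ← ofReal_h, ← ENNReal.ofReal_mul (by linarith [G.one_lt])]
  ring_nf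

theorem volume_box (l : ℤ) (z : Fin n → ℤ) :
    volume (G.box l z) = volume (G.layer l) * G.V l := by
  rw [box, Measure.volume_eq_prod, Measure.prod_prod, volume_cube]

theorem volume_box_ne_zero (l : ℤ) (z : Fin n → ℤ) : volume (G.box l z) ≠ 0 := by
  rw [volume_box]; exact mul_ne_zero (G.volume_layer_ne_zero l) (G.V_ne_zero l)

theorem volume_box_ne_top (l : ℤ) (z : Fin n → ℤ) : volume (G.box l z) ≠ ⊤ := by
  rw [volume_box, layer, Real.volume_Ico]
  exact ENNReal.mul_ne_top ENNReal.ofReal_ne_top (G.V_ne_top l)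

/-- On a layer the powers of `t` are comparable to constants. -/
theorem ofReal_rpow_le {l : ℤ} {t : ℝ} (ht : t ∈ G.layer l) (a : ℝ) :
    ENNReal.ofReal (t ^ a) ≤ G.R ^ |a| * G.R ^ ((l : ℝ) * a) ∧
      G.R ^ ((l : ℝ) * a) ≤ G.R ^ |a| * ENNReal.ofReal (t ^ a) := by
  have hh := G.h_pos l
  have ht0 := G.pos_of_mem_layer ht
  have hρ := G.ρ_pos
  have ht1 := ht.1
  have ht2 : t ≤ G.ρ * G.h l := by rw [← h_succ]; exact ht.2.le
  have hR : G.R ^ |a| = ENNReal.ofReal (G.ρ ^ |a|) := by rw [R, ENNReal.ofReal_rpow_of_pos hρ]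
  have h1 : 1 ≤ G.ρ ^ |a| := Real.one_le_rpow G.one_lt.le (abs_nonneg a)
  rw [← ofReal_h_rpow, hR, ← ENNReal.ofReal_mul (by positivity), ← ENNReal.ofReal_mul (by positivity)]
  rcases le_total 0 a with ha | ha
  · rw [abs_of_nonneg ha] at h1 ⊢
    constructor <;> apply ENNReal.ofReal_le_ofReal
    · rw [← Real.mul_rpow hρ.le hh.le]; gcongr
    · calc G.h l ^ a ≤ t ^ a := by gcongr
        _ ≤ _ := le_mul_of_one_le_left (by positivity) h1
  · rw [abs_of_nonpos ha] at h1 ⊢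
    constructor <;> apply ENNReal.ofReal_le_ofReal
    · calc t ^ a ≤ G.h l ^ a := Real.rpow_le_rpow_of_nonpos hh ht1 ha
        _ ≤ _ := le_mul_of_one_le_left (by positivity) h1
    · have h3 : (G.ρ * G.h l) ^ a ≤ t ^ a := Real.rpow_le_rpow_of_nonpos ht0 ht2 ha
      rw [Real.mul_rpow hρ.le hh.le] at h3
      have h4 : G.ρ ^ (-a) * G.ρ ^ a = 1 := by rw [← Real.rpow_add hρ]; simp
      calc G.h l ^ a = G.ρ ^ (-a) * (G.ρ ^ a * G.h l ^ a) := by rw [← mul_assoc, h4, one_mul]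
        _ ≤ _ := by gcongr

/-- A pointwise majorant of local suprema at the scale of a layer, with comparable integral. -/
theorem exists_sup_majorant (A : ℝ) : ∃ C : ℝ≥0, ∀ (l : ℤ) (φ : (Fin n → ℤ) → ℝ≥0∞),
    ∃ Φ : EuclideanSpace ℝ (Fin n) → ℝ≥0∞, Measurable Φ ∧
      (∀ x y, dist x y < A * G.h l → φ (G.cz l y) ≤ Φ x) ∧
      ∫⁻ x, Φ x ≤ C * ∫⁻ x, φ (G.cz l x) := by
  obtain ⟨C, hC⟩ := G.exists_volume_ball_le (A + 1)
  refine ⟨C, fun l φ => ⟨fun x => (G.V l)⁻¹ * ∫⁻ y, (if dist x y < (A + 1) * G.h l then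
    φ (G.cz l y) else 0), ?_, ?_, ?_⟩⟩
  · refine Measurable.const_mul (Measurable.lintegral_prod_right'
      (f := fun w : EuclideanSpace ℝ (Fin n) × EuclideanSpace ℝ (Fin n) =>
        if dist w.1 w.2 < (A + 1) * G.h l then φ (G.cz l w.2) else 0) ?_) _
    exact Measurable.ite (measurableSet_lt (by fun_prop) measurable_const)
      ((G.measurable_comp_cz l φ).comp measurable_snd) measurable_const
  · intro x y hxy
    calc φ (G.cz l y) = (G.V l)⁻¹ * ∫⁻ w in G.cube l (G.cz l y), φ (G.cz l w) := by
          rw [setLIntegral_cube, ← mul_assoc, ENNReal.inv_mul_cancel (G.V_ne_zero l) (G.V_ne_top l),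
            one_mul]
      _ ≤ _ := by
          refine mul_le_mul_right ?_ _
          rw [← lintegral_indicator (G.measurableSet_cube l _)]
          refine lintegral_mono fun w => ?_
          by_cases hw : w ∈ G.cube l (G.cz l y)
          · rw [indicator_of_mem hw, if_pos]
            have h1 := G.dist_lt (G.mem_cube.mp hw).symm
            calc dist x w ≤ dist x y + dist y w := dist_triangle _ _ _
              _ < A * G.h l + G.h l := add_lt_add hxy h1
              _ = _ := by ring
          · rw [indicator_of_notMem hw]; exact zero_le
  · rw [lintegral_const_mul']
    · rw [lintegral_lintegral_swap]
      · calc (G.V l)⁻¹ * ∫⁻ y, ∫⁻ x, (if dist x y < (A + 1) * G.h l then φ (G.cz l y) else 0)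
            ≤ (G.V l)⁻¹ * ∫⁻ y, φ (G.cz l y) * (C * G.V l) := by
              gcongr with y
              have : ∀ x, (if dist x y < (A + 1) * G.h l then φ (G.cz l y) else 0) =
                  (Metric.ball y ((A + 1) * G.h l)).indicator (fun _ => φ (G.cz l y)) x := by
                intro x; simp [indicator, Metric.mem_ball]
              simp only [this]
              rw [lintegral_indicator_const Metric.isOpen_ball.measurableSet]
              gcongr
              exact hC l y
          _ = _ := by
              rw [lintegral_mul_const _ (G.measurable_comp_cz l φ),
                mul_comm, mul_assoc, mul_assoc, ENNReal.mul_inv_cancel (G.V_ne_zero l) (G.V_ne_top l)]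
              rw [mul_one, mul_comm]
      · refine Measurable.aemeasurable ?_
        exact Measurable.ite (measurableSet_lt (by fun_prop) measurable_const)
          ((G.measurable_comp_cz l φ).comp measurable_snd) measurable_const
    · exact ENNReal.inv_ne_top.mpr (G.V_ne_zero l)

end Grid

namespace Grid

variable {n N : ℕ} (G : Grid n)

/-- Averages over Whitney boxes. -/
def M (F : Space n → ℝ≥0∞) (l : ℤ) (z : Fin n → ℤ) : ℝ≥0∞ :=
  (volume (G.box l z))⁻¹ * ∫⁻ w in G.box l z, F w

theorem volume_box_mul_M (F : Space n → ℝ≥0∞) (l : ℤ) (z : Fin n → ℤ) :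
    volume (G.box l z) * G.M F l z = ∫⁻ w in G.box l z, F w := by
  rw [M, ← mul_assoc, ENNReal.mul_inv_cancel (G.volume_box_ne_zero l z) (G.volume_box_ne_top l z),
    one_mul]

theorem setLIntegral_layer_ball_le (F : Space n → ℝ≥0∞) (l : ℤ) (x : EuclideanSpace ℝ (Fin n))
    (r : ℝ) : ∫⁻ w in G.layer l ×ˢ Metric.ball x r, F w ≤
      volume (G.layer l) * ∫⁻ y in Metric.ball x (r + G.h l), G.M F l (G.cz l y) := by
  classical
  set S : Set (Fin n → ℤ) := {z | (G.cube l z ∩ Metric.ball x r).Nonempty} with hS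
  have hsub : G.layer l ×ˢ Metric.ball x r ⊆ ⋃ z : S, G.box l z := by
    rintro ⟨t, y⟩ ⟨ht, hy⟩
    exact mem_iUnion.mpr ⟨⟨G.cz l y, ⟨y, rfl, hy⟩⟩, ⟨ht, rfl⟩⟩
  calc _ ≤ ∫⁻ w in ⋃ z : S, G.box l z, F w := lintegral_mono_set hsub
    _ ≤ ∑' z : S, ∫⁻ w in G.box l z, F w := lintegral_iUnion_le _ _
    _ = ∑' z, S.indicator (fun z => ∫⁻ w in G.box l z, F w) z :=
        tsum_subtype S (fun z => ∫⁻ w in G.box l z, F w)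
    _ = ∑' z, volume (G.layer l) * (G.V l * S.indicator (G.M F l) z) := by
        congr 1; ext z
        by_cases hz : z ∈ S
        · rw [indicator_of_mem hz, indicator_of_mem hz, ← mul_assoc, ← G.volume_box l z,
            volume_box_mul_M]
        · rw [indicator_of_notMem hz, indicator_of_notMem hz]; simp
    _ = volume (G.layer l) * ∫⁻ y, S.indicator (G.M F l) (G.cz l y) := by
        rw [ENNReal.tsum_mul_left, lintegral_comp_cz]
    _ ≤ _ := by
        refine mul_le_mul_right ?_ _
        rw [← lintegral_indicator Metric.isOpen_ball.measurableSet]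
        refine lintegral_mono fun y => ?_
        by_cases hy : G.cz l y ∈ S
        · obtain ⟨w, hw, hw'⟩ := hy
          have h1 : y ∈ Metric.ball x (r + G.h l) := by
            rw [Metric.mem_ball] at hw' ⊢
            have := G.dist_lt (G.mem_cube.mp hw).symm
            linarith [dist_triangle y w x]
          rw [indicator_of_mem h1]
          exact indicator_le_self _ _ _
        · rw [indicator_of_notMem hy]; exact zero_le

theorem enorm_kappa_sq (s : ℝ) (f : Space n → EuclideanSpace ℂ (Fin N)) {w : Space n} (hw : 0 < w.1) :
    ‖kappa (-s) f w‖ₑ ^ 2 = ENNReal.ofReal (w.1 ^ (-(2 * s))) * ‖f w‖ₑ ^ 2 := by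
  rw [kappa, enorm_smul, mul_pow, Real.enorm_of_nonneg (by positivity), ← ENNReal.ofReal_pow
    (by positivity), ← Real.rpow_natCast, ← Real.rpow_mul hw.le]
  congr 3
  push_cast; ring

theorem enorm_kappa_sq_le {s : ℝ} {f : Space n → EuclideanSpace ℂ (Fin N)} {l : ℤ} {w : Space n}
    (hw : w.1 ∈ G.layer l) :
    ‖kappa (-s) f w‖ₑ ^ 2 ≤ G.R ^ |-(2 * s)| * G.R ^ ((l : ℝ) * -(2 * s)) * ‖f w‖ₑ ^ 2 := by
  rw [enorm_kappa_sq s f (G.pos_of_mem_layer hw)]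
  exact mul_le_mul_left (G.ofReal_rpow_le hw _).1 _

theorem le_enorm_kappa_sq {s : ℝ} {f : Space n → EuclideanSpace ℂ (Fin N)} {l : ℤ} {w : Space n}
    (hw : w.1 ∈ G.layer l) :
    G.R ^ ((l : ℝ) * -(2 * s)) * ‖f w‖ₑ ^ 2 ≤ G.R ^ |-(2 * s)| * ‖kappa (-s) f w‖ₑ ^ 2 := by
  rw [enorm_kappa_sq s f (G.pos_of_mem_layer hw), ← mul_assoc]
  exact mul_le_mul_left (G.ofReal_rpow_le hw _).2 _

theorem ofReal_pow_bounds {l : ℤ} {t : ℝ} (ht : t ∈ G.layer l) (k : ℕ) :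
    G.R ^ ((l : ℝ) * k) ≤ ENNReal.ofReal (t ^ k) ∧
      ENNReal.ofReal (t ^ k) ≤ G.R ^ (k : ℝ) * G.R ^ ((l : ℝ) * k) := by
  constructor
  · rw [← ofReal_h_rpow, Real.rpow_natCast]
    exact ENNReal.ofReal_le_ofReal (pow_le_pow_left₀ (G.h_pos l).le ht.1 k)
  · have := (G.ofReal_rpow_le ht (k : ℝ)).1
    rwa [Real.rpow_natCast, abs_of_nonneg (Nat.cast_nonneg k)] at this

theorem exists_volume_box_bounds : ∃ C : ℝ≥0, ∀ (l : ℤ) (z : Fin n → ℤ),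
    G.R ^ ((l : ℝ) * (n + 1 : ℕ)) ≤ C * volume (G.box l z) := by
  obtain ⟨C, hC⟩ := G.exists_Rpow_le
  have h1 : 0 < G.ρ - 1 := by linarith [G.one_lt]
  refine ⟨C * (Real.toNNReal (G.ρ - 1))⁻¹, fun l z => ?_⟩
  rw [volume_box, volume_layer, ENNReal.coe_mul, ENNReal.coe_inv (by simpa using h1)]
  change _ ≤ C * (ENNReal.ofReal (G.ρ - 1))⁻¹ * _
  calc G.R ^ ((l : ℝ) * (n + 1 : ℕ)) = G.R ^ (l : ℝ) * G.R ^ ((l : ℝ) * n) := by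
        rw [← Rpow_add]; push_cast; ring_nf
    _ ≤ G.R ^ (l : ℝ) * (C * G.V l) := by gcongr; exact hC l
    _ = C * ((ENNReal.ofReal (G.ρ - 1))⁻¹ * ENNReal.ofReal (G.ρ - 1)) *
          (G.R ^ (l : ℝ) * G.V l) := by
        rw [ENNReal.inv_mul_cancel (by simpa using h1) ENNReal.ofReal_ne_top]; ring
    _ = _ := by ring

/-- Local upper bound of weighted integrals by box averages. -/
theorem exists_setLIntegral_kappa_le (s A : ℝ) : ∃ C : ℝ≥0,
    ∀ (f : Space n → EuclideanSpace ℂ (Fin N)) (x : EuclideanSpace ℝ (Fin n)) (l : ℤ) (Y : ℝ≥0∞),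
      (∀ y, dist x y < (A + 1) * G.h l →
        G.R ^ ((l : ℝ) * -(2 * s)) * G.M (fun w => ‖f w‖ₑ ^ 2) l (G.cz l y) ≤ Y) →
      ∫⁻ w in G.layer l ×ˢ Metric.ball x (A * G.h l), ‖kappa (-s) f w‖ₑ ^ 2 ≤
        C * G.R ^ ((l : ℝ) * (n + 1 : ℕ)) * Y := by
  obtain ⟨C, hC⟩ := G.exists_volume_ball_le (A + 1)
  have hR1 := G.Rpow_ne_top |-(2 * s)|
  refine ⟨(G.R ^ |-(2 * s)|).toNNReal * Real.toNNReal (G.ρ - 1) * C, fun f x l Y hY => ?_⟩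
  rw [ENNReal.coe_mul, ENNReal.coe_mul, ENNReal.coe_toNNReal hR1]
  change _ ≤ _ * ENNReal.ofReal (G.ρ - 1) * _ * _ * _
  calc _ ≤ ∫⁻ w in G.layer l ×ˢ Metric.ball x (A * G.h l),
          G.R ^ |-(2 * s)| * G.R ^ ((l : ℝ) * -(2 * s)) * ‖f w‖ₑ ^ 2 :=
        setLIntegral_mono' ((G.measurableSet_layer l).prod Metric.isOpen_ball.measurableSet)
          fun w hw => G.enorm_kappa_sq_le hw.1
    _ = G.R ^ |-(2 * s)| * G.R ^ ((l : ℝ) * -(2 * s)) *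
          ∫⁻ w in G.layer l ×ˢ Metric.ball x (A * G.h l), ‖f w‖ₑ ^ 2 :=
        lintegral_const_mul' _ _ (ENNReal.mul_ne_top hR1 (G.Rpow_ne_top _))
    _ ≤ G.R ^ |-(2 * s)| * G.R ^ ((l : ℝ) * -(2 * s)) * (volume (G.layer l) *
          ∫⁻ y in Metric.ball x ((A + 1) * G.h l), G.R ^ ((l : ℝ) * (2 * s)) * Y) := by
        refine mul_le_mul_right ((G.setLIntegral_layer_ball_le _ l x _).trans ?_) _
        refine mul_le_mul_right ?_ _
        rw [show A * G.h l + G.h l = (A + 1) * G.h l by ring]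
        refine setLIntegral_mono' Metric.isOpen_ball.measurableSet fun y hy => ?_
        have h1 := hY y (by rw [dist_comm]; exact hy)
        refine le_trans (le_of_eq ?_) (mul_le_mul_right h1 _)
        rw [← mul_assoc, ← Rpow_add]; simp
    _ ≤ G.R ^ |-(2 * s)| * G.R ^ ((l : ℝ) * -(2 * s)) *
          (ENNReal.ofReal (G.ρ - 1) * G.R ^ (l : ℝ) *
            (G.R ^ ((l : ℝ) * (2 * s)) * Y * (C * G.R ^ ((l : ℝ) * n)))) := by
        rw [setLIntegral_const, volume_layer]
        gcongr
        exact (hC l x).trans (by gcongr; exact G.V_le l)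
    _ = G.R ^ |-(2 * s)| * (G.R ^ ((l : ℝ) * -(2 * s)) * G.R ^ ((l : ℝ) * (2 * s))) *
          (ENNReal.ofReal (G.ρ - 1) * G.R ^ (l : ℝ) * (Y * (C * G.R ^ ((l : ℝ) * n)))) := by ring
    _ = _ := by
        rw [show G.R ^ ((l : ℝ) * -(2 * s)) * G.R ^ ((l : ℝ) * (2 * s)) = 1 by
          rw [← Rpow_add]; simp]
        rw [show (l : ℝ) * (n + 1 : ℕ) = l + l * n by push_cast; ring, Rpow_add]
        ring

/-- Upper bound of the area function by box averages. -/
theorem exists_areaFn_le (s : ℝ) : ∃ C : ℝ≥0,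
    ∀ (f : Space n → EuclideanSpace ℂ (Fin N)) (x : EuclideanSpace ℝ (Fin n)) (Y : ℤ → ℝ≥0∞),
      (∀ l y, dist x y < (G.ρ + 1) * G.h l →
        G.R ^ ((l : ℝ) * -(2 * s)) * G.M (fun w => ‖f w‖ₑ ^ 2) l (G.cz l y) ≤ Y l) →
      areaFn (kappa (-s) f) x ≤ C * (∑' l : ℤ, Y l) ^ (1 / 2 : ℝ) := by
  obtain ⟨C, hC⟩ := G.exists_setLIntegral_kappa_le (N := N) s G.ρ
  refine ⟨C ^ (1 / 2 : ℝ), fun f x Y hY => ?_⟩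
  rw [areaFn, ENNReal.coe_rpow_of_nonneg _ (by norm_num), ← ENNReal.mul_rpow_of_nonneg _ _
    (by norm_num), ← ENNReal.tsum_mul_left]
  refine ENNReal.rpow_le_rpow ?_ (by norm_num)
  have hsub : cone x ⊆ ⋃ l, G.layer l ×ˢ Metric.ball x (G.ρ * G.h l) := by
    rintro ⟨t, y⟩ hw
    have hw' : dist x y < t := hw
    obtain ⟨l, hl⟩ := G.exists_mem_layer (dist_nonneg.trans_lt hw')
    refine mem_iUnion.mpr ⟨l, hl, ?_⟩
    rw [Metric.mem_ball, dist_comm, ← h_succ]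
    exact hw'.trans hl.2
  refine (lintegral_mono_set hsub).trans ((lintegral_iUnion_le _ _).trans ?_)
  refine ENNReal.tsum_le_tsum fun l => ?_
  have hn0 := G.Rpow_ne_zero ((l : ℝ) * (n + 1 : ℕ))
  have hnt := G.Rpow_ne_top ((l : ℝ) * (n + 1 : ℕ))
  calc _ ≤ ∫⁻ w in G.layer l ×ˢ Metric.ball x (G.ρ * G.h l),
          ‖kappa (-s) f w‖ₑ ^ 2 * (G.R ^ ((l : ℝ) * (n + 1 : ℕ)))⁻¹ := by
        refine setLIntegral_mono' ((G.measurableSet_layer l).prod Metric.isOpen_ball.measurableSet)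
          fun w hw => ?_
        rw [div_eq_mul_inv]
        gcongr
        exact (G.ofReal_pow_bounds hw.1 (n + 1)).1
    _ = (∫⁻ w in G.layer l ×ˢ Metric.ball x (G.ρ * G.h l),
          ‖kappa (-s) f w‖ₑ ^ 2) * (G.R ^ ((l : ℝ) * (n + 1 : ℕ)))⁻¹ :=
        lintegral_mul_const' _ _ (ENNReal.inv_ne_top.mpr hn0)
    _ ≤ C * G.R ^ ((l : ℝ) * (n + 1 : ℕ)) * Y l *
          (G.R ^ ((l : ℝ) * (n + 1 : ℕ)))⁻¹ := by
        gcongr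
        exact hC f x l (Y l) (hY l)
    _ = C * Y l * (G.R ^ ((l : ℝ) * (n + 1 : ℕ)) *
          (G.R ^ ((l : ℝ) * (n + 1 : ℕ)))⁻¹) := by ring
    _ = _ := by rw [ENNReal.mul_inv_cancel hn0 hnt, mul_one]

/-- Box averages are controlled by any weighted integral over a set containing the box. -/
theorem exists_M_le (s : ℝ) (k : ℕ) : ∃ C : ℝ≥0,
    ∀ (f : Space n → EuclideanSpace ℂ (Fin N)) (l : ℤ) (z : Fin n → ℤ) (E : Set (Space n)),
      G.box l z ⊆ E → G.R ^ ((l : ℝ) * (n + 1 : ℕ)) *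
        (G.R ^ ((l : ℝ) * -(2 * s)) * G.M (fun w => ‖f w‖ₑ ^ 2) l z) ≤
      C * G.R ^ ((l : ℝ) * k) * ∫⁻ w in E, ‖kappa (-s) f w‖ₑ ^ 2 / ENNReal.ofReal (w.1 ^ k) := by
  obtain ⟨C, hC⟩ := G.exists_volume_box_bounds
  have hR1 := G.Rpow_ne_top |-(2 * s)|
  have hR2 := G.Rpow_ne_top (k : ℝ)
  refine ⟨C * (G.R ^ |-(2 * s)|).toNNReal * (G.R ^ (k : ℝ)).toNNReal, fun f l z E hE => ?_⟩
  rw [ENNReal.coe_mul, ENNReal.coe_mul, ENNReal.coe_toNNReal hR1, ENNReal.coe_toNNReal hR2]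
  calc _ ≤ (C * volume (G.box l z)) *
        (G.R ^ ((l : ℝ) * -(2 * s)) * G.M (fun w => ‖f w‖ₑ ^ 2) l z) := by gcongr; exact hC l z
    _ = C * (G.R ^ ((l : ℝ) * -(2 * s)) * ∫⁻ w in G.box l z, ‖f w‖ₑ ^ 2) := by
        rw [← volume_box_mul_M]; ring
    _ = C * ∫⁻ w in G.box l z, G.R ^ ((l : ℝ) * -(2 * s)) * ‖f w‖ₑ ^ 2 := by
        rw [lintegral_const_mul' _ _ (G.Rpow_ne_top _)]
    _ ≤ C * ∫⁻ w in G.box l z, (G.R ^ |-(2 * s)| * (G.R ^ (k : ℝ) * G.R ^ ((l : ℝ) * k))) *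
          (‖kappa (-s) f w‖ₑ ^ 2 / ENNReal.ofReal (w.1 ^ k)) := by
        refine mul_le_mul_right (setLIntegral_mono' (G.measurableSet_box l z) fun w hw => ?_) _
        refine (G.le_enorm_kappa_sq hw.1).trans ?_
        rw [mul_assoc]
        refine mul_le_mul_right ?_ _
        have hw0 := G.pos_of_mem_layer hw.1
        have h0 : ENNReal.ofReal (w.1 ^ k) ≠ 0 := by simpa using pow_pos hw0 k
        calc ‖kappa (-s) f w‖ₑ ^ 2 = ENNReal.ofReal (w.1 ^ k) *
              (‖kappa (-s) f w‖ₑ ^ 2 / ENNReal.ofReal (w.1 ^ k)) :=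
              (ENNReal.mul_div_cancel h0 ENNReal.ofReal_ne_top).symm
          _ ≤ _ := by gcongr; exact (G.ofReal_pow_bounds hw.1 k).2
    _ = C * ((G.R ^ |-(2 * s)| * (G.R ^ (k : ℝ) * G.R ^ ((l : ℝ) * k))) * ∫⁻ w in G.box l z,
          (‖kappa (-s) f w‖ₑ ^ 2 / ENNReal.ofReal (w.1 ^ k))) := by
        rw [lintegral_const_mul' _ _ (ENNReal.mul_ne_top hR1 (ENNReal.mul_ne_top hR2
          (G.Rpow_ne_top _)))]
    _ ≤ C * ((G.R ^ |-(2 * s)| * (G.R ^ (k : ℝ) * G.R ^ ((l : ℝ) * k))) * ∫⁻ w in E,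
          (‖kappa (-s) f w‖ₑ ^ 2 / ENNReal.ofReal (w.1 ^ k))) := by
        gcongr
    _ = _ := by ring

/-- Lower bound of the area function by box averages. -/
theorem exists_le_areaFn (s : ℝ) : ∃ C : ℝ≥0,
    ∀ (f : Space n → EuclideanSpace ℂ (Fin N)) (x : EuclideanSpace ℝ (Fin n)) (l : ℤ),
      G.R ^ ((l : ℝ) * -(2 * s)) * G.M (fun w => ‖f w‖ₑ ^ 2) l (G.cz l x) ≤
        C * areaFn (kappa (-s) f) x ^ (2 : ℝ) := by
  obtain ⟨C, hC⟩ := G.exists_M_le (N := N) s (n + 1)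
  refine ⟨C, fun f x l => ?_⟩
  have hn0 := G.Rpow_ne_zero ((l : ℝ) * (n + 1 : ℕ))
  have hnt := G.Rpow_ne_top ((l : ℝ) * (n + 1 : ℕ))
  have hsub : G.box l (G.cz l x) ⊆ cone x := by
    rintro ⟨t, y⟩ ⟨ht, hy⟩
    exact (G.dist_lt (G.mem_cube.mp hy).symm).trans_le ht.1
  have h := hC f l _ _ hsub
  rw [areaFn, ← ENNReal.rpow_mul]
  norm_num only [ENNReal.rpow_one]
  rw [mul_comm (C : ℝ≥0∞), mul_assoc] at h
  exact (ENNReal.mul_le_mul_iff_right hn0 hnt).mp h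

/-- Upper bound of the Carleson norm by box averages. -/
theorem exists_carlesonNorm_le (s : ℝ) : ∃ C : ℝ≥0,
    ∀ (f : Space n → EuclideanSpace ℂ (Fin N)) (D : ℝ≥0∞),
      (∀ (x : EuclideanSpace ℝ (Fin n)) (r : ℝ), 0 < r → ∑' l : ℤ, (if G.h l ≤ r then
        G.R ^ ((l : ℝ) * -(2 * s)) * ∫⁻ y in Metric.ball x (2 * r),
          G.M (fun w => ‖f w‖ₑ ^ 2) l (G.cz l y) else 0) ≤
        D ^ (2 : ℝ) * volume (Metric.ball x r)) →
      carlesonNorm 0 (kappa (-s) f) ≤ C * D := by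
  have hR1 := G.Rpow_ne_top |-(2 * s)|
  set K : ℝ≥0∞ := G.R ^ |-(2 * s)| * ENNReal.ofReal (G.ρ - 1) with hK
  have hKt : K ≠ ⊤ := ENNReal.mul_ne_top hR1 ENNReal.ofReal_ne_top
  refine ⟨(K ^ (1 / 2 : ℝ)).toNNReal, fun f D hD => ?_⟩
  rw [ENNReal.coe_toNNReal (ENNReal.rpow_ne_top_of_nonneg (by norm_num) hKt)]
  refine iSup_le fun x => iSup_le fun r => iSup_le fun hr => ?_
  simp only [neg_zero, Real.rpow_zero, ENNReal.ofReal_one, one_mul]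
  have hv0 : volume (Metric.ball x r) ≠ 0 := (Metric.measure_ball_pos volume x hr).ne'
  have hvt : volume (Metric.ball x r) ≠ ⊤ := measure_ball_lt_top.ne
  suffices h : ∫⁻ w in tent x r, ‖kappa (-s) f w‖ₑ ^ 2 / ENNReal.ofReal w.1 ≤
      K * (D ^ (2 : ℝ) * volume (Metric.ball x r)) by
    calc _ ≤ ((volume (Metric.ball x r))⁻¹ * (K * (D ^ (2 : ℝ) * volume (Metric.ball x r)))) ^
          (1 / 2 : ℝ) := by gcongr
      _ = (K * D ^ (2 : ℝ) * ((volume (Metric.ball x r))⁻¹ * volume (Metric.ball x r))) ^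
          (1 / 2 : ℝ) := by congr 1; ring
      _ = _ := by
        rw [ENNReal.inv_mul_cancel hv0 hvt, mul_one, ENNReal.mul_rpow_of_nonneg _ _ (by norm_num),
          ← ENNReal.rpow_mul]
        norm_num
  refine le_trans ?_ (mul_le_mul_right (hD x r hr) K)
  rw [← ENNReal.tsum_mul_left]
  have hsub : tent x r ⊆ ⋃ l : ({l | G.h l ≤ r} : Set ℤ), G.layer l ×ˢ Metric.ball x r := by
    rintro ⟨t, y⟩ ⟨h1, h2⟩
    dsimp only at h1 h2
    obtain ⟨l, hl⟩ := G.exists_mem_layer h1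
    have h3 := dist_nonneg (x := x) (y := y)
    refine mem_iUnion.mpr ⟨⟨l, hl.1.trans (by linarith)⟩, hl, ?_⟩
    rw [Metric.mem_ball, dist_comm]; linarith
  refine (lintegral_mono_set hsub).trans ((lintegral_iUnion_le _ _).trans ?_)
  rw [tsum_subtype {l | G.h l ≤ r} (fun l => ∫⁻ w in G.layer l ×ˢ Metric.ball x r,
    ‖kappa (-s) f w‖ₑ ^ 2 / ENNReal.ofReal w.1)]
  refine ENNReal.tsum_le_tsum fun l => ?_
  by_cases hl : G.h l ≤ r
  swap
  · rw [indicator_of_notMem (show l ∉ {l | G.h l ≤ r} from hl)]; exact zero_le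
  rw [indicator_of_mem (show l ∈ {l | G.h l ≤ r} from hl), if_pos hl]
  have h0 := G.Rpow_ne_zero (l : ℝ)
  have ht := G.Rpow_ne_top (l : ℝ)
  calc _ ≤ ∫⁻ w in G.layer l ×ˢ Metric.ball x r,
          (G.R ^ |-(2 * s)| * G.R ^ ((l : ℝ) * -(2 * s)) * (G.R ^ (l : ℝ))⁻¹) * ‖f w‖ₑ ^ 2 := by
        refine setLIntegral_mono' ((G.measurableSet_layer l).prod Metric.isOpen_ball.measurableSet)
          fun w hw => ?_
        rw [div_eq_mul_inv, mul_right_comm]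
        have h2 := (G.ofReal_pow_bounds hw.1 1).1
        rw [pow_one, Nat.cast_one, mul_one] at h2
        gcongr
        exact G.enorm_kappa_sq_le hw.1
    _ = (G.R ^ |-(2 * s)| * G.R ^ ((l : ℝ) * -(2 * s)) * (G.R ^ (l : ℝ))⁻¹) *
          ∫⁻ w in G.layer l ×ˢ Metric.ball x r, ‖f w‖ₑ ^ 2 :=
        lintegral_const_mul' _ _ (ENNReal.mul_ne_top (ENNReal.mul_ne_top hR1 (G.Rpow_ne_top _))
          (ENNReal.inv_ne_top.mpr h0))
    _ ≤ (G.R ^ |-(2 * s)| * G.R ^ ((l : ℝ) * -(2 * s)) * (G.R ^ (l : ℝ))⁻¹) *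
          (volume (G.layer l) * ∫⁻ y in Metric.ball x (2 * r),
            G.M (fun w => ‖f w‖ₑ ^ 2) l (G.cz l y)) := by
        refine mul_le_mul_right ((G.setLIntegral_layer_ball_le _ l x r).trans ?_) _
        gcongr
        linarith
    _ = (G.R ^ |-(2 * s)| * ENNReal.ofReal (G.ρ - 1)) * (G.R ^ ((l : ℝ) * -(2 * s)) *
          ∫⁻ y in Metric.ball x (2 * r), G.M (fun w => ‖f w‖ₑ ^ 2) l (G.cz l y)) *
          ((G.R ^ (l : ℝ))⁻¹ * G.R ^ (l : ℝ)) := by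
        rw [volume_layer]; ring
    _ = _ := by rw [ENNReal.inv_mul_cancel h0 ht, mul_one, hK]

/-- Lower bound of the Carleson norm by box averages. -/
theorem exists_le_carlesonNorm (s : ℝ) : ∃ C : ℝ≥0,
    ∀ (f : Space n → EuclideanSpace ℂ (Fin N)) (l : ℤ) (z : Fin n → ℤ),
      G.R ^ ((l : ℝ) * -(2 * s)) * G.M (fun w => ‖f w‖ₑ ^ 2) l z ≤
        C * carlesonNorm 0 (kappa (-s) f) ^ (2 : ℝ) := by
  obtain ⟨C, hC⟩ := G.exists_M_le (N := N) s 1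
  obtain ⟨C', hC'⟩ := G.exists_volume_ball_le (G.ρ + 1)
  refine ⟨C * C', fun f l z => ?_⟩
  obtain ⟨x, hx⟩ := G.cube_nonempty l z
  have hh := G.h_pos l
  have hr : 0 < (G.ρ + 1) * G.h l := mul_pos (by linarith [G.ρ_pos]) hh
  have hv0 : volume (Metric.ball x ((G.ρ + 1) * G.h l)) ≠ 0 :=
    (Metric.measure_ball_pos volume x hr).ne'
  have hvt : volume (Metric.ball x ((G.ρ + 1) * G.h l)) ≠ ⊤ := measure_ball_lt_top.ne
  have hsub : G.box l z ⊆ tent x ((G.ρ + 1) * G.h l) := by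
    rintro ⟨t, y⟩ ⟨ht, hy⟩
    refine ⟨G.pos_of_mem_layer ht, ?_⟩
    have h1 := G.dist_lt ((G.mem_cube.mp hx).trans (G.mem_cube.mp hy).symm)
    have h2 := ht.2
    rw [h_succ] at h2
    dsimp only at h2 ⊢
    nlinarith
  have h1 := hC f l z _ hsub
  have h2 : (volume (Metric.ball x ((G.ρ + 1) * G.h l)))⁻¹ * ∫⁻ w in tent x ((G.ρ + 1) * G.h l),
      ‖kappa (-s) f w‖ₑ ^ 2 / ENNReal.ofReal w.1 ≤ carlesonNorm 0 (kappa (-s) f) ^ (2 : ℝ) := by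
    have h3 : ENNReal.ofReal (((G.ρ + 1) * G.h l) ^ (-0 : ℝ)) *
        ((volume (Metric.ball x ((G.ρ + 1) * G.h l)))⁻¹ * ∫⁻ w in tent x ((G.ρ + 1) * G.h l),
      ‖kappa (-s) f w‖ₑ ^ 2 / ENNReal.ofReal w.1) ^ (1 / 2 : ℝ) ≤ carlesonNorm 0 (kappa (-s) f) :=
      le_iSup_of_le x (le_iSup_of_le ((G.ρ + 1) * G.h l) (le_iSup_of_le hr le_rfl))
    simp only [neg_zero, Real.rpow_zero, ENNReal.ofReal_one, one_mul] at h3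
    have h4 := ENNReal.rpow_le_rpow h3 (by norm_num : (0 : ℝ) ≤ 2)
    rw [← ENNReal.rpow_mul] at h4
    norm_num only [ENNReal.rpow_one] at h4
    exact h4
  have h3 : ∫⁻ w in tent x ((G.ρ + 1) * G.h l), ‖kappa (-s) f w‖ₑ ^ 2 / ENNReal.ofReal w.1 ≤
      C' * G.R ^ ((l : ℝ) * n) * carlesonNorm 0 (kappa (-s) f) ^ (2 : ℝ) := by
    calc _ = volume (Metric.ball x ((G.ρ + 1) * G.h l)) *
          ((volume (Metric.ball x ((G.ρ + 1) * G.h l)))⁻¹ *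
          ∫⁻ w in tent x ((G.ρ + 1) * G.h l), ‖kappa (-s) f w‖ₑ ^ 2 / ENNReal.ofReal w.1) := by
          rw [← mul_assoc, ENNReal.mul_inv_cancel hv0 hvt, one_mul]
      _ ≤ _ := by
          gcongr
          exact (hC' l x).trans (by gcongr; exact G.V_le l)
  have hn0 := G.Rpow_ne_zero ((l : ℝ) * (n + 1 : ℕ))
  have hnt := G.Rpow_ne_top ((l : ℝ) * (n + 1 : ℕ))
  refine (ENNReal.mul_le_mul_iff_right hn0 hnt).mp (h1.trans ?_)
  simp only [pow_one]
  refine (mul_le_mul_right h3 _).trans (le_of_eq ?_)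
  rw [show (l : ℝ) * (n + 1 : ℕ) = l * (1 : ℕ) + l * n by push_cast; ring, Rpow_add, ENNReal.coe_mul]
  ring

end Grid

namespace Grid

variable {n N : ℕ} (G : Grid n)

/-! ### `Z`-norms in terms of box averages -/

theorem lintegral_halfSpaceHaar (g : Space n → ℝ≥0∞) :
    ∫⁻ z, g z ∂(halfSpaceHaar n) = ∑' l : ℤ, ∫⁻ z in G.layer l ×ˢ univ,
      ENNReal.ofReal z.1⁻¹ * g z := by
  rw [halfSpaceHaar, halfSpace, lintegral_withDensity_eq_lintegral_mul_non_measurable _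
    (f := fun z : Space n => ENNReal.ofReal z.1⁻¹) (by fun_prop) (Filter.Eventually.of_forall fun t => ENNReal.ofReal_lt_top)]
  have e : {z : Space n | 0 < z.1} = ⋃ l, G.layer l ×ˢ univ := by
    ext z
    simp only [mem_iUnion, mem_prod, mem_univ, and_true, mem_ofPred_eq]
    exact ⟨G.exists_mem_layer, fun ⟨l, hl⟩ => G.pos_of_mem_layer hl⟩
  rw [e, lintegral_iUnion (fun l => (G.measurableSet_layer l).prod MeasurableSet.univ)]
  · rfl
  · intro a b hab
    exact Disjoint.set_prod_left (G.pairwise_disjoint_layer hab) _ _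

theorem setLIntegral_layer_prod (l : ℤ) {φ : EuclideanSpace ℝ (Fin n) → ℝ≥0∞} (hφ : Measurable φ) :
    ∫⁻ z in G.layer l ×ˢ univ, ENNReal.ofReal z.1⁻¹ * φ z.2 =
      (∫⁻ t in G.layer l, ENNReal.ofReal t⁻¹) * ∫⁻ x, φ x := by
  rw [Measure.volume_eq_prod, ← Measure.prod_restrict, Measure.restrict_univ,
    lintegral_prod_mul measurable_inv.ennreal_ofReal.aemeasurable hφ.aemeasurable]

theorem lintegral_layer_le (l : ℤ) :
    ∫⁻ t in G.layer l, ENNReal.ofReal t⁻¹ ≤ ENNReal.ofReal (G.ρ - 1) := by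
  have hh := G.h_pos l
  have h1 := G.one_lt
  calc _ ≤ ∫⁻ t in G.layer l, ENNReal.ofReal (G.h l)⁻¹ :=
        setLIntegral_mono' (G.measurableSet_layer l) fun t ht =>
          ENNReal.ofReal_le_ofReal (inv_anti₀ hh ht.1)
    _ = _ := by
        rw [setLIntegral_const, layer, Real.volume_Ico, ← ENNReal.ofReal_mul (by positivity), h_succ]
        congr 1; field_simp

theorem le_lintegral_layer (l : ℤ) :
    ENNReal.ofReal (1 - G.ρ⁻¹) ≤ ∫⁻ t in G.layer l, ENNReal.ofReal t⁻¹ := by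
  have hh := G.h_pos l
  have h1 := G.one_lt
  have h2 := G.ρ_pos
  calc _ = ∫⁻ t in G.layer l, ENNReal.ofReal (G.h (l + 1))⁻¹ := by
        have h3 := G.h_pos (l + 1)
        rw [setLIntegral_const, layer, Real.volume_Ico, ← ENNReal.ofReal_mul (by positivity), h_succ]
        congr 1; field_simp
    _ ≤ _ := setLIntegral_mono' (G.measurableSet_layer l) fun t ht =>
          ENNReal.ofReal_le_ofReal (inv_anti₀ (G.pos_of_mem_layer ht) ht.2.le)

theorem exists_tsum_le_lintegral_halfSpaceHaar : ∃ C : ℝ≥0,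
    ∀ (g : Space n → ℝ≥0∞) (φ : ℤ → EuclideanSpace ℝ (Fin n) → ℝ≥0∞), (∀ l, Measurable (φ l)) →
      (∀ l z, z.1 ∈ G.layer l → φ l z.2 ≤ g z) →
      ∑' l, ∫⁻ x, φ l x ≤ C * ∫⁻ z, g z ∂(halfSpaceHaar n) := by
  have hc : 0 < 1 - G.ρ⁻¹ := by rw [sub_pos]; exact inv_lt_one_of_one_lt₀ G.one_lt
  refine ⟨(Real.toNNReal (1 - G.ρ⁻¹))⁻¹, fun g φ hφ hg => ?_⟩
  rw [ENNReal.coe_inv (by simpa using hc), mul_comm, ← div_eq_mul_inv,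
    ENNReal.le_div_iff_mul_le (Or.inl (by simpa using hc)) (by simp), mul_comm]
  change ENNReal.ofReal _ * _ ≤ _
  rw [G.lintegral_halfSpaceHaar, ← ENNReal.tsum_mul_left]
  refine ENNReal.tsum_le_tsum fun l => ?_
  calc _ ≤ (∫⁻ t in G.layer l, ENNReal.ofReal t⁻¹) * ∫⁻ x, φ l x := by
        gcongr; exact G.le_lintegral_layer l
    _ = _ := (G.setLIntegral_layer_prod l (hφ l)).symm
    _ ≤ _ := setLIntegral_mono' ((G.measurableSet_layer l).prod MeasurableSet.univ)
        fun z hz => mul_le_mul_right (hg l z hz.1) _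

theorem lintegral_halfSpaceHaar_le (g : Space n → ℝ≥0∞)
    (φ : ℤ → EuclideanSpace ℝ (Fin n) → ℝ≥0∞) (hφ : ∀ l, Measurable (φ l))
    (hg : ∀ l z, z.1 ∈ G.layer l → g z ≤ φ l z.2) :
    ∫⁻ z, g z ∂(halfSpaceHaar n) ≤ ENNReal.ofReal (G.ρ - 1) * ∑' l, ∫⁻ x, φ l x := by
  rw [G.lintegral_halfSpaceHaar, ← ENNReal.tsum_mul_left]
  refine ENNReal.tsum_le_tsum fun l => ?_
  calc _ ≤ ∫⁻ z in G.layer l ×ˢ univ, ENNReal.ofReal z.1⁻¹ * φ l z.2 :=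
        setLIntegral_mono' ((G.measurableSet_layer l).prod MeasurableSet.univ)
          fun z hz => mul_le_mul_right (hg l z hz.1) _
    _ = _ := G.setLIntegral_layer_prod l (hφ l)
    _ ≤ _ := by gcongr; exact G.lintegral_layer_le l

theorem volume_whitney {c₀ c₁ : ℝ} (hc₀ : 0 < c₀) (hc₁ : 1 < c₁) {z : Space n} (hz : 0 < z.1) :
    volume (whitney c₀ c₁ z) = ENNReal.ofReal ((c₁ - c₁⁻¹) * c₀ ^ n) *
      volume (Metric.ball (0 : EuclideanSpace ℝ (Fin n)) 1) * ENNReal.ofReal (z.1 ^ (n + 1)) := by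
  have h1 : c₁⁻¹ < 1 := inv_lt_one_of_one_lt₀ hc₁
  rw [whitney, Measure.volume_eq_prod, Measure.prod_prod, Real.volume_Ioo,
    Measure.addHaar_ball_of_pos _ _ (by positivity), finrank_euclideanSpace_fin, ← mul_assoc,
    ← ENNReal.ofReal_mul, mul_right_comm, ← ENNReal.ofReal_mul]
  · congr 2; ring
  · exact mul_nonneg (by linarith) (by positivity)
  · rw [div_eq_inv_mul, ← sub_mul]; exact mul_nonneg (by linarith) hz.le

theorem whitneyAvg_sq (c₀ c₁ : ℝ) (f : Space n → EuclideanSpace ℂ (Fin N)) (z : Space n) :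
    whitneyAvg c₀ c₁ f z ^ (2 : ℝ) =
      (∫⁻ w in whitney c₀ c₁ z, ‖f w‖ₑ ^ 2) / volume (whitney c₀ c₁ z) := by
  rw [whitneyAvg, ← ENNReal.rpow_mul, setLAverage_eq]
  norm_num

/-- Lower bound of Whitney averages by box averages. -/
theorem exists_le_whitneyAvg {c₀ c₁ : ℝ} (hc₀ : 0 < c₀) (hc₁ : 1 < c₁) (hρ : G.ρ = c₁)
    (hL : n < c₀ * G.L) (s : ℝ) : ∃ C : ℝ≥0,
    ∀ (f : Space n → EuclideanSpace ℂ (Fin N)) (l : ℤ) (z : Space n), z.1 ∈ G.layer l →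
      G.R ^ ((l : ℝ) * -(2 * s)) * G.M (fun w => ‖f w‖ₑ ^ 2) l (G.cz l z.2) ≤
        C * whitneyAvg c₀ c₁ (kappa (-s) f) z ^ (2 : ℝ) := by
  obtain ⟨C, hC⟩ := G.exists_M_le (N := N) s 0
  set K : ℝ≥0∞ := ENNReal.ofReal ((c₁ - c₁⁻¹) * c₀ ^ n) *
      volume (Metric.ball (0 : EuclideanSpace ℝ (Fin n)) 1) * G.R ^ ((n + 1 : ℕ) : ℝ) with hK
  have hKt : K ≠ ⊤ := ENNReal.mul_ne_top (ENNReal.mul_ne_top ENNReal.ofReal_ne_top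
    measure_ball_lt_top.ne) (G.Rpow_ne_top _)
  refine ⟨C * K.toNNReal, fun f l z hz => ?_⟩
  have hz0 := G.pos_of_mem_layer hz
  have hsub : G.box l (G.cz l z.2) ⊆ whitney c₀ c₁ z := by
    rintro ⟨t, y⟩ ⟨ht, hy⟩
    have ht0 := G.pos_of_mem_layer ht
    dsimp only at ht ht0 hy
    have e1 := ht.2
    have e2 := hz.2
    have e3 := ht.1
    have e4 := hz.1
    rw [h_succ, hρ] at e1 e2
    refine ⟨⟨?_, ?_⟩, ?_⟩
    · dsimp only
      rw [div_lt_iff₀ (by linarith)]; nlinarith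
    · dsimp only; nlinarith
    · rw [Metric.mem_ball]
      refine (G.dist_le (G.mem_cube.mp hy)).trans_lt ?_
      have h1 := G.side_le l
      have h2 := G.side_pos l
      have h3 := G.L_pos
      rw [le_div_iff₀ h3] at h1
      nlinarith
  have h1 := hC f l _ _ hsub
  simp only [pow_zero, ENNReal.ofReal_one, div_one, Nat.cast_zero, mul_zero, ENNReal.rpow_zero,
    mul_one] at h1
  have hn0 := G.Rpow_ne_zero ((l : ℝ) * (n + 1 : ℕ))
  have hnt := G.Rpow_ne_top ((l : ℝ) * (n + 1 : ℕ))
  refine (ENNReal.mul_le_mul_iff_right hn0 hnt).mp (h1.trans ?_)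
  have hv : volume (whitney c₀ c₁ z) ≤ K * G.R ^ ((l : ℝ) * (n + 1 : ℕ)) := by
    rw [volume_whitney hc₀ hc₁ hz0, hK, mul_assoc (ENNReal.ofReal _ * _)]
    gcongr
    exact (G.ofReal_pow_bounds hz (n + 1)).2
  have hv0 : volume (whitney c₀ c₁ z) ≠ 0 := fun h0 =>
    G.volume_box_ne_zero l (G.cz l z.2) (measure_mono_null hsub h0)
  have hvt : volume (whitney c₀ c₁ z) ≠ ⊤ :=
    ne_top_of_le_ne_top (ENNReal.mul_ne_top hKt (G.Rpow_ne_top _)) hv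
  calc _ = C * (volume (whitney c₀ c₁ z) * whitneyAvg c₀ c₁ (kappa (-s) f) z ^ (2 : ℝ)) := by
        rw [whitneyAvg_sq, ENNReal.mul_div_cancel hv0 hvt]
    _ ≤ C * (K * G.R ^ ((l : ℝ) * (n + 1 : ℕ)) *
          whitneyAvg c₀ c₁ (kappa (-s) f) z ^ (2 : ℝ)) := by gcongr
    _ = _ := by rw [ENNReal.coe_mul, ENNReal.coe_toNNReal hKt]; ring

/-- Upper bound of Whitney averages by box averages. -/
theorem exists_whitneyAvg_le {c₀ c₁ : ℝ} (hc₀ : 0 < c₀) (hc₁ : 1 < c₁) (hρ : G.ρ = c₁)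
    (s : ℝ) : ∃ C : ℝ≥0,
    ∀ (f : Space n → EuclideanSpace ℂ (Fin N)) (l : ℤ) (z : Space n) (Y : ℤ → ℝ≥0∞),
      z.1 ∈ G.layer l → (∀ k y, dist z.2 y < (c₀ * G.ρ ^ 2 + 1) * G.h k →
        G.R ^ ((k : ℝ) * -(2 * s)) * G.M (fun w => ‖f w‖ₑ ^ 2) k (G.cz k y) ≤ Y k) →
      whitneyAvg c₀ c₁ (kappa (-s) f) z ^ (2 : ℝ) ≤ C * (Y (l - 1) + Y l + Y (l + 1)) := by
  obtain ⟨C, hC⟩ := G.exists_setLIntegral_kappa_le (N := N) s (c₀ * G.ρ ^ 2)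
  set v := volume (Metric.ball (0 : EuclideanSpace ℝ (Fin n)) 1) with hv
  have hv0 : v ≠ 0 := (Metric.measure_ball_pos volume _ one_pos).ne'
  have hvt : v ≠ ⊤ := measure_ball_lt_top.ne
  set K : ℝ≥0∞ := ENNReal.ofReal ((c₁ - c₁⁻¹) * c₀ ^ n) * v with hK
  have h1 : c₁⁻¹ < 1 := inv_lt_one_of_one_lt₀ hc₁
  have hK0 : K ≠ 0 := by
    refine mul_ne_zero ?_ hv0
    have : 0 < (c₁ - c₁⁻¹) * c₀ ^ n := mul_pos (by linarith) (by positivity)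
    simpa using this
  have hKt : K ≠ ⊤ := ENNReal.mul_ne_top ENNReal.ofReal_ne_top hvt
  have hRt := G.Rpow_ne_top ((n + 1 : ℕ) : ℝ)
  refine ⟨(K⁻¹).toNNReal * C * (G.R ^ ((n + 1 : ℕ) : ℝ)).toNNReal, fun f l z Y hz hY => ?_⟩
  rw [ENNReal.coe_mul, ENNReal.coe_mul, ENNReal.coe_toNNReal hRt,
    ENNReal.coe_toNNReal (ENNReal.inv_ne_top.mpr hK0)]
  have hz0 := G.pos_of_mem_layer hz
  have hW : K * G.R ^ ((l : ℝ) * (n + 1 : ℕ)) ≤ volume (whitney c₀ c₁ z) := by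
    rw [volume_whitney hc₀ hc₁ hz0]
    gcongr
    exact (G.ofReal_pow_bounds hz (n + 1)).1
  have hR0 := G.Rpow_ne_zero ((l : ℝ) * (n + 1 : ℕ))
  have hsub : whitney c₀ c₁ z ⊆ (G.layer (l - 1) ×ˢ Metric.ball z.2 (c₀ * G.ρ ^ 2 * G.h (l - 1)) ∪
      G.layer l ×ˢ Metric.ball z.2 (c₀ * G.ρ ^ 2 * G.h l)) ∪
      G.layer (l + 1) ×ˢ Metric.ball z.2 (c₀ * G.ρ ^ 2 * G.h (l + 1)) := by
    rintro ⟨t, y⟩ ⟨⟨ht1, ht2⟩, hy⟩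
    dsimp only at ht1 ht2 hy
    rw [Metric.mem_ball] at hy
    have e0 := G.h_succ (l - 1)
    rw [sub_add_cancel] at e0
    have e1 := G.h_succ l
    have e2 := G.h_succ (l + 1)
    have hp := G.h_pos (l - 1)
    have hρ0 := G.ρ_pos
    have hρ1 := G.one_lt
    have hz1 := hz.1
    have hz2 := hz.2
    rw [div_lt_iff₀ (by linarith), ← hρ] at ht1
    rw [← hρ] at ht2
    have hyb : dist y z.2 < c₀ * G.ρ ^ 2 * G.h (l - 1) := by
      refine hy.trans_le ?_
      rw [mul_assoc]
      gcongr
      calc z.1 ≤ G.h (l + 1) := hz2.le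
        _ = _ := by rw [e1, e0]; ring
    have hm1 := G.h_mono (by omega : l - 1 ≤ l)
    have hm2 := G.h_mono (by omega : l - 1 ≤ l + 1)
    have hcr : 0 ≤ c₀ * G.ρ ^ 2 := by positivity
    rcases lt_or_ge t (G.h l) with h3 | h3
    · refine Or.inl (Or.inl ⟨⟨?_, ?_⟩, hyb⟩)
      · dsimp only; rw [e0] at hz1; nlinarith
      · dsimp only; rw [sub_add_cancel]; exact h3
    rcases lt_or_ge t (G.h (l + 1)) with h4 | h4
    · exact Or.inl (Or.inr ⟨⟨h3, h4⟩, hyb.trans_le (mul_le_mul_of_nonneg_left hm1 hcr)⟩)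
    · refine Or.inr ⟨⟨h4, ?_⟩, hyb.trans_le (mul_le_mul_of_nonneg_left hm2 hcr)⟩
      dsimp only; rw [e2]; nlinarith
  have hI : ∀ k ≤ l + 1, ∫⁻ w in G.layer k ×ˢ Metric.ball z.2 (c₀ * G.ρ ^ 2 * G.h k),
      ‖kappa (-s) f w‖ₑ ^ 2 ≤ C * (G.R ^ ((n + 1 : ℕ) : ℝ) * G.R ^ ((l : ℝ) * (n + 1 : ℕ))) * Y k := by
    intro k hk
    refine (hC f z.2 k (Y k) (hY k)).trans ?_
    gcongr
    rw [← Rpow_add]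
    refine G.Rpow_mono ?_
    have : (k : ℝ) ≤ l + 1 := by exact_mod_cast hk
    nlinarith [(Nat.cast_nonneg (n + 1) : (0 : ℝ) ≤ (n + 1 : ℕ))]
  rw [whitneyAvg_sq]
  refine ENNReal.div_le_of_le_mul ?_
  calc _ ≤ C * (G.R ^ ((n + 1 : ℕ) : ℝ) * G.R ^ ((l : ℝ) * (n + 1 : ℕ))) * Y (l - 1) +
        C * (G.R ^ ((n + 1 : ℕ) : ℝ) * G.R ^ ((l : ℝ) * (n + 1 : ℕ))) * Y l +
        C * (G.R ^ ((n + 1 : ℕ) : ℝ) * G.R ^ ((l : ℝ) * (n + 1 : ℕ))) * Y (l + 1) := by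
        refine (lintegral_mono_set hsub).trans ((lintegral_union_le _ _ _).trans ?_)
        refine add_le_add ((lintegral_union_le _ _ _).trans (add_le_add ?_ ?_)) ?_
        · exact hI _ (by omega)
        · exact hI _ (by omega)
        · exact hI _ le_rfl
    _ = K⁻¹ * C * G.R ^ ((n + 1 : ℕ) : ℝ) * (Y (l - 1) + Y l + Y (l + 1)) *
        (K * G.R ^ ((l : ℝ) * (n + 1 : ℕ))) := by
        have : K⁻¹ * K = 1 := ENNReal.inv_mul_cancel hK0 hKt
        calc _ = 1 * (C * (G.R ^ ((n + 1 : ℕ) : ℝ) * G.R ^ ((l : ℝ) * (n + 1 : ℕ))) *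
              (Y (l - 1) + Y l + Y (l + 1))) := by ring
          _ = _ := by rw [← this]; ring
    _ ≤ _ := by gcongr

end Grid

namespace Grid

variable {n N : ℕ} (G : Grid n)

/-- The weighted `L²` average `(ρ^{-2ls} |Q|⁻¹ ∬_Q |f|²)^{1/2}` over a Whitney box. -/
def e (s : ℝ) (f : L0 n N) (l : ℤ) (z : Fin n → ℤ) : ℝ≥0∞ :=
  (G.R ^ ((l : ℝ) * -(2 * s)) * G.M (fun w => ‖f w‖ₑ ^ 2) l z) ^ (1 / 2 : ℝ)

theorem rpow_half_sq (a : ℝ≥0∞) : (a ^ (1 / 2 : ℝ)) ^ (2 : ℝ) = a := by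
  rw [← ENNReal.rpow_mul]; norm_num

theorem sq_rpow_half (a : ℝ≥0∞) : (a ^ (2 : ℝ)) ^ (1 / 2 : ℝ) = a := by
  rw [← ENNReal.rpow_mul]; norm_num

theorem e_sq (s : ℝ) (f : L0 n N) (l : ℤ) (z : Fin n → ℤ) : G.e s f l z ^ (2 : ℝ) =
    G.R ^ ((l : ℝ) * -(2 * s)) * G.M (fun w => ‖f w‖ₑ ^ 2) l z := rpow_half_sq _

theorem e_shift (s s' : ℝ) (f : L0 n N) (l : ℤ) (z : Fin n → ℤ) :
    G.e s f l z = G.R ^ ((l : ℝ) * (s' - s)) * G.e s' f l z := by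
  rw [e, e, ENNReal.mul_rpow_of_nonneg _ _ (by norm_num), ENNReal.mul_rpow_of_nonneg _ _
    (by norm_num), ← mul_assoc, ← ENNReal.rpow_mul, ← ENNReal.rpow_mul, ← Rpow_add]
  ring_nf

theorem le_of_sq_le {a b : ℝ≥0∞} {C : ℝ≥0} (h : a ^ (2 : ℝ) ≤ C * b ^ (2 : ℝ)) :
    a ≤ (C ^ (1 / 2 : ℝ) : ℝ≥0) * b := by
  have := ENNReal.rpow_le_rpow h (by norm_num : (0 : ℝ) ≤ 1 / 2)
  rwa [ENNReal.mul_rpow_of_nonneg _ _ (by norm_num), sq_rpow_half, sq_rpow_half,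
    ← ENNReal.coe_rpow_of_nonneg _ (by norm_num)] at this

/-! ### Algebra of box averages -/

theorem halfSpace_ae_box {p : Space n → Prop} (h : ∀ᵐ w ∂(halfSpace n), p w) (l : ℤ)
    (z : Fin n → ℤ) : ∀ᵐ w ∂(volume.restrict (G.box l z)), p w := by
  refine ae_mono (Measure.restrict_mono ?_ le_rfl) h
  rintro ⟨t, y⟩ hw
  exact G.pos_of_mem_layer hw.1

theorem e_add_le (s : ℝ) (g k : L0 n N) (l : ℤ) (z : Fin n → ℤ) :
    G.e s (g + k) l z ≤ 2 * (G.e s g l z + G.e s k l z) := by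
  have h1 : G.M (fun w => ‖(g + k : L0 n N) w‖ₑ ^ 2) l z ≤
      2 * G.M (fun w => ‖g w‖ₑ ^ 2) l z + 2 * G.M (fun w => ‖k w‖ₑ ^ 2) l z := by
    have hm : AEMeasurable (fun w => ‖g w‖ₑ ^ 2) (volume.restrict (G.box l z)) := by
      have h2 : AEStronglyMeasurable g (volume.restrict (G.box l z)) := by
        refine g.aestronglyMeasurable.mono_measure (Measure.restrict_mono ?_ le_rfl)
        rintro ⟨t, y⟩ hw
        exact G.pos_of_mem_layer hw.1
      exact h2.enorm.pow_const 2
    rw [M, M, M, mul_left_comm 2, mul_left_comm 2, ← mul_add,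
      ← lintegral_const_mul' _ _ (by norm_num : (2 : ℝ≥0∞) ≠ ⊤),
      ← lintegral_const_mul' _ _ (by norm_num : (2 : ℝ≥0∞) ≠ ⊤),
      ← lintegral_add_left' (hm.const_mul 2)]
    refine mul_le_mul_right (lintegral_mono_ae ?_) _
    filter_upwards [G.halfSpace_ae_box (AEEqFun.coeFn_add g k) l z] with w hw
    rw [hw, Pi.add_apply]
    calc ‖g w + k w‖ₑ ^ 2 ≤ (‖g w‖ₑ + ‖k w‖ₑ) ^ 2 := by gcongr; exact enorm_add_le _ _
      _ ≤ 2 ^ (2 - 1) * (‖g w‖ₑ ^ 2 + ‖k w‖ₑ ^ 2) := by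
          have := ENNReal.rpow_add_le_mul_rpow_add_rpow (‖g w‖ₑ) (‖k w‖ₑ) (p := 2) (by norm_num)
          norm_num at this ⊢
          exact this
      _ = _ := by norm_num; ring
  rw [e]
  calc _ ≤ (G.R ^ ((l : ℝ) * -(2 * s)) * (2 * G.M (fun w => ‖g w‖ₑ ^ 2) l z +
        2 * G.M (fun w => ‖k w‖ₑ ^ 2) l z)) ^ (1 / 2 : ℝ) := by gcongr
    _ = (2 * G.e s g l z ^ (2 : ℝ) + 2 * G.e s k l z ^ (2 : ℝ)) ^ (1 / 2 : ℝ) := by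
        rw [e_sq, e_sq]; ring_nf
    _ ≤ ((2 * (G.e s g l z + G.e s k l z)) ^ (2 : ℝ)) ^ (1 / 2 : ℝ) := by
        gcongr
        rw [ENNReal.mul_rpow_of_nonneg _ _ (by norm_num), ← mul_add]
        have h3 := ENNReal.add_rpow_le_rpow_add (G.e s g l z) (G.e s k l z) (p := 2) (by norm_num)
        gcongr
        norm_num
    _ = _ := sq_rpow_half _

/-- The union of the boxes with indices in a given set. -/
def cutSet (𝒢 : Set (ℤ × (Fin n → ℤ))) : Set (Space n) := ⋃ Q : 𝒢, G.box Q.1.1 Q.1.2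

theorem measurableSet_cutSet (𝒢 : Set (ℤ × (Fin n → ℤ))) : MeasurableSet (G.cutSet 𝒢) :=
  MeasurableSet.iUnion fun _ => G.measurableSet_box _ _

theorem mem_cutSet {𝒢 : Set (ℤ × (Fin n → ℤ))} {l : ℤ} {z : Fin n → ℤ} {w : Space n}
    (hw : w ∈ G.box l z) : w ∈ G.cutSet 𝒢 ↔ (l, z) ∈ 𝒢 := by
  constructor
  · intro h
    obtain ⟨⟨⟨l', z'⟩, hQ⟩, h'⟩ := mem_iUnion.mp h
    dsimp only at h'
    have hl : l' = l := by
      by_contra hne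
      exact Set.disjoint_left.mp (G.pairwise_disjoint_layer hne) h'.1 hw.1
    subst hl
    have hz : z' = z := (G.mem_cube.mp h'.2).symm.trans (G.mem_cube.mp hw.2)
    subst hz
    exact hQ
  · intro h
    exact mem_iUnion.mpr ⟨⟨(l, z), h⟩, hw⟩

/-- Restriction of a function to the boxes with indices in a given set. -/
def cut (f : L0 n N) (𝒢 : Set (ℤ × (Fin n → ℤ))) : L0 n N :=
  AEEqFun.mk ((G.cutSet 𝒢).indicator f) (f.aestronglyMeasurable.indicator (G.measurableSet_cutSet 𝒢))

theorem cut_add_cut_compl (f : L0 n N) (𝒢 : Set (ℤ × (Fin n → ℤ))) :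
    G.cut f 𝒢 + G.cut f 𝒢ᶜ = f := by
  refine AEEqFun.ext ?_
  have hpos : ∀ᵐ w ∂(halfSpace n), 0 < w.1 :=
    ae_restrict_mem (measurableSet_lt measurable_const measurable_fst)
  filter_upwards [AEEqFun.coeFn_add (G.cut f 𝒢) (G.cut f 𝒢ᶜ), AEEqFun.coeFn_mk
    ((G.cutSet 𝒢).indicator f) (f.aestronglyMeasurable.indicator (G.measurableSet_cutSet 𝒢)),
    AEEqFun.coeFn_mk ((G.cutSet 𝒢ᶜ).indicator f)
    (f.aestronglyMeasurable.indicator (G.measurableSet_cutSet 𝒢ᶜ)), hpos] with w h1 h2 h3 h4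
  rw [h1, Pi.add_apply, cut, cut, h2, h3]
  obtain ⟨l, hl⟩ := G.exists_mem_layer h4
  have hw : w ∈ G.box l (G.cz l w.2) := ⟨hl, rfl⟩
  by_cases h : (l, G.cz l w.2) ∈ 𝒢
  · rw [indicator_of_mem ((G.mem_cutSet hw).mpr h), indicator_of_notMem, add_zero]
    rw [G.mem_cutSet hw]; exact fun h' => h' h
  · rw [indicator_of_notMem (fun h' => h ((G.mem_cutSet hw).mp h')), indicator_of_mem, zero_add]
    rw [G.mem_cutSet hw]; exact h

open Classical in
theorem e_cut (s : ℝ) (f : L0 n N) (𝒢 : Set (ℤ × (Fin n → ℤ))) (l : ℤ) (z : Fin n → ℤ) :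
    G.e s (G.cut f 𝒢) l z = if (l, z) ∈ 𝒢 then G.e s f l z else 0 := by
  have h1 : G.M (fun w => ‖(G.cut f 𝒢) w‖ₑ ^ 2) l z =
      if (l, z) ∈ 𝒢 then G.M (fun w => ‖f w‖ₑ ^ 2) l z else 0 := by
    have h2 : ∫⁻ w in G.box l z, ‖(G.cut f 𝒢) w‖ₑ ^ 2 =
        ∫⁻ w in G.box l z, if (l, z) ∈ 𝒢 then ‖f w‖ₑ ^ 2 else 0 := by
      refine lintegral_congr_ae ?_
      filter_upwards [G.halfSpace_ae_box (AEEqFun.coeFn_mk ((G.cutSet 𝒢).indicator f)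
        (f.aestronglyMeasurable.indicator (G.measurableSet_cutSet 𝒢))) l z,
        ae_restrict_mem (G.measurableSet_box l z)] with w hw hw'
      rw [cut, hw]
      split_ifs with h
      · rw [indicator_of_mem ((G.mem_cutSet hw').mpr h)]
      · rw [indicator_of_notMem (fun h' => h ((G.mem_cutSet hw').mp h'))]; simp
    rw [M, h2]
    split_ifs
    · rfl
    · simp
  rw [e, h1]
  split_ifs
  · rfl
  · simp

/-! ### Norms in terms of box averages -/

theorem exists_e_le_areaFn (s : ℝ) : ∃ C : ℝ≥0, ∀ (f : L0 n N) (x : EuclideanSpace ℝ (Fin n)) (l : ℤ),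
    G.e s f l (G.cz l x) ≤ C * areaFn (kappa (-s) f) x := by
  obtain ⟨C, hC⟩ := G.exists_le_areaFn (N := N) s
  exact ⟨C ^ (1 / 2 : ℝ), fun f x l => le_of_sq_le (by rw [e_sq]; exact hC f x l)⟩

theorem exists_e_le_carlesonNorm (s : ℝ) : ∃ C : ℝ≥0, ∀ (f : L0 n N) (l : ℤ) (z : Fin n → ℤ),
    G.e s f l z ≤ C * carlesonNorm 0 (kappa (-s) f) := by
  obtain ⟨C, hC⟩ := G.exists_le_carlesonNorm (N := N) s
  exact ⟨C ^ (1 / 2 : ℝ), fun f l z => le_of_sq_le (by rw [e_sq]; exact hC f l z)⟩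

theorem add_three_rpow_le (a b c : ℝ≥0∞) {q : ℝ} (hq : 0 < q) :
    (a + b + c) ^ q ≤ 3 ^ q * (a ^ q + b ^ q + c ^ q) := by
  have h : a + b + c ≤ 3 * max (max a b) c := by
    have h1 : a ≤ max (max a b) c := (le_max_left _ _).trans (le_max_left _ _)
    have h2 : b ≤ max (max a b) c := (le_max_right _ _).trans (le_max_left _ _)
    have h3 : c ≤ max (max a b) c := le_max_right _ _
    calc a + b + c ≤ max (max a b) c + max (max a b) c + max (max a b) c := by gcongr
      _ = _ := by ring
  calc (a + b + c) ^ q ≤ (3 * max (max a b) c) ^ q := by gcongr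
    _ = 3 ^ q * max (max a b) c ^ q := ENNReal.mul_rpow_of_nonneg _ _ hq.le
    _ ≤ _ := by
      gcongr
      rcases max_cases (max a b) c with ⟨h1, -⟩ | ⟨h1, -⟩ <;> rw [h1]
      · rcases max_cases a b with ⟨h2, -⟩ | ⟨h2, -⟩ <;> rw [h2]
        · exact le_add_right (le_add_right le_rfl)
        · exact le_add_right (le_add_left le_rfl)
      · exact le_add_left le_rfl

variable {c₀ c₁ : ℝ}

theorem exists_zNorm_le (hc₀ : 0 < c₀) (hc₁ : 1 < c₁) (hρ : G.ρ = c₁) (s : ℝ) {P : ℝ} (hP : 0 < P) :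
    ∃ C : ℝ≥0, ∀ f : L0 n N, zNorm c₀ c₁ (.finite P hP s) f ^ P ≤
      C * ∑' l, ∫⁻ x, G.e s f l (G.cz l x) ^ P := by
  obtain ⟨C, hC⟩ := G.exists_whitneyAvg_le (N := N) hc₀ hc₁ hρ s
  obtain ⟨C', hC'⟩ := G.exists_sup_majorant (c₀ * G.ρ ^ 2 + 1)
  set K : ℝ≥0∞ := (C : ℝ≥0∞) ^ (P / 2) * 3 ^ (P / 2) with hK
  have hKt : K ≠ ⊤ := ENNReal.mul_ne_top (ENNReal.rpow_ne_top_of_nonneg (by positivity) (by simp))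
    (ENNReal.rpow_ne_top_of_nonneg (by positivity) (by simp))
  refine ⟨Real.toNNReal (G.ρ - 1) * K.toNNReal * 3 * C', fun f => ?_⟩
  choose Φ hΦm hΦ hΦi using fun l => hC' l (fun z => G.e s f l z ^ P)
  have h1 : zNorm c₀ c₁ (.finite P hP s) f ^ P =
      ∫⁻ z, whitneyAvg c₀ c₁ (kappa (-s) f) z ^ P ∂(halfSpaceHaar n) := by
    change (eLpNorm _ (ENNReal.ofReal P) _) ^ P = _
    rw [eLpNorm_ofReal_eq _ _ hP, ← ENNReal.rpow_mul, one_div_mul_cancel hP.ne', ENNReal.rpow_one]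
    rfl
  rw [h1]
  have h2 : ∀ l (z : Space n), z.1 ∈ G.layer l → whitneyAvg c₀ c₁ (kappa (-s) f) z ^ P ≤
      K * (Φ (l - 1) z.2 + Φ l z.2 + Φ (l + 1) z.2) := by
    intro l z hz
    have h3 := hC f l z (fun k => Φ k z.2 ^ (2 / P)) hz (fun k y hy => by
      rw [← e_sq]
      have := ENNReal.rpow_le_rpow (hΦ k z.2 y hy) (by positivity : 0 ≤ 2 / P)
      rwa [← ENNReal.rpow_mul, mul_div_cancel₀ _ hP.ne'] at this)
    have h4 := ENNReal.rpow_le_rpow h3 (by positivity : 0 ≤ P / 2)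
    rw [← ENNReal.rpow_mul, mul_div_cancel₀ _ two_ne_zero, ENNReal.mul_rpow_of_nonneg _ _
      (by positivity)] at h4
    refine h4.trans ?_
    rw [hK, mul_assoc]
    refine mul_le_mul_right ((add_three_rpow_le _ _ _ (by positivity)).trans (le_of_eq ?_)) _
    have h5 : 2 / P * (P / 2) = 1 := by field_simp
    simp only [← ENNReal.rpow_mul, h5, ENNReal.rpow_one]
  refine (G.lintegral_halfSpaceHaar_le _ (fun l x => K * (Φ (l - 1) x + Φ l x + Φ (l + 1) x))
    (fun l => (((hΦm _).add (hΦm _)).add (hΦm _)).const_mul _) h2).trans ?_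
  have h3 : ∀ l, ∫⁻ x, K * (Φ (l - 1) x + Φ l x + Φ (l + 1) x) =
      K * (∫⁻ x, Φ (l - 1) x) + K * (∫⁻ x, Φ l x) + K * (∫⁻ x, Φ (l + 1) x) := by
    intro l
    rw [lintegral_const_mul' _ _ hKt, lintegral_add_left (f := fun x => Φ (l - 1) x + Φ l x)
      ((hΦm _).add (hΦm _)), lintegral_add_left (hΦm _)]
    ring
  simp only [h3]
  have hs1 : ∑' i : ℤ, ∫⁻ x, Φ (i - 1) x = ∑' i, ∫⁻ x, Φ i x :=
    (Equiv.subRight (1 : ℤ)).tsum_eq (fun l => ∫⁻ x, Φ l x)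
  have hs2 : ∑' i : ℤ, ∫⁻ x, Φ (i + 1) x = ∑' i, ∫⁻ x, Φ i x :=
    (Equiv.addRight (1 : ℤ)).tsum_eq (fun l => ∫⁻ x, Φ l x)
  rw [ENNReal.tsum_add, ENNReal.tsum_add, ENNReal.tsum_mul_left, ENNReal.tsum_mul_left,
    ENNReal.tsum_mul_left, hs1, hs2]
  have h4 : ∑' l, ∫⁻ x, Φ l x ≤ C' * ∑' l, ∫⁻ x, G.e s f l (G.cz l x) ^ P := by
    rw [← ENNReal.tsum_mul_left]
    exact ENNReal.tsum_le_tsum hΦi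
  calc _ = ENNReal.ofReal (G.ρ - 1) * K * 3 * ∑' l, ∫⁻ x, Φ l x := by ring
    _ ≤ ENNReal.ofReal (G.ρ - 1) * K * 3 * (C' * ∑' l, ∫⁻ x, G.e s f l (G.cz l x) ^ P) := by gcongr
    _ = _ := by
      rw [ENNReal.coe_mul, ENNReal.coe_mul, ENNReal.coe_mul, ENNReal.coe_toNNReal hKt]
      simp only [ENNReal.ofReal]
      push_cast; ring

theorem exists_le_zNorm (hc₀ : 0 < c₀) (hc₁ : 1 < c₁) (hρ : G.ρ = c₁) (hL : n < c₀ * G.L) (s : ℝ)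
    {P : ℝ} (hP : 0 < P) :
    ∃ C : ℝ≥0, ∀ f : L0 n N, ∑' l, ∫⁻ x, G.e s f l (G.cz l x) ^ P ≤
      C * zNorm c₀ c₁ (.finite P hP s) f ^ P := by
  obtain ⟨C, hC⟩ := G.exists_le_whitneyAvg (N := N) hc₀ hc₁ hρ hL s
  obtain ⟨C', hC'⟩ := G.exists_tsum_le_lintegral_halfSpaceHaar
  set C₂ : ℝ≥0 := C ^ (1 / 2 : ℝ)
  refine ⟨C' * C₂ ^ P, fun f => ?_⟩
  have h1 : zNorm c₀ c₁ (.finite P hP s) f ^ P =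
      ∫⁻ z, whitneyAvg c₀ c₁ (kappa (-s) f) z ^ P ∂(halfSpaceHaar n) := by
    change (eLpNorm _ (ENNReal.ofReal P) _) ^ P = _
    rw [eLpNorm_ofReal_eq _ _ hP, ← ENNReal.rpow_mul, one_div_mul_cancel hP.ne', ENNReal.rpow_one]
    rfl
  rw [h1]
  refine (hC' (fun z => (C₂ : ℝ≥0∞) ^ P * whitneyAvg c₀ c₁ (kappa (-s) f) z ^ P)
    (fun l x => G.e s f l (G.cz l x) ^ P) (fun l => G.measurable_comp_cz l
      (fun z => G.e s f l z ^ P)) fun l z hz => ?_).trans ?_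
  · rw [← ENNReal.mul_rpow_of_nonneg _ _ hP.le]
    refine ENNReal.rpow_le_rpow (le_of_sq_le ?_) hP.le
    rw [e_sq]; exact hC f l z hz
  · rw [lintegral_const_mul' _ _ (ENNReal.rpow_ne_top_of_nonneg hP.le (by simp)), ENNReal.coe_mul,
      ENNReal.coe_rpow_of_nonneg _ hP.le, mul_assoc]

theorem exists_zNorm_top_le (hc₀ : 0 < c₀) (hc₁ : 1 < c₁) (hρ : G.ρ = c₁) (s : ℝ) :
    ∃ C : ℝ≥0, ∀ (f : L0 n N) (D : ℝ≥0∞), (∀ l z, G.e s f l z ≤ D) →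
      zNorm c₀ c₁ (.infinite s 0 le_rfl) f ≤ C * D := by
  obtain ⟨C, hC⟩ := G.exists_whitneyAvg_le (N := N) hc₀ hc₁ hρ s
  refine ⟨(C * 3) ^ (1 / 2 : ℝ), fun f D hD => ?_⟩
  change eLpNorm _ ⊤ _ ≤ _
  rw [eLpNorm_exponent_top]
  refine eLpNormEssSup_le_of_ae_enorm_bound ?_
  have hpos : ∀ᵐ w ∂(halfSpaceHaar n), 0 < w.1 :=
    (withDensity_absolutelyContinuous _ _).ae_le
      (ae_restrict_mem (measurableSet_lt measurable_const measurable_fst))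
  filter_upwards [hpos] with z hz
  obtain ⟨l, hl⟩ := G.exists_mem_layer hz
  rw [enorm_eq_self]
  refine le_of_sq_le ?_
  have := hC f l z (fun _ => D ^ (2 : ℝ)) hl (fun k y _ => by
    rw [← e_sq]; exact ENNReal.rpow_le_rpow (hD k _) (by norm_num))
  change whitneyAvg c₀ c₁ (kappa (-(s + 0)) f) z ^ (2 : ℝ) ≤ _
  rw [add_zero]
  refine this.trans (le_of_eq ?_)
  push_cast; ring

theorem exists_le_zNorm_top (hc₀ : 0 < c₀) (hc₁ : 1 < c₁) (hρ : G.ρ = c₁) (hL : n < c₀ * G.L)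
    (s : ℝ) : ∃ C : ℝ≥0, ∀ (f : L0 n N) (l : ℤ) (z : Fin n → ℤ),
      G.e s f l z ≤ C * zNorm c₀ c₁ (.infinite s 0 le_rfl) f := by
  obtain ⟨C, hC⟩ := G.exists_le_whitneyAvg (N := N) hc₀ hc₁ hρ hL s
  refine ⟨C ^ (1 / 2 : ℝ), fun f l z => ?_⟩
  change _ ≤ _ * eLpNorm (whitneyAvg c₀ c₁ (kappa (-(s + 0)) f)) ⊤ (halfSpaceHaar n)
  rw [eLpNorm_exponent_top, add_zero]
  have h := ae_le_eLpNormEssSup (μ := halfSpaceHaar n) (f := whitneyAvg c₀ c₁ (kappa (-s) f))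
  rw [halfSpaceHaar, ae_withDensity_iff (by fun_prop)] at h
  have h2 := G.halfSpace_ae_box h l z
  obtain ⟨w, hw, hw'⟩ : ∃ w ∈ G.box l z, whitneyAvg c₀ c₁ (kappa (-s) f) w ≤
      eLpNormEssSup (whitneyAvg c₀ c₁ (kappa (-s) f)) (halfSpaceHaar n) := by
    have h3 := h2.and (ae_restrict_mem (G.measurableSet_box l z))
    have : (ae (volume.restrict (G.box l z))).NeBot := by
      rw [ae_neBot, Ne, Measure.restrict_eq_zero]; exact G.volume_box_ne_zero l z
    obtain ⟨w, hw1, hw2⟩ := h3.exists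
    refine ⟨w, hw2, ?_⟩
    have := hw1 (by simpa using G.pos_of_mem_layer hw2.1)
    rwa [enorm_eq_self] at this
  refine le_trans (le_of_sq_le (b := whitneyAvg c₀ c₁ (kappa (-s) f) w) ?_)
    (mul_le_mul_right hw' _)
  rw [e_sq]
  have := hC f l w hw.1
  rwa [G.mem_cube.mp hw.2] at this

end Grid

namespace Grid

variable {n N : ℕ} (G : Grid n)

/-! ### Upper bounds for tent norms of superpositions -/

theorem exists_tentNorm_finite_le (s : ℝ) {p : ℝ} (hp : 0 < p) {r : ℝ} (hr : 0 < r) (hr1 : r ≤ 1)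
    (hrp : r ≤ p) : ∃ C : ℝ≥0, ∀ (ι : Type) [Countable ι] (g : L0 n N)
      (V : ι → EuclideanSpace ℝ (Fin n) → ℝ≥0∞) (D : ι → ℤ → EuclideanSpace ℝ (Fin n) → ℝ≥0∞),
      (∀ i, Measurable (V i)) → (∀ i x, ∑' l, D i l x ≤ V i x ^ (2 : ℝ)) →
      (∀ l x y, dist x y < (G.ρ + 1) * G.h l → G.e s g l (G.cz l y) ^ (2 : ℝ) ≤ ∑' i, D i l x) →
      tentNorm (.finite p hp s) g ^ r ≤ C * ∑' i, (∫⁻ x, V i x ^ p) ^ (r / p) := by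
  obtain ⟨C, hC⟩ := G.exists_areaFn_le (N := N) s
  refine ⟨C ^ r, fun ι _ g V D hV hD he => ?_⟩
  have h1 : ∀ x, areaFn (kappa (-s) g) x ^ p ≤
      (C : ℝ≥0∞) ^ p * (∑' i, V i x ^ (2 : ℝ)) ^ (p / 2) := by
    intro x
    have h2 := hC g x (fun l => ∑' i, D i l x) (fun l y hy => by rw [← e_sq]; exact he l x y hy)
    rw [ENNReal.tsum_comm] at h2
    have h3 : areaFn (kappa (-s) g) x ≤ C * (∑' i, V i x ^ (2 : ℝ)) ^ (1 / 2 : ℝ) :=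
      h2.trans (mul_le_mul_right (ENNReal.rpow_le_rpow
        (ENNReal.tsum_le_tsum fun i => hD i x) (by norm_num)) _)
    have h4 := ENNReal.rpow_le_rpow h3 hp.le
    rwa [ENNReal.mul_rpow_of_nonneg _ _ hp.le, ← ENNReal.rpow_mul, one_div_mul_eq_div] at h4
  change eLpNorm _ (ENNReal.ofReal p) _ ^ r ≤ _
  rw [eLpNorm_ofReal_eq _ _ hp, ← ENNReal.rpow_mul, one_div_mul_eq_div]
  calc (∫⁻ x, areaFn (kappa (-s) g) x ^ p) ^ (r / p)
      ≤ (∫⁻ x, (C : ℝ≥0∞) ^ p * (∑' i, V i x ^ (2 : ℝ)) ^ (p / 2)) ^ (r / p) :=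
        ENNReal.rpow_le_rpow (lintegral_mono h1) (by positivity)
    _ = (C : ℝ≥0∞) ^ r * (∫⁻ x, (∑' i, V i x ^ (2 : ℝ)) ^ (p / 2)) ^ (r / p) := by
        rw [lintegral_const_mul' _ _ (ENNReal.rpow_ne_top_of_nonneg hp.le (by simp)),
          ENNReal.mul_rpow_of_nonneg _ _ (by positivity), ← ENNReal.rpow_mul,
          mul_div_cancel₀ _ hp.ne']
    _ ≤ _ := by
        rw [ENNReal.coe_rpow_of_nonneg _ hr.le]
        exact mul_le_mul_right (lintegral_tsum_sq_rpow_le hV hr hr1 hrp) _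

theorem exists_tentNorm_infinite_le (s : ℝ) {r : ℝ} (hr : 0 < r) (hr1 : r ≤ 1) :
    ∃ C : ℝ≥0, ∀ (ι : Type) (g : L0 n N) (a : ι → ℝ≥0∞)
      (D : ι → ℤ → (Fin n → ℤ) → ℝ≥0∞), (∀ l z, G.e s g l z ^ (2 : ℝ) ≤ ∑' i, D i l z) →
      (∀ i (x : EuclideanSpace ℝ (Fin n)) (R : ℝ), 0 < R → ∑' l, (if G.h l ≤ R then
        ∫⁻ y in Metric.ball x (2 * R), D i l (G.cz l y) else 0) ≤
          a i ^ (2 : ℝ) * volume (Metric.ball x R)) → Countable ι →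
      tentNorm (.infinite s 0 le_rfl) g ^ r ≤ C * ∑' i, a i ^ r := by
  obtain ⟨C, hC⟩ := G.exists_carlesonNorm_le (N := N) s
  refine ⟨C ^ r, fun ι g a D he hD hι => ?_⟩
  have h1 := hC g ((∑' i, a i ^ (2 : ℝ)) ^ (1 / 2 : ℝ)) fun x R hR => by
    rw [rpow_half_sq, ← ENNReal.tsum_mul_right]
    refine le_trans (le_trans (ENNReal.tsum_le_tsum fun l => ?_) (ENNReal.tsum_comm
      (f := fun l i => if G.h l ≤ R then ∫⁻ y in Metric.ball x (2 * R), D i l (G.cz l y)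
        else 0)).le) (ENNReal.tsum_le_tsum fun i => hD i x R hR)
    split_ifs
    · rw [← lintegral_const_mul' _ _ (G.Rpow_ne_top _), ← lintegral_tsum
        fun i => (G.measurable_comp_cz l (D i l)).aemeasurable]
      refine lintegral_mono fun y => ?_
      rw [← e_sq]; exact he _ _
    · exact zero_le
  change carlesonNorm 0 _ ^ r ≤ _
  calc _ ≤ ((C : ℝ≥0∞) * (∑' i, a i ^ (2 : ℝ)) ^ (1 / 2 : ℝ)) ^ r := ENNReal.rpow_le_rpow h1 hr.le
    _ = (C : ℝ≥0∞) ^ r * (∑' i, a i ^ (2 : ℝ)) ^ (r / 2) := by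
        rw [ENNReal.mul_rpow_of_nonneg _ _ hr.le, ← ENNReal.rpow_mul, one_div_mul_eq_div]
    _ ≤ _ := by
        rw [ENNReal.coe_rpow_of_nonneg _ hr.le]
        refine mul_le_mul_right ((rpow_tsum_le_tsum_rpow _ (by positivity) (by linarith)).trans
          (le_of_eq ?_)) _
        congr 1; ext i
        rw [← ENNReal.rpow_mul, mul_div_cancel₀ _ two_ne_zero]

/-! ### Decomposition into layers -/

theorem exists_tentNorm_layers_finite_le (s : ℝ) {p : ℝ} (hp : 0 < p) {r : ℝ} (hr : 0 < r)
    (hr1 : r ≤ 1) (hrp : r ≤ p) : ∃ C : ℝ≥0, ∀ (g : L0 n N),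
      tentNorm (.finite p hp s) g ^ r ≤
        C * ∑' l, (∫⁻ x, G.e s g l (G.cz l x) ^ p) ^ (r / p) := by
  obtain ⟨C, hC⟩ := G.exists_tentNorm_finite_le (N := N) s hp hr hr1 hrp
  obtain ⟨C', hC'⟩ := G.exists_sup_majorant (G.ρ + 1)
  refine ⟨C * C' ^ (r / p), fun g => ?_⟩
  choose Φ hΦm hΦ hΦi using fun l => hC' l (fun z => G.e s g l z ^ p)
  have h1 := hC ℤ g (fun l x => Φ l x ^ (1 / p)) (fun i l x => if l = i then Φ l x ^ (2 / p) else 0)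
    (fun l => (hΦm l).pow_const _) (fun l x => by
      rw [tsum_ite_eq, ← ENNReal.rpow_mul, one_div_mul_eq_div]) (fun l x y hxy => by
      have h2 : ∑' i, (if l = i then Φ l x ^ (2 / p) else 0) = Φ l x ^ (2 / p) := tsum_ite_eq' _ _
      rw [h2]
      have := ENNReal.rpow_le_rpow (hΦ l x y hxy) (by positivity : 0 ≤ 2 / p)
      rwa [← ENNReal.rpow_mul, mul_div_cancel₀ _ hp.ne'] at this)
  refine h1.trans ?_
  rw [ENNReal.coe_mul, mul_assoc, ENNReal.coe_rpow_of_nonneg _ (by positivity),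
    ← ENNReal.tsum_mul_left (a := (C' : ℝ≥0∞) ^ (r / p))]
  refine mul_le_mul_right (ENNReal.tsum_le_tsum fun l => ?_) _
  rw [← ENNReal.mul_rpow_of_nonneg _ _ (by positivity)]
  refine ENNReal.rpow_le_rpow (le_trans (le_of_eq ?_) (hΦi l)) (by positivity)
  simp only [← ENNReal.rpow_mul, one_div_mul_cancel hp.ne', ENNReal.rpow_one]

theorem volume_ball_mul (x : EuclideanSpace ℝ (Fin n)) {R c : ℝ} (hc : 0 < c) :
    volume (Metric.ball x (c * R)) = ENNReal.ofReal (c ^ n) * volume (Metric.ball x R) := by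
  rw [Measure.addHaar_ball_mul_of_pos _ _ hc, finrank_euclideanSpace_fin,
    Measure.addHaar_ball_center volume x R]

theorem exists_tentNorm_layers_infinite_le (s : ℝ) {r : ℝ} (hr : 0 < r) (hr1 : r ≤ 1) :
    ∃ C : ℝ≥0, ∀ (g : L0 n N), tentNorm (.infinite s 0 le_rfl) g ^ r ≤
        C * ∑' l, (⨆ z, G.e s g l z) ^ r := by
  obtain ⟨C, hC⟩ := G.exists_tentNorm_infinite_le (N := N) s hr hr1
  set C₂ : ℝ≥0 := Real.toNNReal (2 ^ n) with hC₂
  refine ⟨C * (C₂ ^ (1 / 2 : ℝ)) ^ r, fun g => ?_⟩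
  have h1 := hC ℤ g (fun l => (C₂ ^ (1 / 2 : ℝ) : ℝ≥0) * ⨆ z, G.e s g l z)
    (fun i l z => if l = i then G.e s g l z ^ (2 : ℝ) else 0) (fun l z => by
      have h2 : ∑' i, (if l = i then G.e s g l z ^ (2 : ℝ) else 0) = G.e s g l z ^ (2 : ℝ) :=
        tsum_ite_eq' _ _
      rw [h2]) (fun i x R hR => ?_) inferInstance
  · refine h1.trans (le_of_eq ?_)
    simp only [ENNReal.mul_rpow_of_nonneg _ _ hr.le, ENNReal.tsum_mul_left]
    rw [ENNReal.coe_mul, mul_assoc, ENNReal.coe_rpow_of_nonneg _ hr.le]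
  · rw [tsum_eq_single i (fun l hl => by simp [hl])]
    have h2 : (if G.h i ≤ R then ∫⁻ y in Metric.ball x (2 * R),
        (if i = i then G.e s g i (G.cz i y) ^ (2 : ℝ) else 0) else 0) ≤
        (⨆ z, G.e s g i z) ^ (2 : ℝ) * volume (Metric.ball x (2 * R)) := by
      simp only [if_true]
      split_ifs
      · rw [← setLIntegral_const]
        exact lintegral_mono fun y => ENNReal.rpow_le_rpow (le_iSup (G.e s g i) _) (by norm_num)
      · exact zero_le
    refine h2.trans (le_of_eq ?_)
    rw [volume_ball_mul x two_pos, ENNReal.mul_rpow_of_nonneg _ _ (by norm_num),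
      ENNReal.coe_rpow_of_nonneg _ (by norm_num), rpow_half_sq]
    change _ = ENNReal.ofReal _ * _ * _
    ring

/-! ### Decomposition into level sets -/

open Classical in
/-- The weight of a family of boxes: `∑_l ρ^{lm} |E_l|`. -/
def weight (m : ℝ) (E : Set (ℤ × (Fin n → ℤ))) : ℝ≥0∞ :=
  ∑' l : ℤ, ∫⁻ x, G.R ^ ((l : ℝ) * m) * (if (l, G.cz l x) ∈ E then 1 else 0)

open Classical in
theorem exists_tentNorm_levels_finite_le (s : ℝ) {p : ℝ} (hp : 0 < p) {r : ℝ} (hr : 0 < r)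
    (hr1 : r ≤ 1) (hrp : r ≤ p) {m δ : ℝ} (hm : m ≠ 0) (hδ : δ = s + m * (1 / p)) :
    ∃ C : ℝ≥0, ∀ (g : L0 n N) (A : Set ℤ) (E : ℤ → Set (ℤ × (Fin n → ℤ))),
      (∀ l z, G.e δ g l z ≠ 0 → ∃ i ∈ A, (l, z) ∈ E i ∧ G.e δ g l z ≤ 2 ^ ((i : ℝ) + 1)) →
      tentNorm (.finite p hp s) g ^ r ≤
        C * ∑' i : ℤ, if i ∈ A then (2 ^ (i : ℝ) * G.weight m (E i) ^ (1 / p)) ^ r else 0 := by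
  obtain ⟨C, hC⟩ := G.exists_tentNorm_finite_le (N := N) s hp hr hr1 hrp
  obtain ⟨C', hC'⟩ := G.exists_sup_majorant (G.ρ + 1)
  obtain ⟨C₃, hC₃⟩ := Lacunary.exists_tsum_rpow_le
    (lacunary_rpow_int G.one_lt_R G.R_ne_top hm).lt_one (a := 2 / p) (by positivity)
  have hlac := lacunary_rpow_int G.one_lt_R G.R_ne_top hm
  set c : ℝ≥0 := 2 * C₃ ^ (1 / 2 : ℝ) * C' ^ (1 / p) with hc
  refine ⟨C * c ^ r, fun g A E he => ?_⟩
  choose Φ hΦm hΦ hΦi using fun i l => hC' l (fun z => if (l, z) ∈ E i then (1 : ℝ≥0∞) else 0)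
  set X : ℤ → EuclideanSpace ℝ (Fin n) → ℝ≥0∞ := fun i x =>
    ∑' l : ℤ, G.R ^ ((l : ℝ) * m) * Φ i l x with hX
  have hXm : ∀ i, Measurable (X i) := fun i => Measurable.tsum fun l =>
    (hΦm i l).const_mul _
  have hXi : ∀ i, ∫⁻ x, X i x ≤ C' * G.weight m (E i) := by
    intro i
    rw [hX, lintegral_tsum fun l => ((hΦm i l).const_mul _).aemeasurable, weight,
      ← ENNReal.tsum_mul_left]
    refine ENNReal.tsum_le_tsum fun l => ?_
    rw [lintegral_const_mul' _ _ (G.Rpow_ne_top _), lintegral_const_mul' _ _ (G.Rpow_ne_top _),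
      mul_left_comm]
    exact mul_le_mul_right (hΦi i l) _
  have h1 := hC ℤ g (fun i x => if i ∈ A then (2 * C₃ ^ (1 / 2 : ℝ) : ℝ≥0) * 2 ^ (i : ℝ) *
      X i x ^ (1 / p) else 0)
    (fun i l x => if i ∈ A ∧ 1 ≤ Φ i l x then (2 ^ ((i : ℝ) + 1)) ^ (2 : ℝ) *
      (G.R ^ ((l : ℝ) * m)) ^ (2 / p) else 0)
    (fun i => by split_ifs; exacts [((hXm i).pow_const _).const_mul _, measurable_const])
    (fun i x => ?_) (fun l x y hxy => ?_)
  · refine h1.trans ?_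
    rw [ENNReal.coe_mul C, mul_assoc, ← ENNReal.tsum_mul_left (a := ((c ^ r : ℝ≥0) : ℝ≥0∞))]
    refine mul_le_mul_right (ENNReal.tsum_le_tsum fun i => ?_) _
    by_cases hi : i ∈ A
    · simp only [hi, if_true]
      have h2 : ∀ x, ((2 * C₃ ^ (1 / 2 : ℝ) : ℝ≥0) * 2 ^ (i : ℝ) * X i x ^ (1 / p)) ^ p =
          ((2 * C₃ ^ (1 / 2 : ℝ) : ℝ≥0) * 2 ^ (i : ℝ)) ^ p * X i x := by
        intro x
        rw [ENNReal.mul_rpow_of_nonneg _ _ hp.le, ← ENNReal.rpow_mul, one_div_mul_cancel hp.ne',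
          ENNReal.rpow_one]
      have h2t : ((2 : ℝ≥0∞) ^ (i : ℝ)) ≠ ⊤ :=
        ENNReal.rpow_ne_top_of_ne_zero (by norm_num) (by norm_num)
      rw [lintegral_congr h2, lintegral_const_mul' _ _ (ENNReal.rpow_ne_top_of_nonneg hp.le
        (ENNReal.mul_ne_top ENNReal.coe_ne_top h2t)), ENNReal.mul_rpow_of_nonneg _ _ (by positivity),
        ← ENNReal.rpow_mul, mul_div_cancel₀ _ hp.ne']
      calc _ ≤ ((2 * C₃ ^ (1 / 2 : ℝ) : ℝ≥0) * 2 ^ (i : ℝ)) ^ r *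
            (C' * G.weight m (E i)) ^ (r / p) :=
            mul_le_mul_right (ENNReal.rpow_le_rpow (hXi i) (by positivity)) _
        _ = _ := by
          have h3 : ∀ a : ℝ≥0∞, a ^ (r / p) = (a ^ (1 / p)) ^ r := fun a => by
            rw [← ENNReal.rpow_mul, one_div_mul_eq_div]
          rw [ENNReal.coe_rpow_of_nonneg _ hr.le, h3, ← ENNReal.mul_rpow_of_nonneg _ _ hr.le,
            ← ENNReal.mul_rpow_of_nonneg _ _ hr.le, hc, ENNReal.mul_rpow_of_nonneg _ _
            (by positivity : 0 ≤ 1 / p), ENNReal.coe_mul _ (C' ^ (1 / p)),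
            ENNReal.coe_rpow_of_nonneg C' (by positivity : 0 ≤ 1 / p)]
          congr 1; ring
    · simp [hi, ENNReal.zero_rpow_of_pos hp, ENNReal.zero_rpow_of_pos (div_pos hr hp)]
  · by_cases hi : i ∈ A
    · simp only [hi, if_true, true_and]
      calc ∑' l : ℤ, (if 1 ≤ Φ i l x then (2 ^ ((i : ℝ) + 1)) ^ (2 : ℝ) *
            (G.R ^ ((l : ℝ) * m)) ^ (2 / p) else 0)
          ≤ ∑' l : ℤ, (2 ^ ((i : ℝ) + 1)) ^ (2 : ℝ) * (if (G.R ^ ((l : ℝ) * m)) ^ (2 / p) ≤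
            X i x ^ (2 / p) then (G.R ^ ((l : ℝ) * m)) ^ (2 / p) else 0) := by
            refine ENNReal.tsum_le_tsum fun l => ?_
            split_ifs with h2 h3
            · exact le_rfl
            · refine absurd (ENNReal.rpow_le_rpow ?_ (by positivity)) h3
              refine le_trans ?_ (ENNReal.le_tsum l)
              calc G.R ^ ((l : ℝ) * m) = G.R ^ ((l : ℝ) * m) * 1 := (mul_one _).symm
                _ ≤ _ := mul_le_mul_right h2 _
            · exact zero_le
            · exact zero_le
        _ ≤ (2 ^ ((i : ℝ) + 1)) ^ (2 : ℝ) * (C₃ * X i x ^ (2 / p)) := by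
            rw [ENNReal.tsum_mul_left]
            exact mul_le_mul_right (hC₃ ℤ _ hlac _) _
        _ = _ := by
            rw [ENNReal.mul_rpow_of_nonneg _ _ (by norm_num), ENNReal.mul_rpow_of_nonneg _ _
              (by norm_num), ENNReal.coe_mul, ENNReal.mul_rpow_of_nonneg _ _ (by norm_num),
              ENNReal.coe_rpow_of_nonneg C₃ (by norm_num), rpow_half_sq, ← ENNReal.rpow_mul (X i x),
              one_div_mul_eq_div, ENNReal.rpow_add _ _ (by norm_num) (by norm_num),
              ENNReal.rpow_one, ENNReal.mul_rpow_of_nonneg _ _ (by norm_num)]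
            push_cast; ring
    · simp [hi]
  · by_cases h0 : G.e δ g l (G.cz l y) = 0
    · rw [G.e_shift s δ, h0, mul_zero, ENNReal.zero_rpow_of_pos (by norm_num)]
      exact zero_le
    · obtain ⟨i, hi, hE, hle⟩ := he _ _ h0
      refine le_trans ?_ (ENNReal.le_tsum i)
      have h2 : 1 ≤ Φ i l x := by
        have := hΦ i l x y hxy
        rwa [if_pos hE] at this
      rw [if_pos ⟨hi, h2⟩, G.e_shift s δ, ENNReal.mul_rpow_of_nonneg _ _ (by norm_num), mul_comm,
        ← ENNReal.rpow_mul (G.R), ← ENNReal.rpow_mul (G.R)]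
      refine mul_le_mul' (ENNReal.rpow_le_rpow hle (by norm_num)) (le_of_eq ?_)
      rw [hδ]; congr 1; ring

open Classical in
theorem exists_tentNorm_levels_infinite_le (s : ℝ) {r : ℝ} (hr : 0 < r) (hr1 : r ≤ 1) (C₀ : ℝ≥0) :
    ∃ C : ℝ≥0, ∀ (g : L0 n N) (A : Set ℤ) (E : ℤ → Set (ℤ × (Fin n → ℤ))),
      (∀ l z, G.e s g l z ≠ 0 → ∃ i ∈ A, (l, z) ∈ E i ∧ G.e s g l z ≤ 2 ^ ((i : ℝ) + 1)) →
      (∀ i (x : EuclideanSpace ℝ (Fin n)) (R : ℝ), 0 < R → ∑' l, (if G.h l ≤ R then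
        ∫⁻ y in Metric.ball x (2 * R), (if (l, G.cz l y) ∈ E i then 1 else 0) else 0) ≤
          C₀ * volume (Metric.ball x R)) →
      tentNorm (.infinite s 0 le_rfl) g ^ r ≤
        C * ∑' i : ℤ, if i ∈ A then (2 ^ (i : ℝ)) ^ r else 0 := by
  obtain ⟨C, hC⟩ := G.exists_tentNorm_infinite_le (N := N) s hr hr1
  refine ⟨C * (2 * C₀ ^ (1 / 2 : ℝ)) ^ r, fun g A E he hE => ?_⟩
  have h1 := hC ℤ g (fun i => if i ∈ A then (2 * C₀ ^ (1 / 2 : ℝ) : ℝ≥0) * 2 ^ (i : ℝ) else 0)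
    (fun i l z => if i ∈ A then (2 ^ ((i : ℝ) + 1)) ^ (2 : ℝ) * (if (l, z) ∈ E i then 1 else 0) else 0)
    (fun l z => ?_) (fun i x R hR => ?_) inferInstance
  · refine h1.trans (le_of_eq ?_)
    rw [ENNReal.coe_mul C, mul_assoc]
    congr 1
    rw [ENNReal.coe_rpow_of_nonneg _ hr.le, ← ENNReal.tsum_mul_left]
    refine tsum_congr fun i => ?_
    split_ifs
    · rw [ENNReal.mul_rpow_of_nonneg _ _ hr.le]
    · rw [mul_zero, ENNReal.zero_rpow_of_pos hr]
  · by_cases h0 : G.e s g l z = 0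
    · rw [h0, ENNReal.zero_rpow_of_pos (by norm_num)]
      exact zero_le
    · obtain ⟨i, hi, hE, hle⟩ := he _ _ h0
      refine le_trans ?_ (ENNReal.le_tsum i)
      rw [if_pos hi, if_pos hE, mul_one]
      exact ENNReal.rpow_le_rpow hle (by norm_num)
  · by_cases hi : i ∈ A
    · simp only [hi, if_true]
      have h2t : ((2 : ℝ≥0∞) ^ ((i : ℝ) + 1)) ^ (2 : ℝ) ≠ ⊤ := ENNReal.rpow_ne_top_of_nonneg
        (by norm_num) (ENNReal.rpow_ne_top_of_ne_zero (by norm_num) (by norm_num))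
      simp only [lintegral_const_mul' _ _ h2t]
      calc _ = (2 ^ ((i : ℝ) + 1)) ^ (2 : ℝ) * ∑' l, (if G.h l ≤ R then
            ∫⁻ y in Metric.ball x (2 * R), (if (l, G.cz l y) ∈ E i then 1 else 0) else 0) := by
            rw [← ENNReal.tsum_mul_left]; congr 1; ext l; split_ifs <;> simp
        _ ≤ (2 ^ ((i : ℝ) + 1)) ^ (2 : ℝ) * (C₀ * volume (Metric.ball x R)) :=
            mul_le_mul_right (hE i x R hR) _
        _ = _ := by
            rw [ENNReal.mul_rpow_of_nonneg _ _ (by norm_num), ENNReal.coe_mul,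
              ENNReal.mul_rpow_of_nonneg _ _ (by norm_num), ENNReal.coe_rpow_of_nonneg C₀
              (by norm_num), rpow_half_sq, ENNReal.rpow_add _ _ (by norm_num) (by norm_num),
              ENNReal.rpow_one, ENNReal.mul_rpow_of_nonneg _ _ (by norm_num)]
            push_cast; ring
    · simp [hi]

end Grid

namespace Grid

variable {n N : ℕ} (G : Grid n)

/-! ### Majorants whose level sets are sparse -/

theorem exists_tsum_Rpow {c : ℝ} (hc : 0 < c) :
    ∃ C : ℝ≥0, ∑' k : ℕ, G.R ^ ((k : ℝ) * -c) = C := by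
  have h1 : G.R ^ (-c) < 1 := ENNReal.rpow_lt_one_of_one_lt_of_neg G.one_lt_R (by linarith)
  have h2 : ∑' k : ℕ, G.R ^ ((k : ℝ) * -c) = (1 - G.R ^ (-c))⁻¹ := by
    rw [← ENNReal.tsum_geometric]
    refine tsum_congr fun k => ?_
    rw [← ENNReal.rpow_natCast, ← ENNReal.rpow_mul, mul_comm]
  rw [h2]
  exact ⟨_, (ENNReal.coe_toNNReal (ENNReal.inv_ne_top.mpr (tsub_pos_of_lt h1).ne')).symm⟩

theorem tsum_Rpow_mul_shift (A : ℤ → ℝ≥0∞) (σ : ℤ) (m ε : ℝ) :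
    ∑' l : ℤ, G.R ^ ((l : ℝ) * m) * ∑' k : ℕ, G.R ^ ((k : ℝ) * ε) * A (l + σ * k) =
      (∑' k : ℕ, G.R ^ ((k : ℝ) * (ε - σ * m))) * ∑' l : ℤ, G.R ^ ((l : ℝ) * m) * A l := by
  conv_lhs => simp only [← ENNReal.tsum_mul_left]
  rw [ENNReal.tsum_comm, ← ENNReal.tsum_mul_right]
  refine tsum_congr fun k => ?_
  rw [← ENNReal.tsum_mul_left, ← (Equiv.addRight (σ * (k : ℤ))).tsum_eq
    (fun l : ℤ => G.R ^ ((k : ℝ) * (ε - σ * m)) * (G.R ^ ((l : ℝ) * m) * A l))]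
  refine tsum_congr fun l => ?_
  simp only [Equiv.coe_addRight]
  rw [← mul_assoc, ← mul_assoc, ← Rpow_add, ← Rpow_add]
  congr 2
  push_cast; ring

/-- A point of the cube with index `z` in the layer `l`. -/
def pt (l : ℤ) (z : Fin n → ℤ) : EuclideanSpace ℝ (Fin n) := (G.cube_nonempty l z).choose

theorem cz_pt (l : ℤ) (z : Fin n → ℤ) : G.cz l (G.pt l z) = z := (G.cube_nonempty l z).choose_spec

/-- Averaging over cubes preserves integrals against functions of a coarser layer. -/
theorem lintegral_mul_average {l l' : ℤ} (hl : l' ≤ l) (φ : (Fin n → ℤ) → ℝ≥0∞)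
    {F : EuclideanSpace ℝ (Fin n) → ℝ≥0∞} (hF : Measurable F) :
    ∫⁻ x, φ (G.cz l x) * ((G.V l')⁻¹ * ∫⁻ y in G.cube l' (G.cz l' x), F y) =
      ∫⁻ x, φ (G.cz l x) * F x := by
  have h1 : ∀ x, G.cz l x = G.cz l (G.pt l' (G.cz l' x)) := fun x =>
    G.cz_congr hl (G.cz_pt l' _).symm
  have h2 : ∫⁻ x, φ (G.cz l x) * ((G.V l')⁻¹ * ∫⁻ y in G.cube l' (G.cz l' x), F y) =
      ∫⁻ x, (fun z => φ (G.cz l (G.pt l' z)) * ((G.V l')⁻¹ * ∫⁻ y in G.cube l' z, F y))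
        (G.cz l' x) := by
    refine lintegral_congr fun x => ?_
    simp only [← h1]
  refine (h2.trans (G.lintegral_comp_cz l' fun z => φ (G.cz l (G.pt l' z)) *
    ((G.V l')⁻¹ * ∫⁻ y in G.cube l' z, F y))).trans ?_
  have hU : ⋃ z, G.cube l' z = univ := by
    ext x; simp [mem_cube]
  have hd : Pairwise (Function.onFun Disjoint (G.cube l')) := by
    intro z z' hz
    rw [Function.onFun, Set.disjoint_left]
    exact fun x hx hx' => hz ((G.mem_cube.mp hx).symm.trans (G.mem_cube.mp hx'))
  rw [← setLIntegral_univ, ← hU, lintegral_iUnion (G.measurableSet_cube l') hd]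
  refine tsum_congr fun z => ?_
  rw [setLIntegral_congr_fun (f := fun x => φ (G.cz l x) * F x)
    (g := fun x => φ (G.cz l (G.pt l' z)) * F x)
    (G.measurableSet_cube l' z), lintegral_const_mul _ hF]
  · rw [mul_left_comm, ← mul_assoc (G.V l'), ENNReal.mul_inv_cancel (G.V_ne_zero _) (G.V_ne_top _),
      one_mul]
  · intro x hx
    simp only
    rw [h1 x, G.mem_cube.mp hx]

open Classical in
theorem tsum_ite_le_of_growth {B : ℤ → ℝ≥0∞} {ε : ℝ} {lam Λ : ℝ≥0∞} {K : ℕ} (hK : Λ ≤ G.R ^ (K * ε))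
    (hB : ∀ (l : ℤ) (k : ℕ), G.R ^ (k * ε) * B (l + k) ≤ B l) (hε : 0 < ε) :
    ∑' l, (if lam < B l ∧ B l ≤ Λ * lam then (1 : ℝ≥0∞) else 0) ≤ 2 * K := by
  have key : ∀ l₁ l₂ : ℤ, l₁ ≤ l₂ → (lam < B l₁ ∧ B l₁ ≤ Λ * lam) →
      (lam < B l₂ ∧ B l₂ ≤ Λ * lam) → l₂ < l₁ + K := by
    intro l₁ l₂ h12 h1 h2
    by_contra! hcon
    obtain ⟨k, hk⟩ := Int.le.dest h12
    have hk' : (K : ℝ) ≤ k := by exact_mod_cast (by omega : K ≤ k)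
    have h3 := hB l₁ k
    rw [hk] at h3
    have h4 : G.R ^ ((k : ℝ) * ε) * lam < G.R ^ ((k : ℝ) * ε) * B l₂ :=
      ENNReal.mul_lt_mul_right (G.Rpow_ne_zero _) (G.Rpow_ne_top _) h2.1
    have h5 : Λ * lam ≤ G.R ^ ((k : ℝ) * ε) * lam :=
      mul_le_mul_left (hK.trans (G.Rpow_mono (by gcongr))) _
    exact absurd (h4.trans_le (h3.trans (h1.2.trans h5))) (lt_irrefl _)
  by_cases hne : ∃ l₀, lam < B l₀ ∧ B l₀ ≤ Λ * lam
  · obtain ⟨l₀, hl₀⟩ := hne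
    rw [tsum_eq_sum (s := Finset.Ico (l₀ - K) (l₀ + K))]
    · refine (Finset.sum_le_card_nsmul _ _ 1 fun l _ => ?_).trans ?_
      · split_ifs <;> simp
      · rw [Int.card_Ico, nsmul_one]
        have : (l₀ + K - (l₀ - K)).toNat = 2 * K := by omega
        rw [this]; push_cast; exact le_rfl
    · intro l hl
      rw [if_neg]
      intro h
      apply hl
      rw [Finset.mem_Ico]
      rcases le_total l l₀ with h' | h'
      · have := key l l₀ h' h hl₀; omega
      · have := key l₀ l h' hl₀ h; omega
  · push Not at hne
    have : ∀ l, (if lam < B l ∧ B l ≤ Λ * lam then (1 : ℝ≥0∞) else 0) = 0 := fun l =>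
      if_neg fun h => absurd h.2 (not_le.mpr (hne l h.1))
    simp [this]

open Classical in
theorem exists_sparse_majorant_of_pos {m : ℝ} (hm : 0 < m) {Λ : ℝ≥0∞} (hΛ : Λ ≠ ⊤) :
    ∃ C : ℝ≥0, ∀ a : ℤ → (Fin n → ℤ) → ℝ≥0∞, ∃ B : ℤ → (Fin n → ℤ) → ℝ≥0∞,
      (∀ l z, a l z ≤ B l z) ∧
      ∑' l : ℤ, G.R ^ ((l : ℝ) * m) * ∫⁻ x, B l (G.cz l x) ≤
        C * ∑' l : ℤ, G.R ^ ((l : ℝ) * m) * ∫⁻ x, a l (G.cz l x) ∧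
      ∀ lam : ℝ≥0∞, lam ≠ 0 → lam ≠ ⊤ → ∀ (x : EuclideanSpace ℝ (Fin n)) (r : ℝ), 0 < r →
        ∑' l, (if G.h l ≤ r then ∫⁻ y in Metric.ball x (2 * r),
          (if lam < B l (G.cz l y) ∧ B l (G.cz l y) ≤ Λ * lam then 1 else 0) else 0) ≤
            C * volume (Metric.ball x r) := by
  set ε : ℝ := m / 2 with hε
  have hε0 : 0 < ε := by positivity
  obtain ⟨C₁, hC₁⟩ := G.exists_tsum_Rpow (c := ε) hε0
  obtain ⟨K, hK⟩ : ∃ K : ℕ, Λ ≤ G.R ^ (K * ε) := by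
    have h1 : 1 < G.R ^ ε := ENNReal.one_lt_rpow G.one_lt_R hε0
    obtain ⟨K, hK⟩ := ((ENNReal.tendsto_pow_atTop_nhds_top_iff.mpr h1).eventually
      (eventually_ge_nhds (lt_top_iff_ne_top.mpr hΛ))).exists
    refine ⟨K, hK.trans_eq ?_⟩
    rw [← ENNReal.rpow_natCast, ← ENNReal.rpow_mul, mul_comm]
  refine ⟨max C₁ (2 * K * Real.toNNReal (2 ^ n)), fun a => ?_⟩
  set B : ℤ → (Fin n → ℤ) → ℝ≥0∞ := fun l z =>
    ∑' k : ℕ, G.R ^ ((k : ℝ) * ε) * a (l + 1 * k) (G.cz (l + 1 * k) (G.pt l z)) with hB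
  have hBx : ∀ l x, B l (G.cz l x) =
      ∑' k : ℕ, G.R ^ ((k : ℝ) * ε) * a (l + 1 * k) (G.cz (l + 1 * k) x) := by
    intro l x
    refine tsum_congr fun k => ?_
    rw [G.cz_congr (by omega : l ≤ l + 1 * k) (G.cz_pt l (G.cz l x))]
  refine ⟨B, fun l z => ?_, ?_, ?_⟩
  · refine le_trans (le_of_eq ?_) (ENNReal.le_tsum 0)
    simp [cz_pt]
  · have h1 : ∀ l, ∫⁻ x, B l (G.cz l x) =
        ∑' k : ℕ, G.R ^ ((k : ℝ) * ε) * ∫⁻ x, a (l + 1 * k) (G.cz (l + 1 * k) x) := by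
      intro l
      simp only [hBx]
      rw [lintegral_tsum fun k => ((G.measurable_comp_cz _ _).const_mul _).aemeasurable]
      refine tsum_congr fun k => ?_
      rw [lintegral_const_mul' _ _ (G.Rpow_ne_top _)]
    simp only [h1]
    rw [G.tsum_Rpow_mul_shift (fun l => ∫⁻ x, a l (G.cz l x)) 1 m ε]
    have h2 : ε - ((1 : ℤ) : ℝ) * m = -ε := by rw [hε]; push_cast; ring
    rw [h2, hC₁]
    exact mul_le_mul_left (by simp) _
  · intro lam h0 ht x r hr
    have h1 : ∀ y, ∑' l, (if lam < B l (G.cz l y) ∧ B l (G.cz l y) ≤ Λ * lam then (1 : ℝ≥0∞)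
        else 0) ≤ 2 * K := by
      intro y
      refine G.tsum_ite_le_of_growth hK (B := fun l => B l (G.cz l y)) (fun l k => ?_) hε0
      rw [hBx, hBx, ← ENNReal.tsum_mul_left]
      calc _ = ∑' j : ℕ, G.R ^ (((j + k : ℕ) : ℝ) * ε) * a (l + 1 * ((j + k : ℕ) : ℤ))
            (G.cz (l + 1 * ((j + k : ℕ) : ℤ)) y) := by
            refine tsum_congr fun j => ?_
            rw [← mul_assoc, ← Rpow_add]
            have e1 : (l + k + 1 * (j : ℤ)) = l + 1 * ((j + k : ℕ) : ℤ) := by push_cast; ring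
            rw [e1]
            congr 2
            push_cast; ring
        _ ≤ _ := ENNReal.tsum_comp_le_tsum_of_injective (f := fun j => j + k)
              (add_left_injective k) (fun j : ℕ => G.R ^ ((j : ℝ) * ε) * a (l + 1 * (j : ℤ))
                (G.cz (l + 1 * (j : ℤ)) y))
    calc _ ≤ ∑' l, ∫⁻ y in Metric.ball x (2 * r),
          (if lam < B l (G.cz l y) ∧ B l (G.cz l y) ≤ Λ * lam then 1 else 0) := by
          refine ENNReal.tsum_le_tsum fun l => ?_
          split_ifs
          · exact le_rfl
          · exact zero_le
      _ ≤ ∫⁻ y in Metric.ball x (2 * r), 2 * K := by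
          rw [← lintegral_tsum fun l => (G.measurable_comp_cz l fun z =>
            if lam < B l z ∧ B l z ≤ Λ * lam then (1 : ℝ≥0∞) else 0).aemeasurable]
          exact lintegral_mono h1
      _ = 2 * K * Real.toNNReal (2 ^ n) * volume (Metric.ball x r) := by
          rw [setLIntegral_const, volume_ball_mul x two_pos]
          simp only [ENNReal.ofReal]; ring
      _ ≤ _ := by
          refine mul_le_mul_left ?_ _
          exact_mod_cast le_max_right _ _

open Classical in
theorem carleson_of_decay {E : Set (ℤ × (Fin n → ℤ))} {ε : ℝ} {Λ : ℝ≥0∞}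
    (hE : ∀ l z (k : ℕ), (l, z) ∈ E → ∫⁻ y in G.cube l z,
      (if (l - k, G.cz (l - k) y) ∈ E then (1 : ℝ≥0∞) else 0) ≤ Λ * G.R ^ ((k : ℝ) * -ε) * G.V l)
    (x : EuclideanSpace ℝ (Fin n)) {r : ℝ} (hr : 0 < r) :
    ∑' l, (if G.h l ≤ r then ∫⁻ y in Metric.ball x (2 * r),
      (if (l, G.cz l y) ∈ E then (1 : ℝ≥0∞) else 0) else 0) ≤
        Λ * (∑' k : ℕ, G.R ^ ((k : ℝ) * -ε)) * volume (Metric.ball x (3 * r)) := by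
  obtain ⟨l₀, hl₀⟩ := G.exists_mem_layer hr
  have hle : ∀ l, G.h l ≤ r ↔ l ≤ l₀ := fun l =>
    ⟨fun h => G.lt_succ_of_mem_layer hl₀ h, fun h => (G.h_mono h).trans hl₀.1⟩
  -- `T l y` holds for the top layer in which `y` lies below a box of `E`
  set T : ℤ → EuclideanSpace ℝ (Fin n) → Prop := fun l y =>
    l ≤ l₀ ∧ (l, G.cz l y) ∈ E ∧ ∀ l', l < l' → l' ≤ l₀ → (l', G.cz l' y) ∉ E with hT
  have hTcongr : ∀ l y y', G.cz l y = G.cz l y' → T l y → T l y' := by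
    rintro l y y' hy ⟨h1, h2, h3⟩
    refine ⟨h1, hy ▸ h2, fun l' hl hl' => ?_⟩
    rw [← G.cz_congr hl.le hy]; exact h3 l' hl hl'
  have hTuniq : ∀ y l l', T l y → T l' y → l = l' := by
    intro y l l' h h'
    by_contra hne
    rcases lt_or_gt_of_ne hne with hlt | hlt
    · exact h.2.2 l' hlt h'.1 h'.2.1
    · exact h'.2.2 l hlt h.1 h.2.1
  have hTex : ∀ y l, l ≤ l₀ → (l, G.cz l y) ∈ E → ∃ k : ℕ, T (l + k) y := by
    intro y l hl hlE
    have hbdd : ∃ b : ℤ, ∀ z : ℤ, (z ≤ l₀ ∧ (z, G.cz z y) ∈ E) → z ≤ b := ⟨l₀, fun z hz => hz.1⟩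
    obtain ⟨t, ht, hmax⟩ := Int.exists_greatest_of_bdd hbdd ⟨l, hl, hlE⟩
    obtain ⟨k, hk⟩ := Int.le.dest (hmax l ⟨hl, hlE⟩)
    refine ⟨k, ?_⟩
    rw [hk]
    refine ⟨ht.1, ht.2, fun l' h1 h2 h3 => ?_⟩
    have := hmax l' ⟨h2, h3⟩
    omega
  set φ : ℤ → (Fin n → ℤ) → ℝ≥0∞ := fun l z =>
    if T l (G.pt l z) ∧ ∃ y ∈ Metric.ball x (2 * r), G.cz l y = z then 1 else 0 with hφ
  have hφT : ∀ l y, φ l (G.cz l y) = if T l y ∧ ∃ y' ∈ Metric.ball x (2 * r),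
      G.cz l y' = G.cz l y then 1 else 0 := by
    intro l y
    have : T l (G.pt l (G.cz l y)) ↔ T l y :=
      ⟨hTcongr _ _ _ (G.cz_pt l _), hTcongr _ _ _ (G.cz_pt l _).symm⟩
    simp only [hφ, this]
  set χ : ℤ → EuclideanSpace ℝ (Fin n) → ℝ≥0∞ := fun l y => if (l, G.cz l y) ∈ E then 1 else 0
    with hχ
  have hχm : ∀ l, Measurable (χ l) := fun l =>
    G.measurable_comp_cz l fun z => if (l, z) ∈ E then (1 : ℝ≥0∞) else 0
  have hφm : ∀ l, Measurable fun y => φ l (G.cz l y) := fun l => G.measurable_comp_cz l (φ l)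
  have h1 : ∀ l, (if G.h l ≤ r then ∫⁻ y in Metric.ball x (2 * r), χ l y else 0) ≤
      ∑' k : ℕ, ∫⁻ y, φ (l + k) (G.cz (l + k) y) * χ l y := by
    intro l
    rw [← lintegral_tsum (f := fun (k : ℕ) y => φ (l + k) (G.cz (l + k) y) * χ l y)
      fun k => ((hφm _).mul (hχm l)).aemeasurable]
    split_ifs with hlr
    · rw [← lintegral_indicator measurableSet_ball]
      refine lintegral_mono fun y => ?_
      by_cases hy : y ∈ Metric.ball x (2 * r)
      · rw [indicator_of_mem hy]
        by_cases hlE : (l, G.cz l y) ∈ E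
        · obtain ⟨k, hk⟩ := hTex y l ((hle l).mp hlr) hlE
          refine le_trans ?_ (ENNReal.le_tsum k)
          rw [hφT, if_pos ⟨hk, y, hy, rfl⟩, one_mul]
        · simp [hχ, hlE]
      · rw [indicator_of_notMem hy]; exact zero_le
    · exact zero_le
  have h2 : ∀ l (k : ℕ), ∫⁻ y, φ l (G.cz l y) * χ (l - k) y ≤
      Λ * G.R ^ ((k : ℝ) * -ε) * ∫⁻ y, φ l (G.cz l y) := by
    intro l k
    have h3 : ∫⁻ y, φ l (G.cz l y) * χ (l - k) y =
        ∫⁻ y, φ l (G.cz l y) * ((G.V l)⁻¹ * ∫⁻ w in G.cube l (G.cz l y), χ (l - k) w) :=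
      (G.lintegral_mul_average le_rfl _ (hχm _)).symm
    rw [h3, ← lintegral_const_mul _ (hφm l)]
    refine lintegral_mono fun y => ?_
    simp only
    rw [hφT]
    split_ifs with hy
    · rw [one_mul, mul_one]
      refine (mul_le_mul_right (hE l _ k hy.1.2.1) _).trans (le_of_eq ?_)
      rw [mul_left_comm, ENNReal.inv_mul_cancel (G.V_ne_zero _) (G.V_ne_top _), mul_one]
    · simp
  have h3 : ∑' l, ∫⁻ y, φ l (G.cz l y) ≤ volume (Metric.ball x (3 * r)) := by
    rw [← lintegral_tsum fun l => (hφm l).aemeasurable, ← setLIntegral_one,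
      ← lintegral_indicator measurableSet_ball]
    refine lintegral_mono fun y => ?_
    by_cases hne : ∃ l, φ l (G.cz l y) ≠ 0
    · obtain ⟨l, hl⟩ := hne
      have hl' : T l y ∧ ∃ y' ∈ Metric.ball x (2 * r), G.cz l y' = G.cz l y := by
        by_contra hcon
        exact hl (by rw [hφT, if_neg hcon])
      rw [tsum_eq_single l, hφT, if_pos hl', indicator_of_mem]
      · obtain ⟨y', hy', hc⟩ := hl'.2
        rw [Metric.mem_ball] at hy' ⊢
        have h4 := (G.dist_lt hc).trans_le ((hle l).mpr hl'.1.1)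
        have h5 := dist_triangle y y' x
        rw [dist_comm y y'] at h5
        linarith
      · intro l' hl'2
        rw [hφT, if_neg]
        exact fun h => hl'2 (hTuniq y l' l h.1 hl'.1)
    · push Not at hne
      simp [hne]
  calc _ ≤ ∑' l, ∑' k : ℕ, ∫⁻ y, φ (l + k) (G.cz (l + k) y) * χ l y :=
        ENNReal.tsum_le_tsum h1
    _ = ∑' k : ℕ, ∑' l : ℤ, ∫⁻ y, φ l (G.cz l y) * χ (l - k) y := by
        rw [ENNReal.tsum_comm]
        refine tsum_congr fun k => ?_
        rw [← (Equiv.addRight (k : ℤ)).tsum_eq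
          (fun l : ℤ => ∫⁻ y, φ l (G.cz l y) * χ (l - k) y)]
        simp
    _ ≤ ∑' k : ℕ, ∑' l : ℤ, Λ * G.R ^ ((k : ℝ) * -ε) * ∫⁻ y, φ l (G.cz l y) :=
        ENNReal.tsum_le_tsum fun k => ENNReal.tsum_le_tsum fun l => h2 l k
    _ = Λ * (∑' k : ℕ, G.R ^ ((k : ℝ) * -ε)) * ∑' l, ∫⁻ y, φ l (G.cz l y) := by
        simp only [ENNReal.tsum_mul_left, ENNReal.tsum_mul_right]
    _ ≤ _ := mul_le_mul_right h3 _

open Classical in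
theorem exists_sparse_majorant_of_neg {m : ℝ} (hm : m < 0) {Λ : ℝ≥0∞} (hΛ : Λ ≠ ⊤) :
    ∃ C : ℝ≥0, ∀ a : ℤ → (Fin n → ℤ) → ℝ≥0∞, ∃ B : ℤ → (Fin n → ℤ) → ℝ≥0∞,
      (∀ l z, a l z ≤ B l z) ∧
      ∑' l : ℤ, G.R ^ ((l : ℝ) * m) * ∫⁻ x, B l (G.cz l x) ≤
        C * ∑' l : ℤ, G.R ^ ((l : ℝ) * m) * ∫⁻ x, a l (G.cz l x) ∧
      ∀ lam : ℝ≥0∞, lam ≠ 0 → lam ≠ ⊤ → ∀ (x : EuclideanSpace ℝ (Fin n)) (r : ℝ), 0 < r →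
        ∑' l, (if G.h l ≤ r then ∫⁻ y in Metric.ball x (2 * r),
          (if lam < B l (G.cz l y) ∧ B l (G.cz l y) ≤ Λ * lam then 1 else 0) else 0) ≤
            C * volume (Metric.ball x r) := by
  set ε : ℝ := -m / 2 with hε
  have hε0 : 0 < ε := by rw [hε]; linarith
  obtain ⟨C₁, hC₁⟩ := G.exists_tsum_Rpow (c := ε) hε0
  refine ⟨max C₁ (Λ.toNNReal * C₁ * Real.toNNReal (3 ^ n)), fun a => ?_⟩
  set F : ℤ → EuclideanSpace ℝ (Fin n) → ℝ≥0∞ := fun l x =>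
    ∑' k : ℕ, G.R ^ ((k : ℝ) * ε) * a (l + (-1) * k) (G.cz (l + (-1) * k) x) with hF
  have hFm : ∀ l, Measurable (F l) := fun l => Measurable.tsum fun k =>
    (G.measurable_comp_cz _ _).const_mul _
  set B : ℤ → (Fin n → ℤ) → ℝ≥0∞ := fun l z => (G.V l)⁻¹ * ∫⁻ y in G.cube l z, F l y with hB
  have hmean : ∀ (l l' : ℤ), l' ≤ l → ∀ φ : (Fin n → ℤ) → ℝ≥0∞,
      ∫⁻ x, φ (G.cz l x) * B l' (G.cz l' x) = ∫⁻ x, φ (G.cz l x) * F l' x :=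
    fun l l' hl φ => G.lintegral_mul_average hl φ (hFm l')
  have hdecay : ∀ l (k : ℕ) x, F (l - k) x ≤ G.R ^ ((k : ℝ) * -ε) * F l x := by
    intro l k x
    have h1 : G.R ^ ((k : ℝ) * ε) * F (l - k) x ≤ F l x := by
      simp only [hF]
      rw [← ENNReal.tsum_mul_left]
      calc _ = ∑' j : ℕ, G.R ^ (((j + k : ℕ) : ℝ) * ε) * a (l + (-1) * ((j + k : ℕ) : ℤ))
            (G.cz (l + (-1) * ((j + k : ℕ) : ℤ)) x) := by
            refine tsum_congr fun j => ?_
            rw [← mul_assoc, ← Rpow_add]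
            have e1 : (l - k + (-1) * (j : ℤ)) = l + (-1) * ((j + k : ℕ) : ℤ) := by
              push_cast; ring
            rw [e1]
            congr 2
            push_cast; ring
        _ ≤ _ := ENNReal.tsum_comp_le_tsum_of_injective (f := fun j => j + k)
              (add_left_injective k) (fun j : ℕ => G.R ^ ((j : ℝ) * ε) * a (l + (-1) * (j : ℤ))
                (G.cz (l + (-1) * (j : ℤ)) x))
    calc F (l - k) x = G.R ^ ((k : ℝ) * -ε) * (G.R ^ ((k : ℝ) * ε) * F (l - k) x) := by
          rw [← mul_assoc, ← Rpow_add]; simp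
      _ ≤ _ := mul_le_mul_right h1 _
  refine ⟨B, fun l z => ?_, ?_, ?_⟩
  · have h1 : ∫⁻ y in G.cube l z, a l (G.cz l y) ≤ ∫⁻ y in G.cube l z, F l y := by
      refine lintegral_mono fun y => ?_
      refine le_trans (le_of_eq ?_) (ENNReal.le_tsum 0)
      simp
    rw [setLIntegral_cube] at h1
    calc a l z = (G.V l)⁻¹ * (G.V l * a l z) := by
          rw [← mul_assoc, ENNReal.inv_mul_cancel (G.V_ne_zero _) (G.V_ne_top _), one_mul]
      _ ≤ _ := mul_le_mul_right h1 _
  · have h1 : ∀ l, ∫⁻ x, B l (G.cz l x) = ∑' k : ℕ, G.R ^ ((k : ℝ) * ε) *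
        ∫⁻ x, a (l + (-1) * k) (G.cz (l + (-1) * k) x) := by
      intro l
      have h2 := hmean l l le_rfl 1
      simp only [Pi.one_apply, one_mul] at h2
      rw [h2, hF, lintegral_tsum fun k => ((G.measurable_comp_cz _ _).const_mul _).aemeasurable]
      refine tsum_congr fun k => ?_
      rw [lintegral_const_mul' _ _ (G.Rpow_ne_top _)]
    simp only [h1]
    rw [G.tsum_Rpow_mul_shift (fun l => ∫⁻ x, a l (G.cz l x)) (-1) m ε]
    have h2 : ε - ((-1 : ℤ) : ℝ) * m = -ε := by rw [hε]; push_cast; ring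
    rw [h2, hC₁]
    exact mul_le_mul_left (by simp) _
  · intro lam h0 ht x r hr
    obtain ⟨E, hE⟩ : ∃ E : Set (ℤ × (Fin n → ℤ)), ∀ l z,
        (l, z) ∈ E ↔ lam < B l z ∧ B l z ≤ Λ * lam :=
      ⟨{Q | lam < B Q.1 Q.2 ∧ B Q.1 Q.2 ≤ Λ * lam}, fun l z => Iff.rfl⟩
    have h1 := G.carleson_of_decay (E := E) (ε := ε) (Λ := Λ) (fun l z k hz => ?_) x hr
    · refine le_trans (le_of_eq ?_) (h1.trans ?_)
      · refine tsum_congr fun l => ?_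
        congr 1
        exact lintegral_congr fun y => if_congr (hE l _).symm rfl rfl
      rw [hC₁, volume_ball_mul x three_pos, ← mul_assoc]
      refine mul_le_mul_left ?_ _
      calc Λ * C₁ * ENNReal.ofReal (3 ^ n) =
          ((Λ.toNNReal * C₁ * Real.toNNReal (3 ^ n) : ℝ≥0) : ℝ≥0∞) := by
            rw [ENNReal.coe_mul, ENNReal.coe_mul, ENNReal.coe_toNNReal hΛ]; rfl
        _ ≤ _ := by exact_mod_cast le_max_right _ _
    · rw [← ENNReal.mul_le_mul_iff_right h0 ht, ← lintegral_const_mul' _ _ ht]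
      calc ∫⁻ y in G.cube l z, lam * (if (l - k, G.cz (l - k) y) ∈ E then 1 else 0)
          ≤ ∫⁻ y in G.cube l z, B (l - k) (G.cz (l - k) y) := by
            refine lintegral_mono fun y => ?_
            simp only
            split_ifs with h
            · rw [mul_one]; exact ((hE _ _).mp h).1.le
            · simp
        _ = ∫⁻ y in G.cube l z, F (l - k) y := by
            have h2 := hmean l (l - k) (by omega) (fun w => if w = z then 1 else 0)
            have h3 : ∀ u : EuclideanSpace ℝ (Fin n) → ℝ≥0∞,
                ∫⁻ x, (if G.cz l x = z then 1 else 0) * u x = ∫⁻ y in G.cube l z, u y := by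
              intro u
              rw [← lintegral_indicator (G.measurableSet_cube l z)]
              refine lintegral_congr fun y => ?_
              by_cases hy : G.cz l y = z
              · rw [if_pos hy, one_mul, indicator_of_mem (G.mem_cube.mpr hy)]
              · rw [if_neg hy, zero_mul, indicator_of_notMem (fun h => hy (G.mem_cube.mp h))]
            rw [← h3, ← h3]; exact h2
        _ ≤ ∫⁻ y in G.cube l z, G.R ^ ((k : ℝ) * -ε) * F l y :=
            lintegral_mono fun y => hdecay l k y
        _ = G.R ^ ((k : ℝ) * -ε) * (G.V l * B l z) := by
            rw [lintegral_const_mul' _ _ (G.Rpow_ne_top _), hB, ← mul_assoc (G.V l),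
              ENNReal.mul_inv_cancel (G.V_ne_zero _) (G.V_ne_top _), one_mul]
        _ ≤ G.R ^ ((k : ℝ) * -ε) * (G.V l * (Λ * lam)) :=
            mul_le_mul_right (mul_le_mul_right ((hE _ _).mp hz).2 _) _
        _ = _ := by ring

open Classical in
theorem exists_sparse_majorant {m : ℝ} (hm : m ≠ 0) {P : ℝ} (hP : 0 < P) :
    ∃ C : ℝ≥0, ∀ b : ℤ → (Fin n → ℤ) → ℝ≥0∞, ∃ β : ℤ → (Fin n → ℤ) → ℝ≥0∞,
      (∀ l z, b l z ≤ β l z) ∧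
      ∑' l : ℤ, G.R ^ ((l : ℝ) * m) * ∫⁻ x, β l (G.cz l x) ^ P ≤
        C * ∑' l : ℤ, G.R ^ ((l : ℝ) * m) * ∫⁻ x, b l (G.cz l x) ^ P ∧
      ∀ (i : ℤ) (x : EuclideanSpace ℝ (Fin n)) (r : ℝ), 0 < r →
        ∑' l, (if G.h l ≤ r then ∫⁻ y in Metric.ball x (2 * r),
          (if 2 ^ (i : ℝ) < β l (G.cz l y) ∧ β l (G.cz l y) ≤ 2 ^ ((i : ℝ) + 1) then 1 else 0)
            else 0) ≤ C * volume (Metric.ball x r) := by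
  have hΛ : (2 : ℝ≥0∞) ^ P ≠ ⊤ := ENNReal.rpow_ne_top_of_nonneg hP.le (by norm_num)
  obtain ⟨C, hC⟩ := (lt_or_gt_of_ne hm).elim (fun h => G.exists_sparse_majorant_of_neg h hΛ)
    (fun h => G.exists_sparse_majorant_of_pos h hΛ)
  refine ⟨C, fun b => ?_⟩
  obtain ⟨B, h1, h2, h3⟩ := hC (fun l z => b l z ^ P)
  have hpow : ∀ a : ℝ≥0∞, (a ^ (1 / P)) ^ P = a := fun a => by
    rw [← ENNReal.rpow_mul, one_div_mul_cancel hP.ne', ENNReal.rpow_one]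
  refine ⟨fun l z => B l z ^ (1 / P), fun l z => ?_, ?_, fun i x r hr => ?_⟩
  · rw [← ENNReal.rpow_le_rpow_iff hP, hpow]; exact h1 l z
  · simp only [hpow]; exact h2
  · have h4 := h3 ((2 ^ (i : ℝ)) ^ P)
      (ENNReal.rpow_pos (ENNReal.rpow_pos (by norm_num) (by norm_num))
        (ENNReal.rpow_ne_top_of_ne_zero (by norm_num) (by norm_num))).ne'
      (ENNReal.rpow_ne_top_of_nonneg hP.le
        (ENNReal.rpow_ne_top_of_ne_zero (by norm_num) (by norm_num))) x r hr
    refine le_trans (le_of_eq ?_) h4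
    refine tsum_congr fun l => ?_
    have h5 : ∀ y, (2 ^ (i : ℝ) < B l (G.cz l y) ^ (1 / P) ∧
        B l (G.cz l y) ^ (1 / P) ≤ 2 ^ ((i : ℝ) + 1)) ↔ ((2 ^ (i : ℝ)) ^ P < B l (G.cz l y) ∧
        B l (G.cz l y) ≤ 2 ^ P * (2 ^ (i : ℝ)) ^ P) := by
      intro y
      rw [← ENNReal.rpow_lt_rpow_iff hP, ← ENNReal.rpow_le_rpow_iff hP (y := 2 ^ ((i : ℝ) + 1)),
        hpow, ← ENNReal.mul_rpow_of_nonneg _ _ hP.le, add_comm,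
        ENNReal.rpow_add _ _ (by norm_num) (by norm_num), ENNReal.rpow_one]
    simp only [h5]

end Grid

/-! ### The `K`-functional of a superposition -/

section KFunctional

variable {V : Type*} [AddCommGroup V] {N₀ N₁ : V → ℝ≥0∞}

theorem kFunctional_mul_le {c t : ℝ} (hc : 1 ≤ c) (f : V) :
    kFunctional N₀ N₁ (c * t) f ≤ ENNReal.ofReal c * kFunctional N₀ N₁ t f := by
  have hc0 : 0 < c := by linarith
  have h0 : ENNReal.ofReal c ≠ 0 := by simpa using hc0
  rw [mul_comm (ENNReal.ofReal c), ← ENNReal.div_le_iff h0 ENNReal.ofReal_ne_top]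
  refine le_kFunctional fun g h e => ?_
  rw [ENNReal.div_le_iff h0 ENNReal.ofReal_ne_top, ← e]
  refine (kFunctional_le (c * t) g h).trans ?_
  rw [ENNReal.ofReal_mul hc0.le, add_mul, mul_assoc, mul_comm (ENNReal.ofReal c)]
  refine add_le_add (le_mul_of_one_le_right' ?_) le_rfl
  simpa using hc

open Classical in
theorem kFunctional_rpow_le_tsum {r η : ℝ} (hr : 0 < r) (hr1 : r ≤ 1) {c : ℝ≥0}
    {τ u : ℤ → ℝ≥0∞} {f : V}
    (h : ∀ A A' : Set ℤ, A' = Aᶜ → ∃ g k, g + k = f ∧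
      N₀ g ^ r ≤ c * (∑' i, if i ∈ A then (τ i ^ η * u i) ^ r else 0) ∧
      N₁ k ^ r ≤ c * (∑' i, if i ∈ A' then (τ i ^ (η - 1) * u i) ^ r else 0)) (t : ℝ) :
    kFunctional N₀ N₁ t f ^ r ≤ ∑' i, (if τ i ≤ ENNReal.ofReal t then
      τ i ^ η * ((c ^ (1 / r) : ℝ≥0) * u i)
        else ENNReal.ofReal t * τ i ^ (η - 1) * ((c ^ (1 / r) : ℝ≥0) * u i)) ^ r := by
  obtain ⟨A, hA⟩ : ∃ A : Set ℤ, ∀ i, i ∈ A ↔ τ i ≤ ENNReal.ofReal t :=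
    ⟨{i | τ i ≤ ENNReal.ofReal t}, fun _ => Iff.rfl⟩
  obtain ⟨A', hA'⟩ : ∃ A' : Set ℤ, A' = Aᶜ := ⟨_, rfl⟩
  obtain ⟨g, k, rfl, hg, hk⟩ := h A A' hA'
  have hc : ((c ^ (1 / r) : ℝ≥0) : ℝ≥0∞) ^ r = c := by
    rw [ENNReal.coe_rpow_of_nonneg _ (by positivity), ← ENNReal.rpow_mul,
      one_div_mul_cancel hr.ne', ENNReal.rpow_one]
  calc kFunctional N₀ N₁ t (g + k) ^ r ≤ (N₀ g + ENNReal.ofReal t * N₁ k) ^ r :=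
        ENNReal.rpow_le_rpow (kFunctional_le t g k) hr.le
    _ ≤ N₀ g ^ r + (ENNReal.ofReal t * N₁ k) ^ r := ENNReal.rpow_add_le_add_rpow _ _ hr.le hr1
    _ ≤ c * (∑' i, if i ∈ A then (τ i ^ η * u i) ^ r else 0) + ENNReal.ofReal t ^ r *
        (c * (∑' i, if i ∈ A' then (τ i ^ (η - 1) * u i) ^ r else 0)) := by
        rw [ENNReal.mul_rpow_of_nonneg _ _ hr.le]
        exact add_le_add hg (mul_le_mul_right hk _)
    _ = ∑' i, (c * (if i ∈ A then (τ i ^ η * u i) ^ r else 0) + ENNReal.ofReal t ^ r *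
        (c * (if i ∈ A' then (τ i ^ (η - 1) * u i) ^ r else 0))) := by
        rw [ENNReal.tsum_add, ENNReal.tsum_mul_left, ENNReal.tsum_mul_left, ENNReal.tsum_mul_left]
    _ = _ := by
        refine tsum_congr fun i => ?_
        by_cases hi : τ i ≤ ENNReal.ofReal t
        · have h1 : i ∈ A := (hA i).mpr hi
          have h2 : i ∉ A' := by rw [hA']; exact fun h => h h1
          rw [if_pos h1, if_neg h2, if_pos hi, mul_zero, mul_zero, add_zero, mul_left_comm (τ i ^ η),
            ENNReal.mul_rpow_of_nonneg ((c ^ (1 / r) : ℝ≥0) : ℝ≥0∞) _ hr.le, hc]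
        · have h1 : i ∉ A := fun h => hi ((hA i).mp h)
          have h2 : i ∈ A' := by rw [hA']; exact h1
          rw [if_neg h1, if_pos h2, if_neg hi, mul_zero, zero_add]
          have h3 : ENNReal.ofReal t * τ i ^ (η - 1) * ((c ^ (1 / r) : ℝ≥0) * u i) =
              ENNReal.ofReal t * ((c ^ (1 / r) : ℝ≥0) * (τ i ^ (η - 1) * u i)) := by ring
          rw [h3, ENNReal.mul_rpow_of_nonneg (ENNReal.ofReal t) _ hr.le,
            ENNReal.mul_rpow_of_nonneg ((c ^ (1 / r) : ℝ≥0) : ℝ≥0∞) _ hr.le, hc]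

end KFunctional

namespace Grid

variable {n N : ℕ} (G : Grid n)

theorem ofReal_rpow_int (l : ℤ) (a : ℝ) :
    ENNReal.ofReal (G.ρ ^ ((l : ℝ) * a)) = G.R ^ ((l : ℝ) * a) := by
  rw [R, ENNReal.ofReal_rpow_of_pos G.ρ_pos]

/-! ### Interpolation between tent spaces of equal integrability -/

section Layers

variable {N₀ N₁ : L0 n N → ℝ≥0∞} {nl : ℤ → ((Fin n → ℤ) → ℝ≥0∞) → ℝ≥0∞} {s₀ s₁ η : ℝ}

open Classical in
theorem kFunctional_rpow_le_layers {r : ℝ} (hr : 0 < r) (hr1 : r ≤ 1)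
    (hnl : ∀ l c φ, c ≠ ⊤ → nl l (fun z => c * φ z) = c * nl l φ) {C : ℝ≥0}
    (h₀ : ∀ g, N₀ g ^ r ≤ C * ∑' l, nl l (G.e s₀ g l) ^ r)
    (h₁ : ∀ g, N₁ g ^ r ≤ C * ∑' l, nl l (G.e s₁ g l) ^ r) (f : L0 n N) (t : ℝ) :
    kFunctional N₀ N₁ t f ^ r ≤ ∑' l : ℤ, (if G.R ^ ((l : ℝ) * (s₁ - s₀)) ≤ ENNReal.ofReal t then
      (G.R ^ ((l : ℝ) * (s₁ - s₀))) ^ η *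
        ((C ^ (1 / r) : ℝ≥0) * nl l (G.e ((1 - η) * s₀ + η * s₁) f l))
      else ENNReal.ofReal t * (G.R ^ ((l : ℝ) * (s₁ - s₀))) ^ (η - 1) *
        ((C ^ (1 / r) : ℝ≥0) * nl l (G.e ((1 - η) * s₀ + η * s₁) f l))) ^ r := by
  have hcut : ∀ (s a : ℝ) (l : ℤ) (A : Set ℤ), (l : ℝ) * (((1 - η) * s₀ + η * s₁) - s) = a →
      nl l (G.e s (G.cut f {Q | Q.1 ∈ A}) l) ^ r =
        if l ∈ A then (G.R ^ a * nl l (G.e ((1 - η) * s₀ + η * s₁) f l)) ^ r else 0 := by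
    intro s a l A ha
    have h1 : G.e s (G.cut f {Q | Q.1 ∈ A}) l = fun z => (if l ∈ A then G.R ^ a else 0) *
        G.e ((1 - η) * s₀ + η * s₁) f l z := by
      ext z
      rw [e_cut, G.e_shift s ((1 - η) * s₀ + η * s₁), ha]
      by_cases hl : l ∈ A
      · rw [if_pos hl, if_pos (show (l, z) ∈ {Q : ℤ × (Fin n → ℤ) | Q.1 ∈ A} from hl)]
      · rw [if_neg hl, if_neg (show (l, z) ∉ {Q : ℤ × (Fin n → ℤ) | Q.1 ∈ A} from hl), zero_mul]
    rw [h1, hnl _ _ _ (by split_ifs; exacts [G.Rpow_ne_top _, ENNReal.zero_ne_top])]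
    split_ifs
    · rfl
    · rw [zero_mul, ENNReal.zero_rpow_of_pos hr]
  refine kFunctional_rpow_le_tsum hr hr1 (fun A A' hA' => ?_) t
  refine ⟨G.cut f {Q | Q.1 ∈ A}, G.cut f {Q | Q.1 ∈ A'}, ?_,
    (h₀ _).trans (le_of_eq ?_), (h₁ _).trans (le_of_eq ?_)⟩
  · rw [hA']; exact G.cut_add_cut_compl f {Q | Q.1 ∈ A}
  · congr 1
    refine tsum_congr fun l => ?_
    rw [← ENNReal.rpow_mul]
    exact hcut s₀ _ l A (by ring)
  · congr 1
    refine tsum_congr fun l => ?_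
    rw [← ENNReal.rpow_mul]
    exact hcut s₁ _ l A' (by ring)

theorem layers_le_kFunctional (hnl : ∀ l c φ, c ≠ ⊤ → nl l (fun z => c * φ z) = c * nl l φ)
    {C C' : ℝ≥0} (hadd : ∀ l φ φ₁ φ₂, (∀ z, φ z ≤ 2 * (φ₁ z + φ₂ z)) →
      nl l φ ≤ C' * (nl l φ₁ + nl l φ₂))
    (h₀ : ∀ g l, nl l (G.e s₀ g l) ≤ C * N₀ g) (h₁ : ∀ g l, nl l (G.e s₁ g l) ≤ C * N₁ g)
    (f : L0 n N) (l : ℤ) :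
    nl l (G.e ((1 - η) * s₀ + η * s₁) f l) ≤ C' * C *
      (ENNReal.ofReal ((G.ρ ^ ((l : ℝ) * (s₁ - s₀))) ^ (-η)) *
        kFunctional N₀ N₁ (G.ρ ^ ((l : ℝ) * (s₁ - s₀))) f) := by
  have hpow : ENNReal.ofReal ((G.ρ ^ ((l : ℝ) * (s₁ - s₀))) ^ (-η)) =
      G.R ^ ((l : ℝ) * (s₀ - ((1 - η) * s₀ + η * s₁))) := by
    rw [← ENNReal.ofReal_rpow_of_pos (Real.rpow_pos_of_pos G.ρ_pos _), ofReal_rpow_int,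
      ← ENNReal.rpow_mul]
    congr 1; ring
  rw [hpow]
  set w := G.R ^ ((l : ℝ) * (s₀ - ((1 - η) * s₀ + η * s₁))) with hw
  have hw0 : w ≠ 0 := G.Rpow_ne_zero _
  have hwt : w ≠ ⊤ := G.Rpow_ne_top _
  by_cases hCC : (C' : ℝ≥0∞) * C = 0
  · have h2 : nl l (G.e ((1 - η) * s₀ + η * s₁) f l) ≤ C' * (C * (w * (N₀ f + N₀ f))) := by
      refine (hadd l _ (G.e ((1 - η) * s₀ + η * s₁) f l) (G.e ((1 - η) * s₀ + η * s₁) f l)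
        fun z => ?_).trans (mul_le_mul_right ?_ _)
      · rw [← two_mul, ← mul_assoc]
        exact le_mul_of_one_le_left' (by norm_num)
      · have h3 : nl l (G.e ((1 - η) * s₀ + η * s₁) f l) ≤ C * (w * N₀ f) := by
          have : G.e ((1 - η) * s₀ + η * s₁) f l = fun z => w * G.e s₀ f l z := by
            ext z; exact G.e_shift _ _ _ _ _
          rw [this, hnl _ _ _ hwt, mul_left_comm]
          exact mul_le_mul_right (h₀ f l) _
        calc _ ≤ C * (w * N₀ f) + C * (w * N₀ f) := add_le_add h3 h3
          _ = _ := by ring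
    rw [← mul_assoc, hCC, zero_mul] at h2
    exact h2.trans zero_le
  have hCt : (C' : ℝ≥0∞) * C ≠ ⊤ := ENNReal.mul_ne_top ENNReal.coe_ne_top ENNReal.coe_ne_top
  have hDt : (C' : ℝ≥0∞) * C * w ≠ ⊤ := ENNReal.mul_ne_top hCt hwt
  have hD0 : (C' : ℝ≥0∞) * C * w ≠ 0 := mul_ne_zero hCC hw0
  rw [← mul_assoc, mul_comm _ (kFunctional _ _ _ _), ← ENNReal.div_le_iff hD0 hDt]
  refine le_kFunctional fun g k e => ?_
  rw [ENNReal.div_le_iff hD0 hDt, ← e, ofReal_rpow_int]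
  refine (hadd l _ _ _ (fun z => G.e_add_le _ g k l z)).trans ?_
  have h2 : G.e ((1 - η) * s₀ + η * s₁) g l = fun z => w * G.e s₀ g l z := by
    ext z; exact G.e_shift _ _ _ _ _
  have h3 : G.e ((1 - η) * s₀ + η * s₁) k l = fun z =>
      (w * G.R ^ ((l : ℝ) * (s₁ - s₀))) * G.e s₁ k l z := by
    ext z
    rw [G.e_shift _ s₁, hw, ← Rpow_add]
    congr 2; ring
  rw [h2, h3, hnl _ _ _ hwt, hnl _ _ _ (ENNReal.mul_ne_top hwt (G.Rpow_ne_top _))]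
  calc _ ≤ C' * (w * (C * N₀ g) + w * G.R ^ ((l : ℝ) * (s₁ - s₀)) * (C * N₁ k)) := by
        refine mul_le_mul_right (add_le_add (mul_le_mul_right (h₀ g l) _)
          (mul_le_mul_right (h₁ k l) _)) _
    _ = _ := by ring

end Layers

end Grid

theorem le_of_rpow_le {a b : ℝ≥0∞} {C : ℝ≥0} {P : ℝ} (hP : 0 < P) (h : a ^ P ≤ C * b ^ P) :
    a ≤ (C ^ (1 / P) : ℝ≥0) * b := by
  have h1 := ENNReal.rpow_le_rpow h (by positivity : 0 ≤ 1 / P)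
  rwa [ENNReal.mul_rpow_of_nonneg _ _ (by positivity), ← ENNReal.rpow_mul, ← ENNReal.rpow_mul,
    mul_one_div_cancel hP.ne', ENNReal.rpow_one, ENNReal.rpow_one,
    ← ENNReal.coe_rpow_of_nonneg _ (by positivity)] at h1

theorem add_rpow_le (a b : ℝ≥0∞) {q : ℝ} (hq : 0 < q) :
    (a + b) ^ q ≤ 2 ^ q * (a ^ q + b ^ q) := by
  have h : a + b ≤ 2 * max a b := by
    rw [two_mul]; exact add_le_add (le_max_left _ _) (le_max_right _ _)
  refine (ENNReal.rpow_le_rpow h hq.le).trans ?_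
  rw [ENNReal.mul_rpow_of_nonneg _ _ hq.le]
  refine mul_le_mul_right ?_ _
  rcases max_cases a b with ⟨h1, -⟩ | ⟨h1, -⟩ <;> rw [h1]
  · exact le_add_right le_rfl
  · exact le_add_left le_rfl

theorem realInterpNorm_rpow {V : Type*} [AddCommGroup V] (N₀ N₁ : V → ℝ≥0∞) (η : ℝ) {q : ℝ}
    (hq : 0 < q) (f : V) : realInterpNorm N₀ N₁ η (ENNReal.ofReal q) f ^ q =
      ∫⁻ t in Ioi (0 : ℝ), ENNReal.ofReal t⁻¹ *
        (ENNReal.ofReal (t ^ (-η)) * kFunctional N₀ N₁ t f) ^ q := by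
  rw [realInterpNorm_ofReal η hq, ← ENNReal.rpow_mul, one_div_mul_cancel hq.ne', ENNReal.rpow_one]

namespace Grid

variable {n N : ℕ} (G : Grid n) {c₀ c₁ : ℝ}

/-- The `L^p` quasi-norm of a function which is constant on the cubes of a layer. -/
def lp (p : ℝ) (l : ℤ) (φ : (Fin n → ℤ) → ℝ≥0∞) : ℝ≥0∞ := (∫⁻ x, φ (G.cz l x) ^ p) ^ (1 / p)

theorem lp_rpow {p : ℝ} (hp : 0 < p) (l : ℤ) (φ : (Fin n → ℤ) → ℝ≥0∞) :
    G.lp p l φ ^ p = ∫⁻ x, φ (G.cz l x) ^ p := by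
  rw [lp, ← ENNReal.rpow_mul, one_div_mul_cancel hp.ne', ENNReal.rpow_one]

theorem lp_const_mul {p : ℝ} (hp : 0 < p) (l : ℤ) (c : ℝ≥0∞) (φ : (Fin n → ℤ) → ℝ≥0∞)
    (hc : c ≠ ⊤) : G.lp p l (fun z => c * φ z) = c * G.lp p l φ := by
  simp only [lp, ENNReal.mul_rpow_of_nonneg _ _ hp.le]
  rw [lintegral_const_mul' _ _ (ENNReal.rpow_ne_top_of_nonneg hp.le hc),
    ENNReal.mul_rpow_of_nonneg _ _ (by positivity), ← ENNReal.rpow_mul, mul_one_div_cancel hp.ne',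
    ENNReal.rpow_one]

theorem exists_lp_le_add {p : ℝ} (hp : 0 < p) : ∃ C : ℝ≥0, ∀ l (φ φ₁ φ₂ : (Fin n → ℤ) → ℝ≥0∞),
    (∀ z, φ z ≤ 2 * (φ₁ z + φ₂ z)) → G.lp p l φ ≤ C * (G.lp p l φ₁ + G.lp p l φ₂) := by
  refine ⟨4 * 2 ^ (1 / p), fun l φ φ₁ φ₂ h => ?_⟩
  have h1 : ∫⁻ x, φ (G.cz l x) ^ p ≤ 4 ^ p * ((∫⁻ x, φ₁ (G.cz l x) ^ p) +
      ∫⁻ x, φ₂ (G.cz l x) ^ p) := by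
    rw [← lintegral_add_left (G.measurable_comp_cz l fun z => φ₁ z ^ p),
      ← lintegral_const_mul' _ _ (ENNReal.rpow_ne_top_of_nonneg hp.le (by norm_num))]
    refine lintegral_mono fun x => ?_
    calc φ (G.cz l x) ^ p ≤ (2 * (φ₁ (G.cz l x) + φ₂ (G.cz l x))) ^ p :=
          ENNReal.rpow_le_rpow (h _) hp.le
      _ ≤ 2 ^ p * (2 ^ p * (φ₁ (G.cz l x) ^ p + φ₂ (G.cz l x) ^ p)) := by
          rw [ENNReal.mul_rpow_of_nonneg _ _ hp.le]
          exact mul_le_mul_right (add_rpow_le _ _ hp) _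
      _ = _ := by
          rw [← mul_assoc, ← ENNReal.mul_rpow_of_nonneg _ _ hp.le]; norm_num
  calc G.lp p l φ ≤ (4 ^ p * ((∫⁻ x, φ₁ (G.cz l x) ^ p) +
        ∫⁻ x, φ₂ (G.cz l x) ^ p)) ^ (1 / p) := ENNReal.rpow_le_rpow h1 (by positivity)
    _ = 4 * ((∫⁻ x, φ₁ (G.cz l x) ^ p) + ∫⁻ x, φ₂ (G.cz l x) ^ p) ^ (1 / p) := by
        rw [ENNReal.mul_rpow_of_nonneg _ _ (by positivity), ← ENNReal.rpow_mul,
          mul_one_div_cancel hp.ne', ENNReal.rpow_one]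
    _ ≤ 4 * (2 ^ (1 / p) * (G.lp p l φ₁ + G.lp p l φ₂)) :=
        mul_le_mul_right (add_rpow_le _ _ (by positivity)) _
    _ = _ := by
        rw [ENNReal.coe_mul, ENNReal.coe_rpow_of_nonneg _ (by positivity), mul_assoc]; rfl

theorem exists_lp_e_le {p : ℝ} (hp : 0 < p) (s : ℝ) : ∃ C : ℝ≥0, ∀ (g : L0 n N) (l : ℤ),
    G.lp p l (G.e s g l) ≤ C * tentNorm (.finite p hp s) g := by
  obtain ⟨C, hC⟩ := G.exists_e_le_areaFn (N := N) s
  refine ⟨C, fun g l => ?_⟩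
  change _ ≤ _ * eLpNorm _ (ENNReal.ofReal p) _
  rw [eLpNorm_ofReal_eq _ _ hp]
  calc G.lp p l (G.e s g l) ≤ (∫⁻ x, (C : ℝ≥0∞) ^ p * areaFn (kappa (-s) g) x ^ p) ^ (1 / p) := by
        refine ENNReal.rpow_le_rpow (lintegral_mono fun x => ?_) (by positivity)
        rw [← ENNReal.mul_rpow_of_nonneg _ _ hp.le]
        exact ENNReal.rpow_le_rpow (hC g x l) hp.le
    _ = _ := by
        rw [lintegral_const_mul' _ _ (ENNReal.rpow_ne_top_of_nonneg hp.le ENNReal.coe_ne_top),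
          ENNReal.mul_rpow_of_nonneg _ _ (by positivity), ← ENNReal.rpow_mul,
          mul_one_div_cancel hp.ne', ENNReal.rpow_one]

theorem exists_realInterpNorm_equiv_of_eq_finite (hc₀ : 0 < c₀) (hc₁ : 1 < c₁) (hρ : G.ρ = c₁)
    (hL : n < c₀ * G.L) {p : ℝ} (hp : 0 < p) {s₀ s₁ η : ℝ} (hs : s₀ ≠ s₁) (hη₀ : 0 < η)
    (hη₁ : η < 1) : ∃ C : ℝ≥0, ∀ f : L0 n N,
      realInterpNorm (tentNorm (.finite p hp s₀)) (tentNorm (.finite p hp s₁)) η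
          (ENNReal.ofReal p) f ≤
        C * zNorm c₀ c₁ (.finite p hp ((1 - η) * s₀ + η * s₁)) f ∧
      zNorm c₀ c₁ (.finite p hp ((1 - η) * s₀ + η * s₁)) f ≤
        C * realInterpNorm (tentNorm (.finite p hp s₀)) (tentNorm (.finite p hp s₁)) η
          (ENNReal.ofReal p) f := by
  set sη := (1 - η) * s₀ + η * s₁ with hsη
  have ha : s₁ - s₀ ≠ 0 := sub_ne_zero.mpr hs.symm
  set r : ℝ := min 1 p with hr
  have hr0 : 0 < r := lt_min one_pos hp
  have hr1 : r ≤ 1 := min_le_left _ _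
  have hrp : r ≤ p := min_le_right _ _
  have hlac := lacunary_rpow_int G.one_lt_R G.R_ne_top ha
  have hU : ∀ s : ℝ, ∃ C : ℝ≥0, ∀ g : L0 n N, tentNorm (.finite p hp s) g ^ r ≤
      C * ∑' l, G.lp p l (G.e s g l) ^ r := by
    intro s
    obtain ⟨C, hC⟩ := G.exists_tentNorm_layers_finite_le (N := N) s hp hr0 hr1 hrp
    refine ⟨C, fun g => (hC g).trans_eq ?_⟩
    simp only [lp, ← ENNReal.rpow_mul, one_div_mul_eq_div]
  obtain ⟨A₀, hA₀⟩ := hU s₀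
  obtain ⟨A₁, hA₁⟩ := hU s₁
  obtain ⟨B₀, hB₀⟩ := G.exists_lp_e_le (N := N) hp s₀
  obtain ⟨B₁, hB₁⟩ := G.exists_lp_e_le (N := N) hp s₁
  obtain ⟨D, hD⟩ := G.exists_lp_le_add hp
  obtain ⟨C₁, hC₁⟩ := exists_lintegral_le_of_lacunary hlac.lt_one hη₀ hη₁ hr0 hrp
  obtain ⟨C₂, hC₂⟩ := exists_tsum_kFunctional_le G.one_lt ha hη₀ hp
  obtain ⟨Z₁, hZ₁⟩ := G.exists_zNorm_le (N := N) hc₀ hc₁ hρ sη hp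
  obtain ⟨Z₂, hZ₂⟩ := G.exists_le_zNorm (N := N) hc₀ hc₁ hρ hL sη hp
  set A := max A₀ A₁
  set B := max B₀ B₁
  set E : ℝ≥0 := (A ^ (1 / r)) with hE
  refine ⟨max ((C₁ * E ^ p * Z₂) ^ (1 / p)) ((Z₁ * (D * B) ^ p * C₂) ^ (1 / p)), fun f => ⟨?_, ?_⟩⟩
  · refine (le_of_rpow_le hp (C := C₁ * E ^ p * Z₂) ?_).trans
      (mul_le_mul_left (by exact_mod_cast le_max_left _ _) _)
    rw [realInterpNorm_rpow _ _ η hp]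
    refine (hC₁ _ _ (fun t => kFunctional (tentNorm (.finite p hp s₀)) (tentNorm (.finite p hp s₁))
      t f) hlac (fun t _ => G.kFunctional_rpow_le_layers (η := η) hr0 hr1
        (fun l c φ => G.lp_const_mul hp l c φ) (C := A)
        (fun g => (hA₀ g).trans (mul_le_mul_left (by exact_mod_cast le_max_left _ _) _))
        (fun g => (hA₁ g).trans (mul_le_mul_left (by exact_mod_cast le_max_right _ _) _))
        f t)).trans ?_
    rw [mul_assoc C₁, ENNReal.coe_mul C₁, mul_assoc]
    refine mul_le_mul_right ?_ _
    simp only [ENNReal.mul_rpow_of_nonneg _ _ hp.le, lp_rpow _ hp]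
    rw [ENNReal.tsum_mul_left, ENNReal.coe_mul, mul_assoc, ENNReal.coe_rpow_of_nonneg _ hp.le]
    exact mul_le_mul_right (hZ₂ f) _
  · refine (le_of_rpow_le hp (C := Z₁ * (D * B) ^ p * C₂) ?_).trans
      (mul_le_mul_left (by exact_mod_cast le_max_right _ _) _)
    refine (hZ₁ f).trans ?_
    rw [mul_assoc Z₁, ENNReal.coe_mul Z₁, mul_assoc]
    refine mul_le_mul_right ?_ _
    have h1 := fun l => ENNReal.rpow_le_rpow (G.layers_le_kFunctional (η := η)
      (fun l c φ => G.lp_const_mul hp l c φ) hD (C := B)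
      (fun g l => (hB₀ g l).trans (mul_le_mul_left (by exact_mod_cast le_max_left _ _) _))
      (fun g l => (hB₁ g l).trans (mul_le_mul_left (by exact_mod_cast le_max_right _ _) _))
      f l) hp.le
    simp only [lp_rpow _ hp] at h1
    refine (ENNReal.tsum_le_tsum h1).trans ?_
    simp only [ENNReal.mul_rpow_of_nonneg (D * B : ℝ≥0∞) _ hp.le]
    rw [ENNReal.tsum_mul_left, realInterpNorm_rpow _ _ η hp, ENNReal.coe_mul, mul_assoc,
      ENNReal.coe_rpow_of_nonneg _ hp.le, ENNReal.coe_mul]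
    exact mul_le_mul_right (hC₂ _ _ _ f) _

theorem exists_realInterpNorm_equiv_of_eq_infinite (hc₀ : 0 < c₀) (hc₁ : 1 < c₁) (hρ : G.ρ = c₁)
    (hL : n < c₀ * G.L) {s₀ s₁ η : ℝ} (hs : s₀ ≠ s₁) (hη₀ : 0 < η) (hη₁ : η < 1) :
    ∃ C : ℝ≥0, ∀ f : L0 n N,
      realInterpNorm (tentNorm (.infinite s₀ 0 le_rfl)) (tentNorm (.infinite s₁ 0 le_rfl)) η ⊤ f ≤
        C * zNorm c₀ c₁ (.infinite ((1 - η) * s₀ + η * s₁) 0 le_rfl) f ∧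
      zNorm c₀ c₁ (.infinite ((1 - η) * s₀ + η * s₁) 0 le_rfl) f ≤
        C * realInterpNorm (tentNorm (.infinite s₀ 0 le_rfl)) (tentNorm (.infinite s₁ 0 le_rfl))
          η ⊤ f := by
  set sη := (1 - η) * s₀ + η * s₁ with hsη
  have ha : s₁ - s₀ ≠ 0 := sub_ne_zero.mpr hs.symm
  have hlac := lacunary_rpow_int G.one_lt_R G.R_ne_top ha
  have hB : ∀ s, ∃ C : ℝ≥0, ∀ (g : L0 n N) (l : ℤ),
      ⨆ z, G.e s g l z ≤ C * tentNorm (.infinite s 0 le_rfl) g := by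
    intro s
    obtain ⟨C, hC⟩ := G.exists_e_le_carlesonNorm (N := N) s
    exact ⟨C, fun g l => iSup_le fun z => hC g l z⟩
  obtain ⟨A₀, hA₀⟩ := G.exists_tentNorm_layers_infinite_le (N := N) s₀ one_pos le_rfl
  obtain ⟨A₁, hA₁⟩ := G.exists_tentNorm_layers_infinite_le (N := N) s₁ one_pos le_rfl
  obtain ⟨B₀, hB₀⟩ := hB s₀
  obtain ⟨B₁, hB₁⟩ := hB s₁
  obtain ⟨C₁, hC₁⟩ := exists_le_of_lacunary hlac.lt_one hη₀ hη₁ one_pos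
  obtain ⟨C₂, hC₂⟩ := exists_le_realInterpNorm_top hη₀
  obtain ⟨Z₁, hZ₁⟩ := G.exists_zNorm_top_le (N := N) hc₀ hc₁ hρ sη
  obtain ⟨Z₂, hZ₂⟩ := G.exists_le_zNorm_top (N := N) hc₀ hc₁ hρ hL sη
  set A := max A₀ A₁
  set B := max B₀ B₁
  set E : ℝ≥0 := (A ^ (1 / 1 : ℝ)) with hE
  have hnl : ∀ (l : ℤ) c (φ : (Fin n → ℤ) → ℝ≥0∞), c ≠ ⊤ → (⨆ z, c * φ z) = c * ⨆ z, φ z :=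
    fun l c φ _ => (ENNReal.mul_iSup c φ).symm
  refine ⟨max (C₁ * (E * Z₂)) (Z₁ * (2 * B * C₂)), fun f => ⟨?_, ?_⟩⟩
  · refine le_trans ?_ (mul_le_mul_left (ENNReal.coe_le_coe.mpr (le_max_left _ _)) _)
    refine realInterpNorm_top_le fun t ht => ?_
    rw [ENNReal.coe_mul, mul_assoc]
    refine hC₁ _ _ (fun t => kFunctional (tentNorm (.infinite s₀ 0 le_rfl))
      (tentNorm (.infinite s₁ 0 le_rfl)) t f) _ hlac
      (fun t _ => G.kFunctional_rpow_le_layers (η := η) (nl := fun _ φ => ⨆ z, φ z) one_pos le_rfl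
        hnl (C := A)
        (fun g => (hA₀ g).trans (mul_le_mul_left (by exact_mod_cast le_max_left _ _) _))
        (fun g => (hA₁ g).trans (mul_le_mul_left (by exact_mod_cast le_max_right _ _) _))
        f t) (fun l => ?_) t ht
    rw [ENNReal.coe_mul, mul_assoc]
    exact mul_le_mul_right (iSup_le fun z => hZ₂ f l z) _
  · refine le_trans ?_ (mul_le_mul_left (ENNReal.coe_le_coe.mpr (le_max_right _ _)) _)
    rw [ENNReal.coe_mul, mul_assoc]
    refine hZ₁ f _ fun l z => ?_
    have h1 := G.layers_le_kFunctional (η := η) (nl := fun _ φ => ⨆ z, φ z) hnl (C' := 2)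
      (fun l φ φ₁ φ₂ h => iSup_le fun z => (h z).trans (mul_le_mul_right
        (add_le_add (le_iSup φ₁ z) (le_iSup φ₂ z)) _)) (C := B)
      (fun g l => (hB₀ g l).trans (mul_le_mul_left (by exact_mod_cast le_max_left _ _) _))
      (fun g l => (hB₁ g l).trans (mul_le_mul_left (by exact_mod_cast le_max_right _ _) _)) f l
    refine (le_iSup (G.e sη f l) z).trans (h1.trans ?_)
    rw [ENNReal.coe_mul, ENNReal.coe_mul, mul_assoc (_ * _)]
    exact mul_le_mul_right (hC₂ _ _ _ f _ (Real.rpow_pos_of_pos G.ρ_pos _)) _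

end Grid

theorem Exponent.eq_zero_of_j_nonneg {n : ℕ} (hn : 1 ≤ n) {s α : ℝ} {hα : 0 ≤ α}
    (h : 0 ≤ (Exponent.infinite s α hα).j n) : α = 0 := by
  have hn' : (0 : ℝ) < n := by exact_mod_cast hn
  have h1 : 0 ≤ -α / n := h
  rw [le_div_iff₀ hn', zero_mul] at h1
  linarith

theorem Exponent.exists_ofReal_le_i (X : Exponent) : ∃ r : ℝ, 0 < r ∧ ENNReal.ofReal r ≤ X.i := by
  cases X with
  | finite p hp s => exact ⟨p, hp, le_rfl⟩
  | infinite s α hα => exact ⟨1, one_pos, le_top⟩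

namespace Grid

variable {n N : ℕ} (G : Grid n) {c₀ c₁ : ℝ}

/-! ### Interpolation between tent spaces of different integrability -/

open Classical in
theorem exists_tentNorm_levels_le (hn : 1 ≤ n) {X : Exponent} (hX : 0 ≤ X.j n) {r : ℝ}
    (hr : 0 < r) (hr1 : r ≤ 1) (hrX : ENNReal.ofReal r ≤ X.i) {m δ : ℝ} (hm : m ≠ 0)
    (hδ : δ = X.θ + m * X.j n) (C₀ : ℝ≥0) :
    ∃ C : ℝ≥0, ∀ (g : L0 n N) (A : Set ℤ) (E : ℤ → Set (ℤ × (Fin n → ℤ))),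
      (∀ l z, G.e δ g l z ≠ 0 → ∃ i ∈ A, (l, z) ∈ E i ∧ G.e δ g l z ≤ 2 ^ ((i : ℝ) + 1)) →
      (∀ i (x : EuclideanSpace ℝ (Fin n)) (R : ℝ), 0 < R → ∑' l, (if G.h l ≤ R then
        ∫⁻ y in Metric.ball x (2 * R), (if (l, G.cz l y) ∈ E i then 1 else 0) else 0) ≤
          C₀ * volume (Metric.ball x R)) →
      tentNorm X g ^ r ≤
        C * ∑' i : ℤ, if i ∈ A then (2 ^ (i : ℝ) * G.weight m (E i) ^ X.j n) ^ r else 0 := by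
  cases X with
  | finite p hp s =>
    have hrp : r ≤ p := (ENNReal.ofReal_le_ofReal_iff hp.le).mp hrX
    obtain ⟨C, hC⟩ := G.exists_tentNorm_levels_finite_le (N := N) s hp hr hr1 hrp hm hδ
    exact ⟨C, fun g A E h _ => hC g A E h⟩
  | infinite s α hα =>
    obtain rfl : α = 0 := Exponent.eq_zero_of_j_nonneg hn hX
    have hj : (Exponent.infinite s 0 hα).j n = 0 := by simp [Exponent.j]
    rw [hj] at hδ
    obtain rfl : δ = s := by rw [hδ, mul_zero, add_zero]; rfl
    obtain ⟨C, hC⟩ := G.exists_tentNorm_levels_infinite_le (N := N) δ hr hr1 C₀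
    refine ⟨C, fun g A E h h' => (hC g A E h h').trans_eq ?_⟩
    simp only [hj, ENNReal.rpow_zero, mul_one]

theorem tsum_layers_eq_tsum (m : ℝ) (φ : ℤ → (Fin n → ℤ) → ℝ≥0∞) :
    ∑' l : ℤ, G.R ^ ((l : ℝ) * m) * ∫⁻ x, φ l (G.cz l x) =
      ∑' Q : ℤ × (Fin n → ℤ), G.R ^ ((Q.1 : ℝ) * m) * G.V Q.1 * φ Q.1 Q.2 := by
  rw [ENNReal.tsum_prod']
  refine tsum_congr fun l => ?_
  rw [lintegral_comp_cz, ← ENNReal.tsum_mul_left]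
  simp only [mul_assoc]

open Classical in
theorem weight_eq_tsum (m : ℝ) (E : Set (ℤ × (Fin n → ℤ))) :
    G.weight m E = ∑' Q : ℤ × (Fin n → ℤ), if Q ∈ E then G.R ^ ((Q.1 : ℝ) * m) * G.V Q.1 else 0 := by
  have h := G.tsum_layers_eq_tsum m (fun l z => if (l, z) ∈ E then 1 else 0)
  rw [weight]
  simp only [mul_ite, mul_one, mul_zero, Prod.mk.eta] at h
  rw [← h]
  refine tsum_congr fun l => ?_
  rw [lintegral_const_mul' _ _ (G.Rpow_ne_top _)]

theorem weight_mono (m : ℝ) {E F : Set (ℤ × (Fin n → ℤ))} (h : E ⊆ F) :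
    G.weight m E ≤ G.weight m F := by
  classical
  rw [weight_eq_tsum, weight_eq_tsum]
  refine ENNReal.tsum_le_tsum fun Q => ?_
  by_cases hQ : Q ∈ E
  · rw [if_pos hQ, if_pos (h hQ)]
  · rw [if_neg hQ]; exact zero_le

theorem weight_union_le (m : ℝ) (E F : Set (ℤ × (Fin n → ℤ))) :
    G.weight m (E ∪ F) ≤ G.weight m E + G.weight m F := by
  classical
  rw [weight_eq_tsum, weight_eq_tsum, weight_eq_tsum, ← ENNReal.tsum_add]
  refine ENNReal.tsum_le_tsum fun Q => ?_
  by_cases hQ : Q ∈ E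
  · rw [if_pos (mem_union_left F hQ), if_pos hQ]; exact le_self_add
  · by_cases hF : Q ∈ F
    · rw [if_pos (mem_union_right E hF), if_pos hF]; exact le_add_self
    · rw [if_neg (show Q ∉ E ∪ F from fun h => h.elim hQ hF)]; exact zero_le

theorem exists_weight_le_finite {p : ℝ} (hp : 0 < p) (s : ℝ) {m δ : ℝ} (hm : m ≠ 0)
    (hδ : δ = s + m * (1 / p)) : ∃ C : ℝ≥0, ∀ (g : L0 n N) (lam M : ℝ≥0∞), lam ≠ 0 →
      tentNorm (.finite p hp s) g ≤ lam * M ^ (1 / p) →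
      G.weight m {Q | C * lam < G.e δ g Q.1 Q.2} ≤ C * M := by
  classical
  obtain ⟨C₁, hC₁⟩ := G.exists_e_le_areaFn (N := N) s
  have hlac := lacunary_rpow_int G.one_lt_R G.R_ne_top hm
  obtain ⟨C₂, hC₂⟩ : ∃ C₂ : ℝ≥0, (1 - G.R ^ (-|m|))⁻¹ = C₂ :=
    ⟨_, (ENNReal.coe_toNNReal (ENNReal.inv_ne_top.mpr (tsub_pos_of_lt hlac.lt_one).ne')).symm⟩
  set C := max 1 (max C₁ C₂) with hC
  have hCC₁ : (C₁ : ℝ≥0∞) ≤ C := ENNReal.coe_le_coe.mpr ((le_max_left _ _).trans (le_max_right _ _))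
  have hCC₂ : (C₂ : ℝ≥0∞) ≤ C := ENNReal.coe_le_coe.mpr ((le_max_right _ _).trans (le_max_right _ _))
  have hC1 : (1 : ℝ≥0∞) ≤ C := by exact_mod_cast le_max_left _ _
  refine ⟨C, fun g lam M h0 hN => ?_⟩
  by_cases ht : lam = ⊤
  · have hempty : {Q : ℤ × (Fin n → ℤ) | C * lam < G.e δ g Q.1 Q.2} = ∅ := by
      ext Q
      simp only [mem_ofPred_eq, mem_empty_iff_false, iff_false, not_lt, ht]
      rw [ENNReal.mul_top (by positivity)]
      exact le_top
    rw [hempty, weight_eq_tsum]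
    simp
  set A := areaFn (kappa (-s) g) with hA
  have hp0 : lam ^ p ≠ 0 := (ENNReal.rpow_pos (pos_iff_ne_zero.mpr h0) ht).ne'
  have hpt : lam ^ p ≠ ⊤ := ENNReal.rpow_ne_top_of_nonneg hp.le ht
  obtain ⟨E, hE⟩ : ∃ E : Set (ℤ × (Fin n → ℤ)), E = {Q | C * lam < G.e δ g Q.1 Q.2} := ⟨_, rfl⟩
  rw [← hE, weight, ← lintegral_tsum fun l => ((G.measurable_comp_cz l fun z =>
    if (l, z) ∈ E then (1 : ℝ≥0∞) else 0).const_mul _).aemeasurable]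
  have hpt1 : ∀ x, ∑' l : ℤ, G.R ^ ((l : ℝ) * m) * (if (l, G.cz l x) ∈ E then 1 else 0) ≤
      C₂ * (lam ^ p)⁻¹ * A x ^ p := by
    intro x
    rw [mul_assoc]
    refine le_trans (ENNReal.tsum_le_tsum fun l => ?_) ((hlac.tsum_le ((lam ^ p)⁻¹ * A x ^ p)).trans
      (by rw [hC₂]))
    by_cases hl : (l, G.cz l x) ∈ E
    · rw [if_pos hl, mul_one, if_pos]
      rw [hE] at hl
      have h1 : C * lam < G.R ^ ((l : ℝ) * (s - δ)) * (C * A x) := by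
        have hl' : C * lam < G.e δ g l (G.cz l x) := hl
        rw [G.e_shift δ s] at hl'
        exact hl'.trans_le (mul_le_mul_right ((hC₁ g x l).trans (mul_le_mul_left hCC₁ _)) _)
      rw [mul_left_comm] at h1
      have h2 : lam < G.R ^ ((l : ℝ) * (s - δ)) * A x := lt_of_mul_lt_mul_left' h1
      have h3 := ENNReal.rpow_le_rpow h2.le hp.le
      rw [ENNReal.mul_rpow_of_nonneg _ _ hp.le, ← ENNReal.rpow_mul] at h3
      have h4 : (l : ℝ) * (s - δ) * p = -((l : ℝ) * m) := by rw [hδ]; field_simp; ring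
      rw [h4] at h3
      rw [mul_comm (lam ^ p)⁻¹, ← div_eq_mul_inv, ENNReal.le_div_iff_mul_le (Or.inl hp0) (Or.inl hpt)]
      refine (mul_le_mul_right h3 _).trans (le_of_eq ?_)
      rw [← mul_assoc, ← Rpow_add]; simp
    · rw [if_neg hl, mul_zero]; exact zero_le
  have hN' : ∫⁻ x, A x ^ p ≤ lam ^ p * M := by
    change eLpNorm _ (ENNReal.ofReal p) _ ≤ _ at hN
    rw [eLpNorm_ofReal_eq _ _ hp] at hN
    have h1 := ENNReal.rpow_le_rpow hN hp.le
    rwa [ENNReal.mul_rpow_of_nonneg _ _ hp.le, ← ENNReal.rpow_mul, ← ENNReal.rpow_mul,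
      one_div_mul_cancel hp.ne', ENNReal.rpow_one, ENNReal.rpow_one] at h1
  calc _ ≤ ∫⁻ x, C₂ * (lam ^ p)⁻¹ * A x ^ p := lintegral_mono hpt1
    _ = C₂ * (lam ^ p)⁻¹ * ∫⁻ x, A x ^ p := lintegral_const_mul' _ _
        (ENNReal.mul_ne_top ENNReal.coe_ne_top (ENNReal.inv_ne_top.mpr hp0))
    _ ≤ C₂ * (lam ^ p)⁻¹ * (lam ^ p * M) := mul_le_mul_right hN' _
    _ = C₂ * M := by
        rw [mul_assoc, ← mul_assoc _ _ M, ENNReal.inv_mul_cancel hp0 hpt, one_mul]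
    _ ≤ C * M := mul_le_mul_left hCC₂ _

theorem exists_weight_le (hn : 1 ≤ n) {X : Exponent} (hX : 0 ≤ X.j n) {m δ : ℝ} (hm : m ≠ 0)
    (hδ : δ = X.θ + m * X.j n) : ∃ C : ℝ≥0, ∀ (g : L0 n N) (lam M : ℝ≥0∞), lam ≠ 0 →
      tentNorm X g ≤ lam * M ^ X.j n →
      G.weight m {Q | C * lam < G.e δ g Q.1 Q.2} ≤ C * M := by
  cases X with
  | finite p hp s => exact G.exists_weight_le_finite hp s hm hδ
  | infinite s α hα =>
    obtain rfl : α = 0 := Exponent.eq_zero_of_j_nonneg hn hX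
    have hj : (Exponent.infinite s 0 hα).j n = 0 := by simp [Exponent.j]
    rw [hj] at hδ
    obtain rfl : δ = s := by rw [hδ, mul_zero, add_zero]; rfl
    obtain ⟨C, hC⟩ := G.exists_e_le_carlesonNorm (N := N) δ
    refine ⟨C, fun g lam M _ h => ?_⟩
    rw [hj, ENNReal.rpow_zero, mul_one] at h
    have hempty : {Q : ℤ × (Fin n → ℤ) | C * lam < G.e δ g Q.1 Q.2} = ∅ := by
      ext Q
      simp only [mem_ofPred_eq, mem_empty_iff_false, iff_false, not_lt]
      exact (hC g _ _).trans (mul_le_mul_right h _)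
    classical
    rw [hempty, weight_eq_tsum]
    simp

theorem exists_weight_le_kFunctional (hn : 1 ≤ n) {X₀ X₁ : Exponent} (hX₀ : 0 ≤ X₀.j n)
    (hX₁ : 0 ≤ X₁.j n) {m δ : ℝ} (hm : m ≠ 0) (hδ₀ : δ = X₀.θ + m * X₀.j n)
    (hδ₁ : δ = X₁.θ + m * X₁.j n) : ∃ C : ℝ≥0, C ≠ 0 ∧ ∀ (f : L0 n N) (j : ℤ) (lam : ℝ≥0∞),
      lam ≠ 0 → kFunctional (tentNorm X₀) (tentNorm X₁) (2 ^ ((j : ℝ) * (X₀.j n - X₁.j n))) f <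
        lam * (2 ^ (j : ℝ)) ^ X₀.j n →
      G.weight m {Q | C * lam < G.e δ f Q.1 Q.2} ≤ C * 2 ^ (j : ℝ) := by
  obtain ⟨C₀, hC₀⟩ := G.exists_weight_le (N := N) hn hX₀ hm hδ₀
  obtain ⟨C₁, hC₁⟩ := G.exists_weight_le (N := N) hn hX₁ hm hδ₁
  refine ⟨4 * (C₀ + C₁) + 1, by positivity, fun f j lam h0 hK => ?_⟩
  obtain ⟨g, k, rfl, hgk⟩ := exists_of_kFunctional_lt hK
  set M : ℝ≥0∞ := 2 ^ (j : ℝ) with hM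
  have hM0 : M ≠ 0 := (ENNReal.rpow_pos (by norm_num) (by norm_num)).ne'
  have hMt : M ≠ ⊤ := ENNReal.rpow_ne_top_of_ne_zero (by norm_num) (by norm_num)
  have hg : tentNorm X₀ g ≤ lam * M ^ X₀.j n := le_self_add.trans hgk.le
  have hk : tentNorm X₁ k ≤ lam * M ^ X₁.j n := by
    have h1 : ENNReal.ofReal (2 ^ ((j : ℝ) * (X₀.j n - X₁.j n))) = M ^ (X₀.j n - X₁.j n) := by
      rw [← ENNReal.ofReal_rpow_of_pos two_pos, hM, ← ENNReal.rpow_mul, ENNReal.ofReal_ofNat]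
    have h2 := (le_add_self.trans hgk.le : _ ≤ lam * M ^ X₀.j n)
    have h3 : lam * M ^ X₀.j n = M ^ (X₀.j n - X₁.j n) * (lam * M ^ X₁.j n) := by
      rw [mul_left_comm, ← ENNReal.rpow_add _ _ hM0 hMt, sub_add_cancel]
    rw [h1, h3] at h2
    exact (ENNReal.mul_le_mul_iff_right (ENNReal.rpow_pos (pos_iff_ne_zero.mpr hM0) hMt).ne'
      (ENNReal.rpow_ne_top_of_ne_zero hM0 hMt)).mp h2
  have hsub : {Q : ℤ × (Fin n → ℤ) | ((4 * (C₀ + C₁) + 1 : ℝ≥0) : ℝ≥0∞) * lam <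
      G.e δ (g + k) Q.1 Q.2} ⊆ {Q | C₀ * lam < G.e δ g Q.1 Q.2} ∪
        {Q | C₁ * lam < G.e δ k Q.1 Q.2} := by
    intro Q hQ
    by_contra hcon
    rw [mem_union, not_or] at hcon
    have h1 : G.e δ g Q.1 Q.2 ≤ C₀ * lam := not_lt.mp hcon.1
    have h2 : G.e δ k Q.1 Q.2 ≤ C₁ * lam := not_lt.mp hcon.2
    have hQ' : ((4 * (C₀ + C₁) + 1 : ℝ≥0) : ℝ≥0∞) * lam < G.e δ (g + k) Q.1 Q.2 := hQ
    refine absurd (hQ'.trans_le (G.e_add_le δ g k Q.1 Q.2)) (not_lt.mpr ?_)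
    calc 2 * (G.e δ g Q.1 Q.2 + G.e δ k Q.1 Q.2) ≤ 2 * (C₀ * lam + C₁ * lam) :=
          mul_le_mul_right (add_le_add h1 h2) _
      _ = ((2 * (C₀ + C₁) : ℝ≥0) : ℝ≥0∞) * lam := by push_cast; ring
      _ ≤ _ := by
          refine mul_le_mul_left (ENNReal.coe_le_coe.mpr ?_) _
          have : (0 : ℝ≥0) ≤ C₀ + C₁ := zero_le
          calc 2 * (C₀ + C₁) ≤ 4 * (C₀ + C₁) := by gcongr; norm_num
            _ ≤ _ := le_self_add
  refine (G.weight_mono m hsub).trans ((G.weight_union_le m _ _).trans ?_)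
  refine (add_le_add (hC₀ g lam M h0 hg) (hC₁ k lam M h0 hk)).trans ?_
  rw [← add_mul]
  refine mul_le_mul_left ?_ _
  rw [← ENNReal.coe_add]
  refine ENNReal.coe_le_coe.mpr ?_
  calc C₀ + C₁ = 1 * (C₀ + C₁) := (one_mul _).symm
    _ ≤ 4 * (C₀ + C₁) := by gcongr; norm_num
    _ ≤ _ := le_self_add

end Grid

theorem kFunctional_eq_zero {V : Type*} [AddCommGroup V] {N₀ N₁ : V → ℝ≥0∞} {t : ℝ} (ht : 0 < t)
    {f : V} (h : kFunctional N₀ N₁ t f = 0) (t' : ℝ) : kFunctional N₀ N₁ t' f = 0 := by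
  have h1 : t' ≤ max 1 (t' / t) * t := by
    calc t' = t' / t * t := (div_mul_cancel₀ _ ht.ne').symm
      _ ≤ _ := by gcongr; exact le_max_right _ _
  have h2 := (kFunctional_mono (N₀ := N₀) (N₁ := N₁) h1 f).trans
    (kFunctional_mul_le (le_max_left _ _) f)
  rw [h, mul_zero] at h2
  exact le_antisymm h2 zero_le

namespace Grid

variable {n N : ℕ} (G : Grid n) {c₀ c₁ : ℝ}

theorem two_rpow_ne_zero (a : ℝ) : (2 : ℝ≥0∞) ^ a ≠ 0 :=
  (ENNReal.rpow_pos (by norm_num) (by norm_num)).ne'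

theorem two_rpow_ne_top (a : ℝ) : (2 : ℝ≥0∞) ^ a ≠ ⊤ :=
  ENNReal.rpow_ne_top_of_ne_zero (by norm_num) (by norm_num)

theorem exists_two_rpow_lt (C : ℝ≥0) {ε : ℝ≥0∞} (hε : ε ≠ 0) : ∃ i : ℤ, C * 2 ^ (i : ℝ) < ε := by
  have h1 : Filter.Tendsto (fun k : ℕ => (C : ℝ≥0∞) * (2⁻¹ : ℝ≥0∞) ^ k) Filter.atTop (nhds 0) := by
    have := ENNReal.Tendsto.const_mul (a := (C : ℝ≥0∞)) (ENNReal.tendsto_pow_atTop_nhds_zero_of_lt_one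
      (r := (2⁻¹ : ℝ≥0∞)) (by simp)) (Or.inr ENNReal.coe_ne_top)
    rwa [mul_zero] at this
  obtain ⟨k, hk⟩ := (h1.eventually (eventually_lt_nhds (pos_iff_ne_zero.mpr hε))).exists
  refine ⟨-k, lt_of_eq_of_lt ?_ hk⟩
  push_cast
  rw [ENNReal.rpow_neg, ENNReal.rpow_natCast, ENNReal.inv_pow]

theorem exists_tsum_le_lintegral_kFunctional (hn : 1 ≤ n) {X₀ X₁ : Exponent} (hX₀ : 0 ≤ X₀.j n)
    (hX₁ : 0 ≤ X₁.j n) (hX : X₀.j n ≠ X₁.j n) {m δ : ℝ} (hm : m ≠ 0)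
    (hδ₀ : δ = X₀.θ + m * X₀.j n) (hδ₁ : δ = X₁.θ + m * X₁.j n) {η : ℝ} (hη₀ : 0 < η)
    {P : ℝ} (hP : 0 < P) (hPη : P * ((1 - η) * X₀.j n + η * X₁.j n) = 1) :
    ∃ C : ℝ≥0, ∀ f : L0 n N, ∑' l : ℤ, G.R ^ ((l : ℝ) * m) * ∫⁻ x, G.e δ f l (G.cz l x) ^ P ≤
      C * ∫⁻ t in Ioi (0 : ℝ), ENNReal.ofReal t⁻¹ *
        (ENNReal.ofReal (t ^ (-η)) * kFunctional (tentNorm X₀) (tentNorm X₁) t f) ^ P := by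
  classical
  obtain ⟨C, hC0, hC⟩ := G.exists_weight_le_kFunctional (N := N) hn hX₀ hX₁ hm hδ₀ hδ₁
  set y₀ := X₀.j n with hy₀
  set y₁ := X₁.j n with hy₁
  set σ := y₀ - y₁ with hσ
  have hσ0 : σ ≠ 0 := sub_ne_zero.mpr hX
  obtain ⟨C₂, hC₂⟩ := exists_tsum_kFunctional_le (ρ := 2) one_lt_two hσ0 hη₀ hP
  have hC0' : (C : ℝ≥0∞) ≠ 0 := ENNReal.coe_ne_zero.mpr hC0
  set D : ℝ≥0 := Real.toNNReal (2 ^ |σ|) * 2 ^ y₀ with hD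
  have hD0 : D ≠ 0 := mul_ne_zero (by simpa using Real.rpow_pos_of_pos two_pos _)
    (by positivity)
  refine ⟨C * D ^ P * (2 * C) ^ P * C₂, fun f => ?_⟩
  set K : ℤ → ℝ≥0∞ := fun j => kFunctional (tentNorm X₀) (tentNorm X₁) (2 ^ ((j : ℝ) * σ)) f with hK
  set ν : ℤ × (Fin n → ℤ) → ℝ≥0∞ := fun Q => G.R ^ ((Q.1 : ℝ) * m) * G.V Q.1 with hν
  have hν0 : ∀ Q, ν Q ≠ 0 := fun Q => mul_ne_zero (G.Rpow_ne_zero _) (G.V_ne_zero _)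
  rw [G.tsum_layers_eq_tsum m (fun l z => G.e δ f l z ^ P)]
  by_cases hzero : ∃ j, K j = 0
  · obtain ⟨j₀, hj₀⟩ := hzero
    have hK0 : ∀ j, K j = 0 := fun j => kFunctional_eq_zero (Real.rpow_pos_of_pos two_pos _) hj₀ _
    have hb : ∀ Q : ℤ × (Fin n → ℤ), G.e δ f Q.1 Q.2 = 0 := by
      intro Q
      by_contra hQ
      set a := min (G.e δ f Q.1 Q.2) 1 with ha
      have ha0 : a ≠ 0 := (lt_min (pos_iff_ne_zero.mpr hQ) one_pos).ne'
      have hat : a ≠ ⊤ := ne_top_of_le_ne_top ENNReal.one_ne_top (min_le_right _ _)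
      set lam := (C : ℝ≥0∞)⁻¹ * (a / 2) with hlam
      have hlam0 : lam ≠ 0 := mul_ne_zero (ENNReal.inv_ne_zero.mpr ENNReal.coe_ne_top)
        (ENNReal.div_pos ha0 (by norm_num)).ne'
      have hmem : C * lam < G.e δ f Q.1 Q.2 := by
        rw [hlam, ← mul_assoc, ENNReal.mul_inv_cancel hC0' ENNReal.coe_ne_top, one_mul]
        exact (ENNReal.half_lt_self ha0 hat).trans_le (min_le_left _ _)
      obtain ⟨i, hi⟩ := exists_two_rpow_lt C (hν0 Q)
      have h1 := hC f i lam hlam0 (by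
        change K i < _
        rw [hK0]
        exact pos_iff_ne_zero.mpr (mul_ne_zero hlam0 (by
          rw [← ENNReal.rpow_mul]; exact two_rpow_ne_zero _)))
      refine absurd (hi.trans_le ?_) (not_lt.mpr h1)
      rw [weight_eq_tsum]
      refine le_trans (le_of_eq ?_) (ENNReal.le_tsum Q)
      rw [if_pos (show Q ∈ {Q : ℤ × (Fin n → ℤ) | C * lam < G.e δ f Q.1 Q.2} from hmem)]
    simp [hb, ENNReal.zero_rpow_of_pos hP]
  · push Not at hzero
    set L : ℤ → ℝ≥0∞ := fun j => (2 * C : ℝ≥0) * (K j * (2 ^ (j : ℝ)) ^ (-y₀)) with hL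
    have h1 := tsum_mul_rpow_le_of_weak (ν := ν) (b := fun Q => G.e δ f Q.1 Q.2) hν0 (L := L)
      (M := fun j => 2 ^ (j : ℝ)) hC0 hD0 hP (fun j => ?_) (fun j => ?_)
      (fun ε hε => exists_two_rpow_lt C hε) (fun j hj => ?_)
    · refine h1.trans ?_
      have h2 : ∀ j : ℤ, L j ^ P * 2 ^ (j : ℝ) = ((2 * C : ℝ≥0) : ℝ≥0∞) ^ P *
          (ENNReal.ofReal ((2 ^ ((j : ℝ) * σ)) ^ (-η)) * K j) ^ P := by
        intro j
        have e1 : ENNReal.ofReal ((2 ^ ((j : ℝ) * σ)) ^ (-η)) = 2 ^ ((j : ℝ) * σ * -η) := by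
          rw [← Real.rpow_mul two_pos.le, ← ENNReal.ofReal_rpow_of_pos two_pos,
            ENNReal.ofReal_ofNat]
        have e2 : ((2 : ℝ≥0∞) ^ ((j : ℝ) * σ * -η)) ^ P =
            ((2 ^ (j : ℝ)) ^ (-y₀)) ^ P * 2 ^ (j : ℝ) := by
          rw [← ENNReal.rpow_mul, ← ENNReal.rpow_mul, ← ENNReal.rpow_mul,
            ← ENNReal.rpow_add _ _ (by norm_num) (by norm_num)]
          congr 1
          rw [hσ]
          linear_combination (j : ℝ) * hPη
        rw [e1, hL, ENNReal.mul_rpow_of_nonneg _ _ hP.le, ENNReal.mul_rpow_of_nonneg _ _ hP.le,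
          ENNReal.mul_rpow_of_nonneg _ _ hP.le, e2]
        ring
      simp only [h2]
      rw [ENNReal.tsum_mul_left]
      calc _ ≤ (C : ℝ≥0∞) * (D : ℝ≥0∞) ^ P * (((2 * C : ℝ≥0) : ℝ≥0∞) ^ P * (C₂ *
            ∫⁻ t in Ioi (0 : ℝ), ENNReal.ofReal t⁻¹ * (ENNReal.ofReal (t ^ (-η)) *
              kFunctional (tentNorm X₀) (tentNorm X₁) t f) ^ P)) :=
            mul_le_mul_right (mul_le_mul_right (hC₂ _ _ _ f) _) _
        _ = _ := by
            rw [ENNReal.coe_mul (C * D ^ P * (2 * C) ^ P), ENNReal.coe_mul _ ((2 * C) ^ P),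
              ENNReal.coe_mul C (D ^ P), ENNReal.coe_rpow_of_nonneg _ hP.le, ENNReal.coe_rpow_of_nonneg _ hP.le]
            ring
    · by_cases hKt : K j = ⊤
      · have hLt : L j = ⊤ := by
          simp only [hL]
          rw [hKt, ENNReal.top_mul (by rw [← ENNReal.rpow_mul]; exact two_rpow_ne_zero _),
            ENNReal.mul_top (ENNReal.coe_ne_zero.mpr (by positivity))]
        simp [hLt]
      · have hlam0 : 2 * (K j * (2 ^ (j : ℝ)) ^ (-y₀)) ≠ 0 := by
          refine mul_ne_zero (by norm_num) (mul_ne_zero (hzero j) ?_)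
          rw [← ENNReal.rpow_mul]; exact two_rpow_ne_zero _
        have h2 := hC f j _ hlam0 (by
          change K j < _
          have e1 : ((2 : ℝ≥0∞) ^ (j : ℝ)) ^ (-y₀) * (2 ^ (j : ℝ)) ^ y₀ = 1 := by
            rw [← ENNReal.rpow_add _ _ (two_rpow_ne_zero _) (two_rpow_ne_top _)]; simp
          calc K j < 2 * K j := by
                rw [two_mul]; exact ENNReal.lt_add_right hKt (hzero j)
            _ = 2 * (K j * (((2 : ℝ≥0∞) ^ (j : ℝ)) ^ (-y₀) * (2 ^ (j : ℝ)) ^ y₀)) := by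
                rw [e1, mul_one]
            _ = _ := by ring)
        rw [weight_eq_tsum] at h2
        refine le_trans (le_of_eq ?_) h2
        refine tsum_congr fun Q => ?_
        have e2 : (C : ℝ≥0∞) * (2 * (K j * (2 ^ (j : ℝ)) ^ (-y₀))) = L j := by
          simp only [hL]; push_cast; ring
        have hiff : Q ∈ {Q : ℤ × (Fin n → ℤ) | C * (2 * (K j * (2 ^ (j : ℝ)) ^ (-y₀))) <
            G.e δ f Q.1 Q.2} ↔ L j < G.e δ f Q.1 Q.2 := by rw [mem_ofPred_eq, e2]
        by_cases hQ : L j < G.e δ f Q.1 Q.2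
        · rw [if_pos hQ, if_pos (hiff.mpr hQ)]
        · rw [if_neg hQ, if_neg (fun h => hQ (hiff.mp h))]
    · have e1 : K j ≤ ENNReal.ofReal (2 ^ |σ|) * K (j + 1) := by
        refine le_trans (kFunctional_mono ?_ f) (kFunctional_mul_le ?_ f)
        · rw [← Real.rpow_add two_pos]
          refine Real.rpow_le_rpow_of_exponent_le one_le_two ?_
          push_cast
          have := neg_abs_le σ
          nlinarith
        · exact Real.one_le_rpow one_le_two (abs_nonneg _)
      have e2 : ((2 : ℝ≥0∞) ^ (j : ℝ)) ^ (-y₀) = 2 ^ y₀ * (2 ^ ((j + 1 : ℤ) : ℝ)) ^ (-y₀) := by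
        rw [← ENNReal.rpow_mul, ← ENNReal.rpow_mul,
          ← ENNReal.rpow_add _ _ (by norm_num) (by norm_num)]
        congr 1; push_cast; ring
      simp only [hL]
      rw [e2]
      calc _ ≤ ((2 * C : ℝ≥0) : ℝ≥0∞) * (ENNReal.ofReal (2 ^ |σ|) * K (j + 1) *
            (2 ^ y₀ * (2 ^ ((j + 1 : ℤ) : ℝ)) ^ (-y₀))) :=
            mul_le_mul_right (mul_le_mul_left e1 _) _
        _ = _ := by
            rw [hD, ENNReal.coe_mul _ (2 ^ y₀), ENNReal.coe_rpow_of_nonneg _ hX₀]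
            simp only [ENNReal.ofReal, ENNReal.coe_ofNat]
            ring
    · rw [← ENNReal.rpow_zero (x := 2)]
      exact ENNReal.rpow_le_rpow_of_exponent_le (by norm_num) (by exact_mod_cast hj)

open Classical in
theorem exists_lintegral_kFunctional_le (hn : 1 ≤ n) {X₀ X₁ : Exponent} (hX₀ : 0 ≤ X₀.j n)
    (hX₁ : 0 ≤ X₁.j n) (hX : X₀.j n ≠ X₁.j n) {m δ : ℝ} (hm : m ≠ 0)
    (hδ₀ : δ = X₀.θ + m * X₀.j n) (hδ₁ : δ = X₁.θ + m * X₁.j n) {η : ℝ} (hη₀ : 0 < η) (hη₁ : η < 1)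
    {P : ℝ} (hP : 0 < P) (hPη : P * ((1 - η) * X₀.j n + η * X₁.j n) = 1) :
    ∃ C : ℝ≥0, ∀ f : L0 n N, ∫⁻ t in Ioi (0 : ℝ), ENNReal.ofReal t⁻¹ *
        (ENNReal.ofReal (t ^ (-η)) * kFunctional (tentNorm X₀) (tentNorm X₁) t f) ^ P ≤
      C * ∑' l : ℤ, G.R ^ ((l : ℝ) * m) * ∫⁻ x, G.e δ f l (G.cz l x) ^ P := by
  obtain ⟨r, hr, hr1, hrP, hrX₀, hrX₁⟩ : ∃ r : ℝ, 0 < r ∧ r ≤ 1 ∧ r ≤ P ∧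
      ENNReal.ofReal r ≤ X₀.i ∧ ENNReal.ofReal r ≤ X₁.i := by
    obtain ⟨r₀, h₀, h₀'⟩ := X₀.exists_ofReal_le_i
    obtain ⟨r₁, h₁, h₁'⟩ := X₁.exists_ofReal_le_i
    refine ⟨min (min 1 P) (min r₀ r₁), by positivity, (min_le_left _ _).trans (min_le_left _ _),
      (min_le_left _ _).trans (min_le_right _ _), le_trans (ENNReal.ofReal_le_ofReal
        ((min_le_right _ _).trans (min_le_left _ _))) h₀', le_trans (ENNReal.ofReal_le_ofReal
        ((min_le_right _ _).trans (min_le_right _ _))) h₁'⟩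
  obtain ⟨B, hB⟩ := G.exists_sparse_majorant hm hP
  obtain ⟨A₀, hA₀⟩ := G.exists_tentNorm_levels_le (N := N) hn hX₀ hr hr1 hrX₀ hm hδ₀ B
  obtain ⟨A₁, hA₁⟩ := G.exists_tentNorm_levels_le (N := N) hn hX₁ hr hr1 hrX₁ hm hδ₁ B
  set A := max A₀ A₁ with hA
  set y₀ := X₀.j n with hy₀
  set y₁ := X₁.j n with hy₁
  set σ := y₀ - y₁ with hσ
  have hσ0 : σ ≠ 0 := sub_ne_zero.mpr hX
  obtain ⟨C₁, hC₁⟩ := exists_lacunary_majorant hP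
  have hq : ((2 : ℝ≥0∞) ^ (-(P / 2))) ^ |σ| < 1 := ENNReal.rpow_lt_one
    (ENNReal.rpow_lt_one_of_one_lt_of_neg (by norm_num) (by linarith)) (abs_pos.mpr hσ0)
  obtain ⟨C₂, hC₂⟩ := exists_lintegral_le_of_lacunary hq hη₀ hη₁ hr hrP
  refine ⟨max 1 (C₂ * (A ^ (1 / r)) ^ P * C₁ * B), fun f => ?_⟩
  set S := ∑' l : ℤ, G.R ^ ((l : ℝ) * m) * ∫⁻ x, G.e δ f l (G.cz l x) ^ P with hS
  by_cases hSt : S = ⊤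
  · rw [hSt, ENNReal.mul_top]
    · exact le_top
    · exact ENNReal.coe_ne_zero.mpr (lt_of_lt_of_le one_pos (le_max_left _ _)).ne'
  obtain ⟨β, hβ, hβS, hβC⟩ := hB (G.e δ f)
  have hβt : ∀ l z, β l z ≠ ⊤ := by
    intro l z hcon
    have h1 : ∑' l : ℤ, G.R ^ ((l : ℝ) * m) * ∫⁻ x, β l (G.cz l x) ^ P ≠ ⊤ :=
      ne_top_of_le_ne_top (ENNReal.mul_ne_top ENNReal.coe_ne_top hSt) hβS
    rw [G.tsum_layers_eq_tsum m (fun l z => β l z ^ P)] at h1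
    refine h1 (top_unique (le_trans (le_of_eq ?_) (ENNReal.le_tsum (l, z))))
    simp only [hcon, ENNReal.top_rpow_of_pos hP]
    rw [ENNReal.mul_top (mul_ne_zero (G.Rpow_ne_zero _) (G.V_ne_zero _))]
  obtain ⟨E, hE⟩ : ∃ E : ℤ → Set (ℤ × (Fin n → ℤ)), ∀ i l z, (l, z) ∈ E i ↔
      (2 ^ (i : ℝ) < β l z ∧ β l z ≤ 2 ^ ((i : ℝ) + 1)) :=
    ⟨fun i => {Q | 2 ^ (i : ℝ) < β Q.1 Q.2 ∧ β Q.1 Q.2 ≤ 2 ^ ((i : ℝ) + 1)}, fun _ _ _ => Iff.rfl⟩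
  have hEC : ∀ i (x : EuclideanSpace ℝ (Fin n)) (R : ℝ), 0 < R → ∑' l, (if G.h l ≤ R then
        ∫⁻ y in Metric.ball x (2 * R), (if (l, G.cz l y) ∈ E i then 1 else 0) else 0) ≤
          B * volume (Metric.ball x R) := by
    intro i x R hR
    refine le_trans (le_of_eq ?_) (hβC i x R hR)
    refine tsum_congr fun l => ?_
    congr 1
    exact lintegral_congr fun y => if_congr (hE i l _) rfl rfl
  have hcover : ∀ l z, G.e δ f l z ≠ 0 → ∃ i : ℤ, (l, z) ∈ E i ∧
      G.e δ f l z ≤ 2 ^ ((i : ℝ) + 1) := by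
    intro l z h0
    have h1 : β l z ≠ 0 := (lt_of_lt_of_le (pos_iff_ne_zero.mpr h0) (hβ l z)).ne'
    obtain ⟨i, hi1, hi2⟩ := ENNReal.exists_mem_Ioc_zpow h1 (hβt l z) (y := 2) (by norm_num)
      (by norm_num)
    rw [← ENNReal.rpow_intCast] at hi1 hi2
    push_cast at hi2
    exact ⟨i, (hE i l z).mpr ⟨hi1, hi2⟩, (hβ l z).trans hi2⟩
  set ν : ℤ → ℝ≥0∞ := fun i => G.weight m (E i) with hν
  have hνS : ∑' i : ℤ, 2 ^ ((i : ℝ) * P) * ν i ≤ B * S := by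
    refine le_trans ?_ hβS
    rw [G.tsum_layers_eq_tsum m (fun l z => β l z ^ P)]
    simp only [hν, weight_eq_tsum, ← ENNReal.tsum_mul_left]
    rw [ENNReal.tsum_comm]
    refine ENNReal.tsum_le_tsum fun Q => ?_
    by_cases hQ : ∃ i, Q ∈ E i
    · obtain ⟨i, hi⟩ := hQ
      have hi' := (hE i Q.1 Q.2).mp hi
      have huniq : ∀ k, k ≠ i → Q ∉ E k := by
        intro k hk hk'
        have hk'' := (hE k Q.1 Q.2).mp hk'
        have e1 : ∀ a b : ℤ, (2 : ℝ≥0∞) ^ (a : ℝ) < 2 ^ ((b : ℝ) + 1) → a ≤ b := by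
          intro a b hab
          have h3 : (a : ℝ) < (b : ℝ) + 1 := by
            by_contra! hcon
            exact absurd hab (not_lt.mpr (ENNReal.rpow_le_rpow_of_exponent_le (by norm_num) hcon))
          exact Int.lt_add_one_iff.mp (by exact_mod_cast h3)
        exact hk (le_antisymm (e1 _ _ (hk''.1.trans_le hi'.2)) (e1 _ _ (hi'.1.trans_le hk''.2)))
      rw [tsum_eq_single i (fun k hk => by rw [if_neg (huniq k hk), mul_zero]), if_pos hi, mul_comm]
      refine mul_le_mul_right ?_ _
      rw [ENNReal.rpow_mul]
      exact ENNReal.rpow_le_rpow hi'.1.le hP.le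
    · push Not at hQ
      simp [hQ]
  have hpieces : ∀ A' A'' : Set ℤ, A'' = A'ᶜ → ∃ g k : L0 n N, g + k = f ∧
      tentNorm X₀ g ^ r ≤ A₀ * (∑' i : ℤ, if i ∈ A' then (2 ^ (i : ℝ) * ν i ^ y₀) ^ r else 0) ∧
      tentNorm X₁ k ^ r ≤ A₁ * (∑' i : ℤ, if i ∈ A'' then (2 ^ (i : ℝ) * ν i ^ y₁) ^ r else 0) := by
    intro A' A'' hA''
    refine ⟨G.cut f (⋃ i ∈ A', E i), G.cut f (⋃ i ∈ A', E i)ᶜ, G.cut_add_cut_compl _ _,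
      hA₀ _ _ _ (fun l z h0 => ?_) hEC, hA₁ _ _ _ (fun l z h0 => ?_) hEC⟩
    · rw [e_cut] at h0 ⊢
      by_cases hm : (l, z) ∈ ⋃ i ∈ A', E i
      · rw [if_pos hm]
        obtain ⟨i, hi, hiE⟩ := mem_iUnion₂.mp hm
        exact ⟨i, hi, hiE, (hβ l z).trans ((hE i l z).mp hiE).2⟩
      · rw [if_neg hm] at h0; exact absurd rfl h0
    · rw [e_cut] at h0 ⊢
      by_cases hm : (l, z) ∈ (⋃ i ∈ A', E i)ᶜ
      · rw [if_pos hm] at h0 ⊢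
        obtain ⟨i, hiE, hi⟩ := hcover l z h0
        refine ⟨i, ?_, hiE, hi⟩
        rw [hA'']
        exact fun hiA => hm (mem_iUnion₂.mpr ⟨i, hiA, hiE⟩)
      · rw [if_neg hm] at h0; exact absurd rfl h0
  by_cases hν0 : ∑' i : ℤ, 2 ^ ((i : ℝ) * P) * ν i = 0
  · have hE0 : ∀ i, E i = ∅ := by
      intro i
      have h1 : ν i = 0 := (mul_eq_zero.mp (ENNReal.tsum_eq_zero.mp hν0 i)).resolve_left
        (two_rpow_ne_zero _)
      simp only [hν, weight_eq_tsum] at h1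
      rw [ENNReal.tsum_eq_zero] at h1
      rw [eq_empty_iff_forall_notMem]
      intro Q hQ
      have h2 := h1 Q
      rw [if_pos hQ] at h2
      exact mul_ne_zero (G.Rpow_ne_zero _) (G.V_ne_zero _) h2
    have hf0 : ∀ (𝒢 : Set (ℤ × (Fin n → ℤ))) l z, G.e δ (G.cut f 𝒢) l z = 0 := by
      intro 𝒢 l z
      rw [e_cut]
      split_ifs
      · by_contra h0
        obtain ⟨i, hi, -⟩ := hcover l z h0
        rw [hE0] at hi
        exact hi
      · rfl
    have hK0 : ∀ t, kFunctional (tentNorm X₀) (tentNorm X₁) t f = 0 := by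
      intro t
      have h0 : tentNorm X₀ (G.cut f ∅) = 0 := by
        have := hA₀ (G.cut f ∅) ∅ E (fun l z h => absurd (hf0 _ l z) h) hEC
        simpa [hr.not_gt, hr] using this
      have h1 : tentNorm X₁ (G.cut f ∅ᶜ) = 0 := by
        have := hA₁ (G.cut f ∅ᶜ) ∅ E (fun l z h => absurd (hf0 _ l z) h) hEC
        simpa [hr.not_gt, hr] using this
      have h2 := kFunctional_le (N₀ := tentNorm X₀) (N₁ := tentNorm X₁) t (G.cut f ∅)
        (G.cut f ∅ᶜ)
      rw [G.cut_add_cut_compl, h0, h1, mul_zero, add_zero] at h2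
      exact le_antisymm h2 zero_le
    simp [hK0, ENNReal.zero_rpow_of_pos hP]
  · obtain ⟨ν', hνν', hlac, hν'S⟩ := hC₁ ν hν0
      (ne_top_of_le_ne_top (ENNReal.mul_ne_top ENNReal.coe_ne_top hSt) hνS)
    have hlac' := hlac.rpow hσ0
    set u : ℤ → ℝ≥0∞ := fun i => 2 ^ (i : ℝ) * ν' i ^ ((1 - η) * y₀ + η * y₁) with hu
    have hu₀ : ∀ i, (ν' i ^ σ) ^ η * u i = 2 ^ (i : ℝ) * ν' i ^ y₀ := by
      intro i
      rw [hu, mul_left_comm, ← ENNReal.rpow_mul, ← ENNReal.rpow_add _ _ (hlac.ne_zero i)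
        (hlac.ne_top i)]
      congr 2; rw [hσ]; ring
    have hu₁ : ∀ i, (ν' i ^ σ) ^ (η - 1) * u i = 2 ^ (i : ℝ) * ν' i ^ y₁ := by
      intro i
      rw [hu, mul_left_comm, ← ENNReal.rpow_mul, ← ENNReal.rpow_add _ _ (hlac.ne_zero i)
        (hlac.ne_top i)]
      congr 2; rw [hσ]; ring
    have huP : ∀ i, u i ^ P = 2 ^ ((i : ℝ) * P) * ν' i := by
      intro i
      rw [hu, ENNReal.mul_rpow_of_nonneg _ _ hP.le, ← ENNReal.rpow_mul, ← ENNReal.rpow_mul,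
        mul_comm _ P, mul_comm _ P, hPη, ENNReal.rpow_one]
    have hterm : ∀ (A' : Set ℤ) {y : ℝ}, 0 ≤ y →
        (∑' i : ℤ, if i ∈ A' then (2 ^ (i : ℝ) * ν i ^ y) ^ r else 0) ≤
          ∑' i : ℤ, if i ∈ A' then (2 ^ (i : ℝ) * ν' i ^ y) ^ r else 0 := by
      intro A' y hy
      refine ENNReal.tsum_le_tsum fun i => ?_
      split_ifs
      · exact ENNReal.rpow_le_rpow (mul_le_mul_right (ENNReal.rpow_le_rpow (hνν' i) hy) _) hr.le
      · exact le_rfl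
    have h1 := hC₂ (fun i => ν' i ^ σ) _
      (fun t => kFunctional (tentNorm X₀) (tentNorm X₁) t f) hlac'
      (fun t _ => kFunctional_rpow_le_tsum (u := u) hr hr1 (c := A) (fun A' A'' hA'' => by
        obtain ⟨g, k, hgk, hg, hk⟩ := hpieces A' A'' hA''
        refine ⟨g, k, hgk, hg.trans ?_, hk.trans ?_⟩
        · simp only [hu₀]
          exact mul_le_mul' (ENNReal.coe_le_coe.mpr (le_max_left _ _)) (hterm _ hX₀)
        · simp only [hu₁]
          exact mul_le_mul' (ENNReal.coe_le_coe.mpr (le_max_right _ _)) (hterm _ hX₁)) t)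
    refine h1.trans ?_
    simp only [ENNReal.mul_rpow_of_nonneg _ _ hP.le, huP]
    rw [ENNReal.tsum_mul_left]
    calc _ ≤ (C₂ : ℝ≥0∞) * (((A ^ (1 / r) : ℝ≥0) : ℝ≥0∞) ^ P * (C₁ * (B * S))) :=
          mul_le_mul_right (mul_le_mul_right (hν'S.trans (mul_le_mul_right hνS _)) _) _
      _ = ((C₂ * (A ^ (1 / r)) ^ P * C₁ * B : ℝ≥0) : ℝ≥0∞) * S := by
          rw [ENNReal.coe_mul, ENNReal.coe_mul, ENNReal.coe_mul,
            ENNReal.coe_rpow_of_nonneg (A ^ (1 / r)) hP.le]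
          ring
      _ ≤ _ := mul_le_mul_left (ENNReal.coe_le_coe.mpr (le_max_right _ _)) _

end Grid

namespace Grid

variable {n N : ℕ} (G : Grid n) {c₀ c₁ : ℝ}

theorem exists_realInterpNorm_equiv_of_ne (hn : 1 ≤ n) (hc₀ : 0 < c₀) (hc₁ : 1 < c₁)
    (hρ : G.ρ = c₁) (hL : n < c₀ * G.L) {X₀ X₁ : Exponent} (hX₀ : 0 ≤ X₀.j n) (hX₁ : 0 ≤ X₁.j n)
    (hX : X₀.j n ≠ X₁.j n) (hθ : X₀.θ ≠ X₁.θ) {η : ℝ} (hη₀ : 0 < η) (hη₁ : η < 1)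
    {P : ℝ} (hP : 0 < P) (hPη : P * ((1 - η) * X₀.j n + η * X₁.j n) = 1) :
    ∃ C : ℝ≥0, ∀ f : L0 n N,
      realInterpNorm (tentNorm X₀) (tentNorm X₁) η (ENNReal.ofReal P) f ≤
        C * zNorm c₀ c₁ (.finite P hP ((1 - η) * X₀.θ + η * X₁.θ)) f ∧
      zNorm c₀ c₁ (.finite P hP ((1 - η) * X₀.θ + η * X₁.θ)) f ≤
        C * realInterpNorm (tentNorm X₀) (tentNorm X₁) η (ENNReal.ofReal P) f := by
  set sη := (1 - η) * X₀.θ + η * X₁.θ with hsη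
  have hy : X₀.j n - X₁.j n ≠ 0 := sub_ne_zero.mpr hX
  obtain ⟨m, hm⟩ : ∃ m, m = -(X₀.θ - X₁.θ) / (X₀.j n - X₁.j n) := ⟨_, rfl⟩
  have hm0 : m ≠ 0 := by rw [hm]; exact div_ne_zero (neg_ne_zero.mpr (sub_ne_zero.mpr hθ)) hy
  have hm1 : m * (X₀.j n - X₁.j n) = -(X₀.θ - X₁.θ) := by rw [hm, div_mul_cancel₀ _ hy]
  obtain ⟨δ, hδ₀⟩ : ∃ δ, δ = X₀.θ + m * X₀.j n := ⟨_, rfl⟩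
  have hδ₁ : δ = X₁.θ + m * X₁.j n := by linear_combination hδ₀ + hm1
  have hδη : (δ - sη) * P = m := by
    rw [hsη]
    linear_combination P * (1 - η) * hδ₀ + P * η * hδ₁ + m * hPη
  have hsum : ∀ f : L0 n N, ∑' l, ∫⁻ x, G.e sη f l (G.cz l x) ^ P =
      ∑' l : ℤ, G.R ^ ((l : ℝ) * m) * ∫⁻ x, G.e δ f l (G.cz l x) ^ P := by
    intro f
    refine tsum_congr fun l => ?_
    rw [← lintegral_const_mul' _ _ (G.Rpow_ne_top _)]
    refine lintegral_congr fun x => ?_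
    rw [G.e_shift sη δ, ENNReal.mul_rpow_of_nonneg _ _ hP.le, ← ENNReal.rpow_mul, mul_assoc, hδη]
  obtain ⟨A, hA⟩ := G.exists_lintegral_kFunctional_le (N := N) hn hX₀ hX₁ hX hm0 hδ₀ hδ₁ hη₀ hη₁ hP
    hPη
  obtain ⟨B, hB⟩ := G.exists_tsum_le_lintegral_kFunctional (N := N) hn hX₀ hX₁ hX hm0 hδ₀ hδ₁ hη₀
    hP hPη
  obtain ⟨Z₁, hZ₁⟩ := G.exists_zNorm_le (N := N) hc₀ hc₁ hρ sη hP
  obtain ⟨Z₂, hZ₂⟩ := G.exists_le_zNorm (N := N) hc₀ hc₁ hρ hL sη hP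
  refine ⟨max ((A * Z₂) ^ (1 / P)) ((Z₁ * B) ^ (1 / P)), fun f => ⟨?_, ?_⟩⟩
  · refine (le_of_rpow_le hP (C := A * Z₂) ?_).trans
      (mul_le_mul_left (ENNReal.coe_le_coe.mpr (le_max_left _ _)) _)
    rw [realInterpNorm_rpow _ _ η hP, ENNReal.coe_mul, mul_assoc]
    refine (hA f).trans (mul_le_mul_right ?_ _)
    rw [← hsum]; exact hZ₂ f
  · refine (le_of_rpow_le hP (C := Z₁ * B) ?_).trans
      (mul_le_mul_left (ENNReal.coe_le_coe.mpr (le_max_right _ _)) _)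
    rw [realInterpNorm_rpow _ _ η hP, ENNReal.coe_mul, mul_assoc]
    refine (hZ₁ f).trans (mul_le_mul_right ?_ _)
    rw [hsum]; exact hB f

/-- A grid adapted to the Whitney parameters. -/
theorem exists_grid (n : ℕ) (hc₀ : 0 < c₀) (hc₁ : 1 < c₁) :
    ∃ G : Grid n, G.ρ = c₁ ∧ n < c₀ * G.L := by
  obtain ⟨L, hL⟩ := exists_nat_gt (max (n : ℝ) (n / c₀))
  refine ⟨⟨c₁, hc₁, L, by exact_mod_cast (le_max_left _ _).trans_lt hL⟩, rfl, ?_⟩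
  have := (le_max_right _ _).trans_lt hL
  rwa [div_lt_iff₀' hc₀] at this

end Grid

theorem exists_realInterpNorm_equiv {n N : ℕ} (hn : 1 ≤ n) {c₀ c₁ : ℝ} (hc₀ : 0 < c₀)
    (hc₁ : 1 < c₁) {p q : Exponent} (hθ : p.θ ≠ q.θ) (hp : 0 ≤ p.j n) (hq : 0 ≤ q.j n) {η : ℝ}
    (hη₀ : 0 < η) (hη₁ : η < 1) : ∃ C : ℝ≥0, ∀ f : L0 n N,
      realInterpNorm (tentNorm p) (tentNorm q) η (p.interp n q η).i f ≤
        C * zNorm c₀ c₁ (p.interp n q η) f ∧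
      zNorm c₀ c₁ (p.interp n q η) f ≤
        C * realInterpNorm (tentNorm p) (tentNorm q) η (p.interp n q η).i f := by
  obtain ⟨G, hρ, hL⟩ := Grid.exists_grid n hc₀ hc₁
  have hη : 0 < 1 - η := by linarith
  by_cases hpos : 0 < (1 - η) * p.j n + η * q.j n
  · obtain ⟨P, hPdef⟩ : ∃ P, P = 1 / ((1 - η) * p.j n + η * q.j n) := ⟨_, rfl⟩
    have hP : 0 < P := by rw [hPdef]; exact one_div_pos.mpr hpos
    have hPη : P * ((1 - η) * p.j n + η * q.j n) = 1 := by
      rw [hPdef]; exact one_div_mul_cancel hpos.ne'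
    have hint : p.interp n q η = .finite P hP ((1 - η) * p.θ + η * q.θ) := by
      rw [Exponent.interp, Exponent.ofJTheta, dif_pos hpos]
      congr 1
      exact hPdef.symm
    rw [hint]
    change ∃ C : ℝ≥0, ∀ f : L0 n N, realInterpNorm (tentNorm p) (tentNorm q) η
      (ENNReal.ofReal P) f ≤ _ ∧ _ ≤ C * realInterpNorm (tentNorm p) (tentNorm q) η
      (ENNReal.ofReal P) f
    by_cases hX : p.j n = q.j n
    · have hjP : p.j n = 1 / P := by
        rw [eq_div_iff hP.ne']
        linear_combination hPη + P * η * hX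
      have key : ∀ X : Exponent, 0 ≤ X.j n → X.j n = 1 / P → X = .finite P hP X.θ := by
        intro X hX₀ hXP
        cases X with
        | finite a ha s =>
          have h1 : 1 / a = 1 / P := hXP
          obtain rfl : a = P := by simpa using h1
          rfl
        | infinite s α hα =>
          obtain rfl : α = 0 := Exponent.eq_zero_of_j_nonneg hn hX₀
          exfalso
          have h1 : -(0 : ℝ) / n = 1 / P := hXP
          rw [neg_zero, zero_div] at h1
          exact (one_div_pos.mpr hP).ne h1
      have h := G.exists_realInterpNorm_equiv_of_eq_finite (N := N) hc₀ hc₁ hρ hL hP hθ hη₀ hη₁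
      rwa [← key p hp hjP, ← key q hq (hX ▸ hjP)] at h
    · exact G.exists_realInterpNorm_equiv_of_ne hn hc₀ hc₁ hρ hL hp hq hX hθ hη₀ hη₁ hP hPη
  · have h0 : p.j n = 0 ∧ q.j n = 0 := by
      constructor <;> nlinarith [mul_nonneg hη.le hp, mul_nonneg hη₀.le hq]
    have key : ∀ X : Exponent, X.j n = 0 → X = .infinite X.θ 0 le_rfl := by
      intro X hX₀
      cases X with
      | finite a ha s => exact absurd hX₀ (one_div_pos.mpr ha).ne'
      | infinite s α hα =>
        obtain rfl : α = 0 := Exponent.eq_zero_of_j_nonneg hn hX₀.ge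
        rfl
    have hint : p.interp n q η = .infinite ((1 - η) * p.θ + η * q.θ) 0 le_rfl := by
      rw [Exponent.interp, Exponent.ofJTheta, dif_neg hpos]
      congr 1
      rw [h0.1, h0.2]; ring
    rw [hint]
    have h := G.exists_realInterpNorm_equiv_of_eq_infinite (N := N) hc₀ hc₁ hρ hL hθ hη₀ hη₁
    rwa [← key p h0.1, ← key q h0.2] at h

theorem Exponent.i_ne_zero (X : Exponent) : X.i ≠ 0 := by
  cases X with
  | finite p hp s => simpa [Exponent.i] using hp
  | infinite s α hα => exact ENNReal.top_ne_zero

end TentZ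
end

theorem theorem2p30 (n N : ℕ) (hn : 1 ≤ n) (c₀ c₁ : ℝ) (hc₀ : 0 < c₀) (hc₁ : 1 < c₁)
    (p q : TentZ.Exponent) (hθ : p.θ ≠ q.θ) (hp : 0 ≤ p.j n) (hq : 0 ≤ q.j n)
    (η : ℝ) (hη₀ : 0 < η) (hη₁ : η < 1) :
    (TentZ.realInterpSpace (TentZ.tentNorm p) (TentZ.tentNorm q) η (p.interp n q η).i :
        Set (TentZ.L0 n N)) = TentZ.zSpace c₀ c₁ (p.interp n q η) ∧
      ∃ C : ℝ≥0, ∀ f ∈ (TentZ.zSpace c₀ c₁ (p.interp n q η) : Set (TentZ.L0 n N)),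
        TentZ.realInterpNorm (TentZ.tentNorm p) (TentZ.tentNorm q) η (p.interp n q η).i f
            ≤ C * TentZ.zNorm c₀ c₁ (p.interp n q η) f ∧
          TentZ.zNorm c₀ c₁ (p.interp n q η) f
            ≤ C * TentZ.realInterpNorm (TentZ.tentNorm p) (TentZ.tentNorm q) η
              (p.interp n q η).i f := by
  obtain ⟨C, hC⟩ := TentZ.exists_realInterpNorm_equiv (N := N) hn hc₀ hc₁ hθ hp hq hη₀ hη₁
  refine ⟨?_, C, fun f _ => hC f⟩
  ext f
  refine ⟨fun hf => (hC f).2.trans_lt (ENNReal.mul_lt_top ENNReal.coe_lt_top hf.2), fun hf => ?_⟩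
  have h : TentZ.realInterpNorm (TentZ.tentNorm p) (TentZ.tentNorm q) η (p.interp n q η).i f < ⊤ :=
    (hC f).1.trans_lt (ENNReal.mul_lt_top ENNReal.coe_lt_top hf)
  exact ⟨TentZ.exists_of_realInterpNorm_lt_top (TentZ.Exponent.i_ne_zero _) h, h⟩
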